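/- Let $P^{n+1}$ carry homogeneous coordinates with a scalar product $(\cdot,\cdot)$ of signature $(n+1,1)$; let $Q^n=\{(x,x)=0\}$ and let $S^{n+1}_1=\{(x,x)>0\}$ be the de Sitter space. Let $U^n\subset S^{n+1}_1$ be a smooth immersed lightlike hypersurface, i.e. all its tangent hyperplanes are tangent to $Q^n$. Assume that it has constant rank $r<n-1$, i.e. the points of tangency of these hyperplanes with $Q^n$ describe an $r$-dimensional submanifold $V^r$. Put $m=n-r-1\ge 1$. Let $\pi:U^n\to M^r$ be the fibration of $U^n$ by its $(m+1)$-dimensional plane generators $L$, along which the tangent hyperplane is constant, $M^r$ being the $r$-dimensional manifold of generators. Adapted frames. Over open sets of $M^r$ consider smooth frames $A_0,A_p,A_\alpha,A_{n+1}$ ($p$ takes $r$ values, $\alpha$ takes $m+1$ values), where $A_0\in V^r$ is the point of tangency, $A_0,A_p$ span the tangent subspace of $V^r$ at $A_0$, $A_0,A_\alpha$ span $L$, $(A_0,A_{n+1})=-1$, $(A_p,A_q)=g_{pq}$, $(A_\alpha,A_\beta)=g_{\alpha\beta}$, and all other scalar products vanish. Write $dA_\xi=\omega_\xi^\eta A_\eta$.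 The forms $\omega_0^p$ are basis forms on $M^r$. Put $\omega_p^\alpha=\lambda^\alpha_{pq}\omega_0^q$, $\lambda^\alpha=\frac1r g^{pq}\lambda^\alpha_{pq}$, $a^\alpha_{pq}=\lambda^\alpha_{pq}-\lambda^\alpha g_{pq}$. Assume that the matrix $(a^\alpha_{pq})$ (rows $\alpha$, columns $(p,q)$) has constant rank $\rho\ge1$. Let $a$ be the sum of the diagonal minors of order $\rho$ of the matrix $a_\beta^\alpha=g_{\beta\gamma}\,g^{pq}g^{st}a^\gamma_{ps}a^\alpha_{qt}$, define $\mu_p$ by $\frac{da}{2\rho a}+\omega_0^0=\mu_p\omega_0^p$, and put $C_p=A_p+\mu_pA_0$. Then the planes $\Delta_x$ spanned by $x\in U^n$ and the points $C_p$ of the generator of $x$ do not depend on the choice of the adapted frame (the invariant screen distribution). There is exactly one affine connection on $M^r$ such that, in every adapted frame with $A_p\in\Delta$, its connection forms relative to the basis forms $\omega_0^p$ are $\theta_q^p=\omega_q^p-\delta_q^p\omega_0^0$. This connection is smooth and torsion-free. Around every generator there are reduced frames, i.e. adapted frames with $A_p\in\Delta$ and $\lambda^\alpha=0$. In every reduced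 frame one has $\omega_p^\alpha=a^\alpha_{pq}\omega_0^q$, $\omega_p^0=c_{pq}\omega_0^q$ with $a^\alpha_{pq}=a^\alpha_{qp}$, $c_{pq}=c_{qp}$, and the curvature tensor is given by $$d\theta_q^p-\theta_q^s\wedge\theta_s^p=R^p_{qst}\,\omega_0^s\wedge\omega_0^t,$$ $$R^p_{qst}=-g_{\alpha\beta}g^{pu}a^\alpha_{q[s}a^\beta_{t]u}+c_{q[s}\delta^p_{t]}+g_{q[s}g^{pu}c_{t]u},$$ where $h_{[st]}=\frac12(h_{st}-h_{ts})$. The Ricci tensor $R_{pq}=R^s_{pqs}$ is symmetric. -/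

import Mathlib

open scoped Manifold ContDiff LinearAlgebra.Projectivization

noncomputable section

namespace DeSitter

/-! ### The projective model -/

/-- The vector space of homogeneous coordinates of the projective space `P^{n+1}`. -/
abbrev Ambient (n : ℕ) : Type := Fin (n + 2) → ℝ

/-- The scalar product `(x, y) = -x⁰y⁰ + x¹y¹ + ⋯ + xⁿ⁺¹yⁿ⁺¹` of signature `(n+1, 1)`.
The hyperquadric `Q^n` is `(x, x) = 0`; the de Sitter space is the domain `(x, x) > 0`. -/
def form (n : ℕ) : LinearMap.BilinForm ℝ (Ambient n) :=
  Matrix.toBilin' (Matrix.diagonal (Fin.cons (-1) fun _ => 1))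

section Hypersurface

variable {n : ℕ} {r : ℕ}
  {U : Type*} [TopologicalSpace U] [ChartedSpace (EuclideanSpace ℝ (Fin n)) U]
  {M : Type*} [TopologicalSpace M] [ChartedSpace (EuclideanSpace ℝ (Fin r)) M]

/-- `x` is a smooth choice of homogeneous coordinates of `f` on the open set `W`. -/
structure IsSmoothLift (f : U → ℙ ℝ (Ambient n)) (W : Set U) (x : U → Ambient n) : Prop where
  isOpen : IsOpen W
  smooth : ContMDiffOn (𝓡 n) 𝓘(ℝ, Ambient n) ∞ x W
  lift : ∀ u ∈ W, ∃ h : x u ≠ 0, Projectivization.mk ℝ (x u) h = f u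

/-- The linear span of `x` and `dx` at the point `u`: the linear subspace underlying the
projective tangent subspace, at `x(u)`, of the submanifold described by the point `x`. -/
def tangentSpan (x : U → Ambient n) (u : U) : Submodule ℝ (Ambient n) :=
  Submodule.span ℝ {x u} ⊔ LinearMap.range (mvfderiv (𝓡 n) x u).toLinearMap

/-- The tangent hyperplane at `u` of the hypersurface `f` is tangent to the
hyperquadric `Q^n` at the point with homogeneous coordinates `y`, i.e. it is the polar
hyperplane of the point `y` of `Q^n`. -/
def IsTangencyPoint (f : U → ℙ ℝ (Ambient n)) (u : U) (y : Ambient n) : Prop :=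
  y ≠ 0 ∧ form n y y = 0 ∧
    ∀ W x, IsSmoothLift f W x → u ∈ W →
      tangentSpan x u = (form n).orthogonal (Submodule.span ℝ {y})

/-- `f` is a (smooth, immersed) lightlike hypersurface of the de Sitter space. -/
structure IsLightlikeHypersurface (f : U → ℙ ℝ (Ambient n)) : Prop where
  mem_deSitter : ∀ u, ∀ v ∈ (f u).submodule, v ≠ 0 → 0 < form n v v
  exists_lift : ∀ u, ∃ W x, IsSmoothLift f W x ∧ u ∈ W
  immersion : ∀ W x, IsSmoothLift f W x → ∀ u ∈ W, Module.finrank ℝ (tangentSpan x u) = n + 1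
  lightlike : ∀ u, ∃ y, IsTangencyPoint f u y

/-- The hypersurface has rank `r`: its tangent hyperplanes form an `r`-parameter family, that is,
their points of tangency with `Q^n` describe a submanifold of dimension `r`. -/
def HasRank (f : U → ℙ ℝ (Ambient n)) (r : ℕ) : Prop :=
  ∀ (W : Set U) (y : U → Ambient n), IsOpen W → ContMDiffOn (𝓡 n) 𝓘(ℝ, Ambient n) ∞ y W →
    (∀ u ∈ W, IsTangencyPoint f u (y u)) →
    ∀ u ∈ W, Module.finrank ℝ (tangentSpan y u) = r + 1

/-- `gen : U → M` is the fibration of the hypersurface `f` of rank `r` by its plane generators `L`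
of projective dimension `n - r`, along which the tangent hyperplane is constant; `M` is the
`r`-dimensional manifold of generators. -/
structure IsGeneratorFibration (f : U → ℙ ℝ (Ambient n)) (gen : U → M) : Prop where
  submersion : Manifold.IsSubmersion (𝓡 n) (𝓡 r) ∞ gen
  surjective : Function.Surjective gen
  plane : ∀ p, ∃ L : Submodule ℝ (Ambient n), Module.finrank ℝ L + r = n + 1 ∧
    ∀ u, gen u = p → (f u).submodule ≤ L
  tangent_const : ∀ u u', gen u = gen u' → ∀ y, IsTangencyPoint f u y → IsTangencyPoint f u' y

end Hypersurface

/-! ### Moving frames over the manifold of generators -/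

/-- Indices of the vertices `A_0`, `A_p` (`r` of them), `A_α` (`k` of them), `A_{n+1}`. -/
abbrev FrameIndex (r k : ℕ) : Type := Unit ⊕ Fin r ⊕ Fin k ⊕ Unit

/-- The index of `A_0`. -/
abbrev ixO {r k : ℕ} : FrameIndex r k := Sum.inl ()
/-- The index of `A_p`. -/
abbrev ixP {r k : ℕ} (p : Fin r) : FrameIndex r k := Sum.inr (Sum.inl p)
/-- The index of `A_α`. -/
abbrev ixA {r k : ℕ} (α : Fin k) : FrameIndex r k := Sum.inr (Sum.inr (Sum.inl α))
/-- The index of `A_{n+1}`. -/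
abbrev ixL {r k : ℕ} : FrameIndex r k := Sum.inr (Sum.inr (Sum.inr ()))

section Frames

variable {n r k : ℕ}
  {U : Type*} [TopologicalSpace U] [ChartedSpace (EuclideanSpace ℝ (Fin n)) U]
  {M : Type*} [TopologicalSpace M] [ChartedSpace (EuclideanSpace ℝ (Fin r)) M]

/-- A field of frames `{A_0, A_p, A_α, A_{n+1}}` over `M`. -/
abbrev FrameField (n r k : ℕ) (M : Type*) : Type _ :=
  M → Module.Basis (FrameIndex r k) ℝ (Ambient n)

variable (A : FrameField n r k M)

/-- The forms `ω_ξ^η` of infinitesimal displacement of a frame: `dA_ξ = ω_ξ^η A_η`. -/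
def omega (ξ η : FrameIndex r k) (x : M) : TangentSpace (𝓡 r) x →L[ℝ] ℝ :=
  (LinearMap.toContinuousLinearMap ((A x).coord η)).comp (mvfderiv (𝓡 r) (fun y => A y ξ) x)

/-- The basis forms `ω_0^p`, together. -/
def coframe (x : M) : TangentSpace (𝓡 r) x →L[ℝ] (Fin r → ℝ) :=
  ContinuousLinearMap.pi fun p => omega A ixO (ixP p) x

/-- The vector fields `e_q` dual to the basis forms: `ω_0^p(e_q) = δ^p_q`. -/
def dualFrame (q : Fin r) (x : M) : TangentSpace (𝓡 r) x :=
  (coframe A x).inverse (Pi.single q 1)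

/-- The matrix `g_{pq} = (A_p, A_q)`. -/
def gP (x : M) : Matrix (Fin r) (Fin r) ℝ :=
  Matrix.of fun p q => form n (A x (ixP p)) (A x (ixP q))

/-- The matrix `g_{αβ} = (A_α, A_β)`. -/
def gA (x : M) : Matrix (Fin k) (Fin k) ℝ :=
  Matrix.of fun α β => form n (A x (ixA α)) (A x (ixA β))

/-- The coefficients `λ^α_{pq}` in `ω_p^α = λ^α_{pq} ω_0^q`. -/
def lam (x : M) (α : Fin k) (p q : Fin r) : ℝ := omega A (ixP p) (ixA α) x (dualFrame A q x)

/-- `λ^α = (1/r) g^{pq} λ^α_{pq}`. -/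
def lamMean (x : M) (α : Fin k) : ℝ :=
  (1 / (r : ℝ)) * ∑ p, ∑ q, (gP A x)⁻¹ p q * lam A x α p q

/-- The tensor `a^α_{pq} = λ^α_{pq} - λ^α g_{pq}`. -/
def aTensor (x : M) (α : Fin k) (p q : Fin r) : ℝ := lam A x α p q - lamMean A x α * gP A x p q

/-- The rectangular matrix `A = (a^α_{pq})`, with rows `α` and columns `(p, q)`. -/
def aMatrix (x : M) : Matrix (Fin k) (Fin r × Fin r) ℝ :=
  Matrix.of fun α pq => aTensor A x α pq.1 pq.2

/-- `a^{αβ} = g^{pq} g^{st} a^α_{ps} a^β_{qt}`. -/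
def aUp (x : M) (α β : Fin k) : ℝ :=
  ∑ p, ∑ q, ∑ s, ∑ t, (gP A x)⁻¹ p q * (gP A x)⁻¹ s t * aTensor A x α p s * aTensor A x β q t

/-- `a_β^α = g_{βγ} a^{γα}`, in row `β` and column `α`. -/
def aMixed (x : M) : Matrix (Fin k) (Fin k) ℝ :=
  Matrix.of fun β α => ∑ γ, gA A x β γ * aUp A x γ α

/-- The relative invariant `a`: the sum of the diagonal minors of order `ρ` of `(a_β^α)`. -/
def aInvariant (ρ : ℕ) (x : M) : ℝ :=
  ∑ S ∈ Finset.powersetCard ρ (Finset.univ : Finset (Fin k)),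
    ((aMixed A x).submatrix (Subtype.val : S → Fin k) (Subtype.val : S → Fin k)).det

/-- The coefficients `μ_p` in `da / (2ρa) + ω_0^0 = μ_p ω_0^p`. -/
def mu (ρ : ℕ) (x : M) (p : Fin r) : ℝ :=
  mvfderiv (𝓡 r) (aInvariant A ρ) x (dualFrame A p x) / (2 * ρ * aInvariant A ρ x) +
    omega A ixO ixO x (dualFrame A p x)

/-- The points `C_p = A_p + μ_p A_0`. -/
def pointC (ρ : ℕ) (x : M) (p : Fin r) : Ambient n := A x (ixP p) + mu A ρ x p • A x ixO

/-- The coefficients `c_{pq}` in `ω_p^0 = c_{pq} ω_0^q`. -/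
def cTensor (x : M) (p q : Fin r) : ℝ := omega A (ixP p) ixO x (dualFrame A q x)

/-- The forms `θ_q^p = ω_q^p - δ_q^p ω_0^0`. -/
def theta (q p : Fin r) (x : M) : TangentSpace (𝓡 r) x →L[ℝ] ℝ :=
  omega A (ixP q) (ixP p) x - (if q = p then (1 : ℝ) else 0) • omega A ixO ixO x

/-- The quantities `R^p_{qst} = - g_{αβ} g^{pu} a^α_{q[s} a^β_{t]u} + c_{q[s} δ^p_{t]}
+ g_{q[s} g^{pu} c_{t]u}`, where `h_{[st]} = (h_{st} - h_{ts}) / 2`. -/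
def curvR (x : M) (p q s t : Fin r) : ℝ :=
  - (∑ α, ∑ β, ∑ u, gA A x α β * (gP A x)⁻¹ p u *
      ((aTensor A x α q s * aTensor A x β t u - aTensor A x α q t * aTensor A x β s u) / 2))
  + (cTensor A x q s * (if p = t then (1 : ℝ) else 0)
      - cTensor A x q t * (if p = s then (1 : ℝ) else 0)) / 2
  + ∑ u, (gP A x)⁻¹ p u *
      ((gP A x q s * cTensor A x t u - gP A x q t * cTensor A x s u) / 2)

/-- `A` is a smooth field of frames over the open set `W` of generators of the lightlike
hypersurface `f`, adapted to the hypersurface: `A_0` is the point of tangency of the tangent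
hyperplanes with `Q^n`; the points `A_0, A_p` span the tangent subspace of the submanifold `V^r`
described by `A_0` (i.e. `ω_0^α = 0`), so that `A_0, A_α` span the generator `L`; and the scalar
products are the usual ones, only `g_{pq}` and `g_{αβ}` being left free. -/
structure IsAdaptedFrame (f : U → ℙ ℝ (Ambient n)) (gen : U → M) (W : Set M)
    (A : FrameField n r k M) : Prop where
  isOpen : IsOpen W
  smooth : ∀ ξ, ContMDiffOn (𝓡 r) 𝓘(ℝ, Ambient n) ∞ (fun x => A x ξ) W
  tangency : ∀ u, gen u ∈ W → IsTangencyPoint f u (A (gen u) ixO)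
  tangent : ∀ x ∈ W, ∀ α, omega A ixO (ixA α) x = 0
  form_O_P : ∀ x ∈ W, ∀ p, form n (A x ixO) (A x (ixP p)) = 0
  form_O_A : ∀ x ∈ W, ∀ α, form n (A x ixO) (A x (ixA α)) = 0
  form_O_L : ∀ x ∈ W, form n (A x ixO) (A x ixL) = -1
  form_P_A : ∀ x ∈ W, ∀ p α, form n (A x (ixP p)) (A x (ixA α)) = 0
  form_P_L : ∀ x ∈ W, ∀ p, form n (A x (ixP p)) (A x ixL) = 0
  form_A_L : ∀ x ∈ W, ∀ α, form n (A x (ixA α)) (A x ixL) = 0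
  form_L_L : ∀ x ∈ W, form n (A x ixL) (A x ixL) = 0

/-- The matrix `A = (a^α_{pq})` has rank `ρ` along all generators. The number `k` of the points
`A_α` is an explicit argument. -/
def HasTensorRank (k : ℕ) (f : U → ℙ ℝ (Ambient n)) (gen : U → M) (ρ : ℕ) : Prop :=
  ∀ (W : Set M) (A : FrameField n r k M), IsAdaptedFrame f gen W A →
    ∀ x ∈ W, (aMatrix A x).rank = ρ

/-- `Δ` is the invariant screen distribution: at each point `u` of the hypersurface, the screen is
the plane spanned by the point `f u` and the normalizing subspace `ζ = C_{1} ∧ … ∧ C_{r}`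
of its generator, whatever adapted frame is used. -/
def IsInvariantScreen (k : ℕ) (f : U → ℙ ℝ (Ambient n)) (gen : U → M) (ρ : ℕ)
    (Δ : U → Submodule ℝ (Ambient n)) : Prop :=
  ∀ (W : Set M) (A : FrameField n r k M), IsAdaptedFrame f gen W A →
    ∀ u, gen u ∈ W →
      Δ u = (f u).submodule ⊔ Submodule.span ℝ (Set.range (pointC A ρ (gen u)))

/-- The vertices `A_p` of the adapted frame lie in the screens of `Δ`. -/
def IsScreenAdapted (gen : U → M) (Δ : U → Submodule ℝ (Ambient n)) (W : Set M)
    (A : FrameField n r k M) : Prop :=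
  ∀ u, gen u ∈ W → ∀ p, A (gen u) (ixP p) ∈ Δ u

/-- A reduced frame: the points `A_p` lie in the screens, and the points `A_α` lie in the
harmonic polar of `A_0` with respect to the focal submanifold of the generator
(i.e. `λ^α = 0`, so that `λ^α_{pq} = a^α_{pq}`). -/
structure IsReducedFrame (f : U → ℙ ℝ (Ambient n)) (gen : U → M)
    (Δ : U → Submodule ℝ (Ambient n)) (W : Set M) (A : FrameField n r k M) : Prop where
  adapted : IsAdaptedFrame f gen W A
  screen : IsScreenAdapted gen Δ W A
  polar : ∀ x ∈ W, ∀ α, lamMean A x α = 0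

end Frames

/-! ### Affine connections -/

section Connection

variable {n r : ℕ}
  {U : Type*} [TopologicalSpace U] [ChartedSpace (EuclideanSpace ℝ (Fin n)) U]
  {M : Type*} [TopologicalSpace M] [ChartedSpace (EuclideanSpace ℝ (Fin r)) M]
  [IsManifold (𝓡 r) ∞ M]

/-- An affine connection on `M`. Mathlib's convention is `∇ Y x (X x) = (∇_X Y)(x)`. -/
abbrev AffineConnection (r : ℕ) (M : Type*) [TopologicalSpace M]
    [ChartedSpace (EuclideanSpace ℝ (Fin r)) M] [IsManifold (𝓡 r) ∞ M] : Type _ :=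
  CovariantDerivative (𝓡 r) (EuclideanSpace ℝ (Fin r)) (TangentSpace (𝓡 r) : M → Type _)

/-- The vector field `X` is smooth on the open set `W`. -/
def IsSmoothFieldOn (W : Set M) (X : Π x : M, TangentSpace (𝓡 r) x) : Prop :=
  ContMDiffOn (𝓡 r) (𝓡 r).tangent ∞ (fun x => (⟨x, X x⟩ : TangentBundle (𝓡 r) M)) W

/-- `∇` is the connection induced by the screen distribution `Δ` on the fibration of plane
generators: in every adapted frame whose points `A_p` lie in the screens, its connection forms
relative to the basis forms `ω_0^p` are the forms `θ_q^p`, that is, `∇ e_q = θ_q^p e_p`. -/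
def IsInducedConnection (k : ℕ) (f : U → ℙ ℝ (Ambient n)) (gen : U → M)
    (Δ : U → Submodule ℝ (Ambient n)) (nab : AffineConnection r M) : Prop :=
  ∀ (W : Set M) (A : FrameField n r k M), IsAdaptedFrame f gen W A → IsScreenAdapted gen Δ W A →
    ∀ x ∈ W, ∀ (q : Fin r) (v : TangentSpace (𝓡 r) x),
      nab (dualFrame A q) x v = ∑ p, theta A q p x v • dualFrame A p x

/-- `R(X, Y)Z = ∇_X ∇_Y Z - ∇_Y ∇_X Z - ∇_{[X, Y]} Z`. -/
def curvature (nab : AffineConnection r M) (X Y Z : Π x : M, TangentSpace (𝓡 r) x) (x : M) :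
    TangentSpace (𝓡 r) x :=
  nab (fun y => nab Z y (Y y)) x (X x) - nab (fun y => nab Z y (X y)) x (Y x)
    - nab Z x (VectorField.mlieBracket (𝓡 r) X Y x)

/-- `R(u, v)w` for tangent vectors at `x`, computed with smooth extensions to vector fields. -/
def curvatureAt (nab : AffineConnection r M) (x : M) (u v w : TangentSpace (𝓡 r) x) :
    TangentSpace (𝓡 r) x :=
  curvature nab (FiberBundle.extend (EuclideanSpace ℝ (Fin r)) u)
    (FiberBundle.extend (EuclideanSpace ℝ (Fin r)) v)
    (FiberBundle.extend (EuclideanSpace ℝ (Fin r)) w) x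

/-- The Ricci tensor `Ric(w, u) = tr (v ↦ R(u, v)w)`, the trace being computed in the
standard basis of the model space of the tangent spaces. -/
def ricci (nab : AffineConnection r M) (x : M) (w u : TangentSpace (𝓡 r) x) : ℝ :=
  ∑ i : Fin r,
    (show EuclideanSpace ℝ (Fin r) from
      curvatureAt nab x u (EuclideanSpace.single i (1 : ℝ) : EuclideanSpace ℝ (Fin r)) w) i

end Connection

end DeSitter

end

noncomputable section
namespace DeSitter

/-! ### The Lorentzian scalar product -/

section Form
variable {n : ℕ}

/-! The homogeneous coordinates of the point of tangency `A_0` are given only up to a factor, and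
the proof rests on fixing that factor. If `A'_0 = σ A_0`, then in any two adapted frames containing
these points the matrices `(a_β^α)` are, up to the factor `σ⁻²`, conjugate, so `a` is multiplied by
`σ^(-2ρ)` (`aInvariant_change`). Moreover `a > 0`, because `a` is a sum of principal minors of order
`ρ` of a product of Gram-type matrices, and `ρ` is the rank (`sumMinors_pos`). Hence `Y = ±
a^(1/(2ρ)) A_0`, with the sign that makes the time coordinate positive, does not depend on the
frame: it is a smooth map from `M` to the light cone (`exists_isNormalizedLift`).

Write `Y = c A_0`. Differentiation gives `dY(e_p) = c C_p`, so the points `C_p` span the image of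
`dY`, which is why the screen is invariant. The scalar product is positive semidefinite on the
hyperplane polar to `Y`, with kernel `Y`, and the rank condition makes `dY` injective modulo `Y`.
Thus `Y` pulls the scalar product back to a Riemannian metric on `M`.

If the `A_p` lie in the screens, then `μ_p = 0`, so `dY(e_p) = c A_p` and `dc = -c ω_0^0`.
Consequently `d(dY(e_q)) = c (dA_q - ω_0^0 A_q)`, and its orthogonal projection to the image of `dY`
is `dY(θ_q^p e_p)`. The induced connection is therefore the Levi-Civita connection of the metric: it
is smooth and torsion-free, and it is unique because the `e_q` span the tangent spaces.

The curvature comes from the Gauss equation for `Y` (`IsSpacelike.form_curvature`). The normal part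
of `d(dY(e_q))` is `c (ω_q^0 A_0 + ω_q^α A_α + ω_q^{n+1} A_{n+1})` with `ω_q^{n+1} = g_{qs} ω_0^s`.
The products of the `A_α` give the terms in `a`, and the product `(A_0, A_{n+1}) = -1` gives the
terms in `c_{pq}`. The symmetry of `a^α_{pq}` and `c_{pq}` expresses that second derivatives of `Y`
commute, and the symmetry of the Ricci tensor then follows by contraction.

Adapted frames exist because `gen` has local sections, along which the tangent hyperplanes vary
smoothly (`exists_isTangencyLift`, `IsTangencyLift.exists_adaptedFrame`). -/

theorem form_apply (x y : Ambient n) :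
    form n x y = - (x 0 * y 0) + ∑ i : Fin (n + 1), x i.succ * y i.succ := by
  rw [form, Matrix.toBilin'_apply']
  simp [dotProduct, Matrix.mulVec_diagonal, Fin.sum_univ_succ]

theorem form_comm (x y : Ambient n) : form n x y = form n y x := by
  rw [form_apply, form_apply]
  congr 1
  · ring
  · exact Finset.sum_congr rfl fun _ _ => mul_comm _ _

/-- The scalar product as a continuous bilinear map. -/
def formL (n : ℕ) : Ambient n →L[ℝ] Ambient n →L[ℝ] ℝ :=
  LinearMap.toContinuousLinearMap
    ((LinearMap.toContinuousLinearMap (𝕜 := ℝ) (E := Ambient n) (F' := ℝ)).toLinearMap ∘ₗ form n)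

@[simp] theorem formL_apply (x y : Ambient n) : formL n x y = form n x y := rfl

theorem eq_zero_of_form_eq_zero {x : Ambient n} (h : ∀ y, form n x y = 0) : x = 0 := by
  ext i
  refine Fin.cases ?_ (fun j => ?_) i
  · have := h (Pi.single 0 1)
    rw [form_apply] at this
    simpa [Pi.single_apply, Fin.succ_ne_zero] using this
  · have := h (Pi.single j.succ 1)
    rw [form_apply] at this
    simpa [Pi.single_apply, (Fin.succ_ne_zero j).symm] using this

theorem form_nondegenerate (n : ℕ) : (form n).Nondegenerate :=
  (LinearMap.IsSymm.isRefl ⟨fun x y => form_comm x y⟩).nondegenerate_iff_separatingLeft.2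
    fun _ h => eq_zero_of_form_eq_zero h

/-- With vanishing time coordinate the form is a sum of squares. This is used both to project along
an isotropic vector and to give it a sign. -/
theorem time_ne_zero {y : Ambient n} (hy : y ≠ 0) (hyy : form n y y = 0) : y 0 ≠ 0 := by
  intro h0
  apply hy
  rw [form_apply, h0] at hyy
  have h : ∑ i : Fin (n + 1), y i.succ * y i.succ = 0 := by simpa using hyy
  rw [Finset.sum_eq_zero_iff_of_nonneg fun _ _ => mul_self_nonneg _] at h
  ext i
  refine Fin.cases h0 (fun j => ?_) i
  simpa using h j (Finset.mem_univ j)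

/-- The scalar product is positive semidefinite on the hyperplane polar to a point of `Q^n`, with
kernel this point. -/
theorem form_pos_of_orthogonal {y v : Ambient n} (hy : y ≠ 0) (hyy : form n y y = 0)
    (hyv : form n y v = 0) : 0 ≤ form n v v ∧ (form n v v = 0 → v = (v 0 / y 0) • y) := by
  have h0 := time_ne_zero hy hyy
  -- This multiple of `y` removes the time coordinate of `v` and leaves `(v, v)` unchanged, since
  -- `y` is orthogonal to itself and to `v`.
  set w := v - (v 0 / y 0) • y with hw
  have hw0 : w 0 = 0 := by simp [hw, div_mul_cancel₀ _ h0]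
  have hvv : form n w w = form n v v := by
    simp [hw, hyy, hyv, form_comm v y]
  have hww : form n w w = ∑ i : Fin (n + 1), w i.succ * w i.succ := by
    rw [form_apply, hw0]; simp
  rw [← hvv, hww]
  refine ⟨Finset.sum_nonneg fun _ _ => mul_self_nonneg _, fun h => ?_⟩
  rw [Finset.sum_eq_zero_iff_of_nonneg fun _ _ => mul_self_nonneg _] at h
  have : w = 0 := by
    ext i
    refine Fin.cases hw0 (fun j => ?_) i
    simpa using h j (Finset.mem_univ j)
  exact sub_eq_zero.1 this

end Form

/-! ### Orthogonal projection onto a spacelike image -/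

section PseudoInverse

variable {n : ℕ} {E : Type*} [NormedAddCommGroup E] [NormedSpace ℝ E]

/-- The map `w ↦ (w, G ·)`. -/
def flat (G : E →L[ℝ] Ambient n) : Ambient n →L[ℝ] E →L[ℝ] ℝ :=
  ((ContinuousLinearMap.compL ℝ E (Ambient n) ℝ).flip G).comp (formL n)

@[simp] theorem flat_apply (G : E →L[ℝ] Ambient n) (w : Ambient n) (v : E) :
    flat G w v = form n w (G v) := rfl

/-- The left inverse of an injection `G` with positive definite image given by the orthogonal
projection onto the image. -/
def pinv (G : E →L[ℝ] Ambient n) : Ambient n →L[ℝ] E :=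
  ((flat G).comp G).inverse.comp (flat G)

variable [FiniteDimensional ℝ E]

/-- The map is the Gram operator of `G`: positivity makes it injective, and a space has the
dimension of its dual. Hence `inverse` in `pinv` is a true inverse. -/
theorem isInvertible_flat_comp {G : E →L[ℝ] Ambient n}
    (hG : ∀ v, v ≠ 0 → 0 < form n (G v) (G v)) : ((flat G).comp G).IsInvertible := by
  have hinj : Function.Injective ((flat G).comp G).toLinearMap := by
    rw [← LinearMap.ker_eq_bot, LinearMap.ker_eq_bot']
    intro v hv
    by_contra hne
    have := congrArg (fun f : E →L[ℝ] ℝ => f v) hv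
    exact (hG v hne).ne' (by simpa using this)
  have hdim : Module.finrank ℝ E = Module.finrank ℝ (E →L[ℝ] ℝ) := by
    rw [← (LinearMap.toContinuousLinearMap (𝕜 := ℝ) (E := E) (F' := ℝ)).finrank_eq]
    exact (Subspace.dual_finrank_eq (K := ℝ) (V := E)).symm
  exact ⟨(LinearEquiv.ofInjectiveOfFinrankEq _ hinj hdim).toContinuousLinearEquiv, by ext; rfl⟩

theorem form_pinv {G : E →L[ℝ] Ambient n} (hG : ∀ v, v ≠ 0 → 0 < form n (G v) (G v))
    (w : Ambient n) (v : E) : form n (G (pinv G w)) (G v) = form n w (G v) := by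
  have h := (isInvertible_flat_comp hG).self_apply_inverse (flat G w)
  exact congrArg (fun f : E →L[ℝ] ℝ => f v) h

/-- The difference of two solutions would have an image orthogonal to itself, against positivity. -/
theorem eq_pinv {G : E →L[ℝ] Ambient n} (hG : ∀ v, v ≠ 0 → 0 < form n (G v) (G v))
    {w : Ambient n} {u : E} (h : ∀ v, form n (G u) (G v) = form n w (G v)) : u = pinv G w := by
  by_contra hne
  have h1 := hG (u - pinv G w) (sub_ne_zero.2 hne)
  have h2 := h (u - pinv G w)
  rw [← form_pinv hG w] at h2
  have h3 : form n (G (u - pinv G w)) (G (u - pinv G w)) =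
      form n (G u) (G (u - pinv G w)) - form n (G (pinv G w)) (G (u - pinv G w)) := by
    rw [map_sub G u, map_sub (form n), LinearMap.sub_apply]
  rw [h3, h2, sub_self] at h1
  exact h1.false

omit [FiniteDimensional ℝ E] in
theorem contDiff_flat {k : ℕ∞ω} : ContDiff ℝ k (flat : (E →L[ℝ] Ambient n) → _) := by
  have h : ContDiff ℝ k ((ContinuousLinearMap.compL ℝ E (Ambient n) ℝ).flip) :=
    ContinuousLinearMap.contDiff _
  exact h.clm_comp contDiff_const

/-- `flat` is linear in `G` and inversion is smooth at invertible maps. All smoothness of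
projections and dual frames comes from here. -/
theorem contDiffAt_pinv {G : E →L[ℝ] Ambient n} (hG : ∀ v, v ≠ 0 → 0 < form n (G v) (G v))
    {k : ℕ∞ω} : ContDiffAt ℝ k (pinv : (E →L[ℝ] Ambient n) → _) G := by
  refine ContDiffAt.clm_comp ?_ contDiff_flat.contDiffAt
  have h : ContDiffAt ℝ k (fun G : E →L[ℝ] Ambient n => (flat G).comp G) G :=
    contDiff_flat.contDiffAt.clm_comp contDiffAt_id
  exact ContDiffAt.comp (g := ContinuousLinearMap.inverse) G
    (isInvertible_flat_comp hG).contDiffAt_map_inverse h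

end PseudoInverse

/-! ### Derivatives of vector-valued functions on a manifold -/

section Calculus
open Bundle Topology
variable {r : ℕ} {M : Type*} [TopologicalSpace M] [ChartedSpace (EuclideanSpace ℝ (Fin r)) M]
  {F : Type*} [NormedAddCommGroup F] [NormedSpace ℝ F]

theorem mvfderiv_congr {y z : M → F} {x : M} (h : y =ᶠ[𝓝 x] z) :
    mvfderiv (𝓡 r) y x = mvfderiv (𝓡 r) z x := by
  ext v
  have := h.mfderiv_eq (I := 𝓡 r) (I' := 𝓘(ℝ, F))
  simp only [mvfderiv, ContinuousLinearMap.comp_apply]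
  exact congrArg (fun L : EuclideanSpace ℝ (Fin r) →L[ℝ] F => L v) this

theorem differentiableAt_chart {y : M → F} {x : M}
    (hy : MDifferentiableAt (𝓡 r) 𝓘(ℝ, F) y x) :
    DifferentiableAt ℝ (y ∘ (extChartAt (𝓡 r) x).symm) (extChartAt (𝓡 r) x x) := by
  have := ((mdifferentiableAt_iff _ _).1 hy).2
  rw [ModelWithCorners.range_eq_univ, differentiableWithinAt_univ] at this
  exact this

theorem mvfderiv_eq_fderiv {y : M → F} {x : M} (hy : MDifferentiableAt (𝓡 r) 𝓘(ℝ, F) y x)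
    (v : EuclideanSpace ℝ (Fin r)) :
    mvfderiv (𝓡 r) y x v = fderiv ℝ (y ∘ (extChartAt (𝓡 r) x).symm) (extChartAt (𝓡 r) x x) v := by
  rw [hy.mvfderiv, ModelWithCorners.range_eq_univ, fderivWithin_univ]
  rfl

theorem mdifferentiableAt_form {n : ℕ} {y z : M → Ambient n} {x : M}
    (hy : MDifferentiableAt (𝓡 r) 𝓘(ℝ, Ambient n) y x)
    (hz : MDifferentiableAt (𝓡 r) 𝓘(ℝ, Ambient n) z x) :
    MDifferentiableAt (𝓡 r) 𝓘(ℝ, ℝ) (fun p => form n (y p) (z p)) x :=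
  (((formL n).differentiableAt.comp_mdifferentiableAt hy).clm_apply hz :)

/-- The Leibniz rule. Applied to scalar products that are constant, it yields the structure
relations between the forms `ω_ξ^η`. -/
theorem mvfderiv_form {n : ℕ} {y z : M → Ambient n} {x : M}
    (hy : MDifferentiableAt (𝓡 r) 𝓘(ℝ, Ambient n) y x)
    (hz : MDifferentiableAt (𝓡 r) 𝓘(ℝ, Ambient n) z x) (v : TangentSpace (𝓡 r) x) :
    mvfderiv (𝓡 r) (fun p => form n (y p) (z p)) x v =
      form n (mvfderiv (𝓡 r) y x v) (z x) + form n (y x) (mvfderiv (𝓡 r) z x v) := by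
  have h0 := differentiableAt_chart hy
  have h1 := differentiableAt_chart hz
  have h2 := (formL n).isBoundedBilinearMap.hasFDerivAt
    ((y ∘ (extChartAt (𝓡 r) x).symm) (extChartAt (𝓡 r) x x),
      (z ∘ (extChartAt (𝓡 r) x).symm) (extChartAt (𝓡 r) x x))
  have h3 := (h2.comp (extChartAt (𝓡 r) x x) (h0.hasFDerivAt.prodMk h1.hasFDerivAt)).fderiv
  refine (mvfderiv_eq_fderiv (mdifferentiableAt_form hy hz) v).trans ?_
  refine (congrArg (fun K : EuclideanSpace ℝ (Fin r) →L[ℝ] ℝ => K v) h3).trans ?_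
  refine Eq.trans ?_ (congrArg₂ (· + ·)
    (congrArg (form n · (z x)) (mvfderiv_eq_fderiv hy v).symm)
    (congrArg (form n (y x)) (mvfderiv_eq_fderiv hz v).symm))
  have hx0 : (extChartAt (𝓡 r) x).symm (extChartAt (𝓡 r) x x) = x := extChartAt_to_inv x
  have hy0 : (y ∘ (extChartAt (𝓡 r) x).symm) (extChartAt (𝓡 r) x x) = y x := congrArg y hx0
  have hz0 : (z ∘ (extChartAt (𝓡 r) x).symm) (extChartAt (𝓡 r) x x) = z x := congrArg z hx0
  exact (congrArg₂ (fun a b => form n a _ + form n _ b) hy0 hz0).trans (add_comm _ _)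

theorem mvfderiv_comp_source {s : ℕ} {N : Type*} [TopologicalSpace N]
    [ChartedSpace (EuclideanSpace ℝ (Fin s)) N] {g : N → M} {y : M → F} {x : N}
    (hy : MDifferentiableAt (𝓡 r) 𝓘(ℝ, F) y (g x)) (hg : MDifferentiableAt (𝓡 s) (𝓡 r) g x) :
    mvfderiv (𝓡 s) (fun p => y (g p)) x =
      (mvfderiv (𝓡 r) y (g x)).comp (mfderiv (𝓡 s) (𝓡 r) g x) :=
  mfderiv_comp x hy hg

variable [IsManifold (𝓡 r) ∞ M]

/-- The preferred trivialization of the tangent bundle at a point. -/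
abbrev triv (r : ℕ) {M : Type*} [TopologicalSpace M] [ChartedSpace (EuclideanSpace ℝ (Fin r)) M]
    [IsManifold (𝓡 r) ∞ M] (x₀ : M) :=
  trivializationAt (EuclideanSpace ℝ (Fin r)) (TangentSpace (𝓡 r) : M → Type _) x₀

theorem eventually_mem_triv (x₀ : M) : ∀ᶠ x in 𝓝 x₀, x ∈ (triv r x₀).baseSet :=
  (triv r x₀).open_baseSet.mem_nhds (FiberBundle.mem_baseSet_trivializationAt' x₀)

theorem symmL_triv {x₀ x : M} (hx : x ∈ (triv r x₀).baseSet) (v : TangentSpace (𝓡 r) x) :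
    (triv r x₀).symmL ℝ x (triv r x₀ ⟨x, v⟩).2 = v := by
  have := (triv r x₀).symmL_continuousLinearMapAt (R := ℝ) hx v
  rwa [(triv r x₀).continuousLinearMapAt_apply ℝ, (triv r x₀).coe_linearMapAt_of_mem hx] at this

/-- Precomposing with the trivialization gives all the differentials one fixed domain, so that their
smooth dependence on the point makes sense. -/
theorem contMDiffAt_mvfderiv_comp_symmL {y : M → F} {x₀ : M} {k : ℕ∞ω}
    (hy : ContMDiffAt (𝓡 r) 𝓘(ℝ, F) ∞ y x₀) (hk : k + 1 ≤ ∞) :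
    ContMDiffAt (𝓡 r) 𝓘(ℝ, EuclideanSpace ℝ (Fin r) →L[ℝ] F) k
      (fun x => (mvfderiv (𝓡 r) y x).comp ((triv r x₀).symmL ℝ x)) x₀ := by
  have h := ContMDiffAt.mfderiv_const hy hk
  refine h.congr_of_eventuallyEq (Filter.Eventually.of_forall fun x => ?_)
  ext v
  simp [inTangentCoordinates, ContinuousLinearMap.inCoordinates, mvfderiv]
  rfl

theorem mdifferentiableAt_mvfderiv_apply {y : M → F} {x₀ : M}
    (hy : ContMDiffAt (𝓡 r) 𝓘(ℝ, F) ∞ y x₀) {X : Π x : M, TangentSpace (𝓡 r) x}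
    (hX : MDifferentiableAt (𝓡 r) (𝓡 r).tangent
      (fun x => (⟨x, X x⟩ : TangentBundle (𝓡 r) M)) x₀) :
    MDifferentiableAt (𝓡 r) 𝓘(ℝ, F) (fun x => mvfderiv (𝓡 r) y x (X x)) x₀ := by
  have h1 := (contMDiffAt_mvfderiv_comp_symmL (k := 1) hy (by norm_cast)).mdifferentiableAt
    one_ne_zero
  have h2 := (mdifferentiableAt_section (IB := 𝓡 r) (F := EuclideanSpace ℝ (Fin r))
    (E := (TangentSpace (𝓡 r) : M → Type _)) X).1 hX
  refine (h1.clm_apply h2).congr_of_eventuallyEq ?_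
  filter_upwards [eventually_mem_triv (r := r) x₀] with x hx
  rw [ContinuousLinearMap.comp_apply, symmL_triv hx]

theorem contMDiffAt_mvfderiv_apply {y : M → F} {x₀ : M}
    (hy : ContMDiffAt (𝓡 r) 𝓘(ℝ, F) ∞ y x₀) {X : Π x : M, TangentSpace (𝓡 r) x}
    (hX : ContMDiffAt (𝓡 r) (𝓡 r).tangent ∞
      (fun x => (⟨x, X x⟩ : TangentBundle (𝓡 r) M)) x₀) :
    ContMDiffAt (𝓡 r) 𝓘(ℝ, F) ∞ (fun x => mvfderiv (𝓡 r) y x (X x)) x₀ := by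
  have h1 := contMDiffAt_mvfderiv_comp_symmL (k := ∞) hy (by norm_cast)
  have h2 := (contMDiffAt_section (IB := 𝓡 r) (F := EuclideanSpace ℝ (Fin r))
    (E := (TangentSpace (𝓡 r) : M → Type _)) (s := X) x₀).1 hX
  refine (h1.clm_apply h2).congr_of_eventuallyEq ?_
  filter_upwards [eventually_mem_triv (r := r) x₀] with x hx
  rw [ContinuousLinearMap.comp_apply, symmL_triv hx]

open VectorField in
-- `[X, Y] y = X(Y y) - Y(X y)`: in the chart at `x₀` the second derivatives of `y` cancel by
-- symmetry, and what remains is the derivative of `y` along the bracket.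
theorem mvfderiv_mlieBracket {y : M → F} {x₀ : M}
    (hy : ContMDiffAt (𝓡 r) 𝓘(ℝ, F) ∞ y x₀) {X Y : Π x : M, TangentSpace (𝓡 r) x}
    (hX : MDifferentiableAt (𝓡 r) (𝓡 r).tangent
      (fun x => (⟨x, X x⟩ : TangentBundle (𝓡 r) M)) x₀)
    (hY : MDifferentiableAt (𝓡 r) (𝓡 r).tangent
      (fun x => (⟨x, Y x⟩ : TangentBundle (𝓡 r) M)) x₀) :
    mvfderiv (𝓡 r) y x₀ (mlieBracket (𝓡 r) X Y x₀) =
      mvfderiv (𝓡 r) (fun x => mvfderiv (𝓡 r) y x (Y x)) x₀ (X x₀) -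
        mvfderiv (𝓡 r) (fun x => mvfderiv (𝓡 r) y x (X x)) x₀ (Y x₀) := by
  have : IsManifold (𝓡 r) 1 M := IsManifold.of_le (n := ∞) (by norm_cast)
  have : IsManifold (𝓡 r) 2 M := IsManifold.of_le (n := ∞) (by norm_cast)
  set φ := extChartAt (𝓡 r) x₀ with hφ
  set ŷ : EuclideanSpace ℝ (Fin r) → F := y ∘ φ.symm with hŷ
  have htgt : ∀ᶠ z in 𝓝 (φ x₀), z ∈ φ.target := extChartAt_target_mem_nhds x₀
  have hφ0 : φ.symm (φ x₀) = x₀ := extChartAt_to_inv x₀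
  have hŷs : ContDiffAt ℝ ∞ ŷ (φ x₀) := by
    have := (contMDiffAt_iff.1 hy).2
    rw [ModelWithCorners.range_eq_univ, contDiffWithinAt_univ] at this
    exact this
  have hŷ2 : MDifferentiableAt (𝓡 r) 𝓘(ℝ, F) y x₀ := hy.mdifferentiableAt (by simp)
  -- `hat Z` is the field `Z` read in the chart. At the centre the derivative of the chart is the
  -- identity, so its value there is `Z x₀`.
  let hat : (Π x : M, TangentSpace (𝓡 r) x) → EuclideanSpace ℝ (Fin r) → EuclideanSpace ℝ (Fin r) :=
    fun Z => mpullbackWithin 𝓘(ℝ, EuclideanSpace ℝ (Fin r)) (𝓡 r) φ.symm Z (Set.range (𝓡 r))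
  have hhat0 : ∀ Z, hat Z (φ x₀) = Z x₀ := by
    intro Z
    have hp : ∀ p, p = x₀ → (show EuclideanSpace ℝ (Fin r) from Z p) = Z x₀ := by
      rintro _ rfl; rfl
    exact (mfderivWithin_extChartAt_symm_inverse_apply (I := 𝓡 r) (x := x₀)
      (Z (φ.symm (φ x₀)))).trans (hp _ hφ0)
  -- The chain rule is needed on a neighbourhood of the centre, because it is differentiated once
  -- more.
  have hcoord : ∀ Z : Π x : M, TangentSpace (𝓡 r) x,
      ((fun x => mvfderiv (𝓡 r) y x (Z x)) ∘ φ.symm) =ᶠ[𝓝 (φ x₀)]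
      fun z => fderiv ℝ ŷ z (hat Z z) := by
    intro Z
    have hev : ∀ᶠ x in 𝓝 x₀, MDifferentiableAt (𝓡 r) 𝓘(ℝ, F) y x := by
      have := (contMDiffAt_iff_contMDiffAt_nhds (n := 1) (by simp)).1 (hy.of_le (by norm_cast))
      exact this.mono fun x hx => hx.mdifferentiableAt one_ne_zero
    have hcont : Filter.Tendsto φ.symm (𝓝 (φ x₀)) (𝓝 x₀) := by
      have := continuousAt_extChartAt_symm (I := 𝓡 r) x₀
      rwa [ContinuousAt, hφ0] at this
    filter_upwards [htgt, hcont.eventually hev] with z hz hyz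
    have h1 := (isInvertible_mfderivWithin_extChartAt_symm (I := 𝓡 r) hz).self_apply_inverse
      (Z (φ.symm z))
    have h2 : MDifferentiableAt 𝓘(ℝ, EuclideanSpace ℝ (Fin r)) (𝓡 r) φ.symm z := by
      have := mdifferentiableWithinAt_extChartAt_symm (I := 𝓡 r) hz
      rwa [ModelWithCorners.range_eq_univ, mdifferentiableWithinAt_univ] at this
    have h3 := mfderiv_comp_apply (I := 𝓘(ℝ, EuclideanSpace ℝ (Fin r))) z hyz h2 (hat Z z)
    rw [mfderiv_eq_fderiv] at h3
    refine Eq.trans ?_ h3.symm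
    rw [ModelWithCorners.range_eq_univ, mfderivWithin_univ] at h1
    simp only [hat, mpullbackWithin_apply]
    rw [ModelWithCorners.range_eq_univ, mfderivWithin_univ]
    exact congrArg (mvfderiv (𝓡 r) y (φ.symm z)) h1.symm
  have hdiff : ∀ Z : Π x : M, TangentSpace (𝓡 r) x, MDifferentiableAt (𝓡 r) (𝓡 r).tangent
      (fun x => (⟨x, Z x⟩ : TangentBundle (𝓡 r) M)) x₀ →
      DifferentiableAt ℝ (hat Z) (φ x₀) := by
    intro Z hZ
    have := hZ.mdifferentiableWithinAt.differentiableWithinAt_mpullbackWithin_vectorField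
      (s := Set.univ)
    rw [Set.preimage_univ, Set.univ_inter] at this
    exact differentiableWithinAt_univ.1 (this.mono (by simp))
  have hder : ∀ Z : Π x : M, TangentSpace (𝓡 r) x, MDifferentiableAt (𝓡 r) (𝓡 r).tangent
      (fun x => (⟨x, Z x⟩ : TangentBundle (𝓡 r) M)) x₀ → ∀ v : EuclideanSpace ℝ (Fin r),
      mvfderiv (𝓡 r) (fun x => mvfderiv (𝓡 r) y x (Z x)) x₀ v =
        fderiv ℝ (fderiv ℝ ŷ) (φ x₀) v (Z x₀) + fderiv ℝ ŷ (φ x₀) (fderiv ℝ (hat Z) (φ x₀) v) := by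
    intro Z hZ v
    refine (mvfderiv_eq_fderiv (mdifferentiableAt_mvfderiv_apply hy hZ) v).trans ?_
    rw [(hcoord Z).fderiv_eq]
    have hd : DifferentiableAt ℝ (fderiv ℝ ŷ) (φ x₀) :=
      (hŷs.fderiv_right (m := 1) (by norm_cast)).differentiableAt one_ne_zero
    rw [fderiv_clm_apply hd (hdiff Z hZ), hhat0, add_comm]
    rfl
  refine Eq.trans ?_ (congrArg₂ (· - ·) (hder Y hY (X x₀)) (hder X hX (Y x₀))).symm
  have hsymm : fderiv ℝ (fderiv ℝ ŷ) (φ x₀) (X x₀) (Y x₀) =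
      fderiv ℝ (fderiv ℝ ŷ) (φ x₀) (Y x₀) (X x₀) :=
    (hŷs.isSymmSndFDerivAt (by simp; norm_cast)) _ _
  refine (mvfderiv_eq_fderiv hŷ2 _).trans ?_
  have hb : mlieBracket (𝓡 r) X Y x₀ =
      fderiv ℝ (hat Y) (φ x₀) (X x₀) - fderiv ℝ (hat X) (φ x₀) (Y x₀) := by
    have hid : ∀ w : EuclideanSpace ℝ (Fin r),
        (mfderiv (𝓡 r) 𝓘(ℝ, EuclideanSpace ℝ (Fin r)) φ x₀).inverse w = w := by
      intro w
      rw [hφ, mfderiv_extChartAt_self]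
      exact congrArg (fun K : EuclideanSpace ℝ (Fin r) →L[ℝ] EuclideanSpace ℝ (Fin r) => K w)
        ContinuousLinearMap.inverse_id
    refine (hid _).trans ?_
    have hs : φ.symm ⁻¹' Set.univ ∩ Set.range (𝓡 r) = Set.univ := by simp
    refine Eq.trans (b := lieBracket ℝ (hat X) (hat Y) (φ x₀)) ?_ ?_
    · rw [← lieBracketWithin_univ, ← hs]
    · simp only [lieBracket, hhat0]
  rw [hb, hsymm]
  simp only [map_sub]
  abel

end Calculus
end DeSitter

end

noncomputable section
namespace DeSitter

/-! ### Sums of principal minors -/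

section Minors

open Matrix Polynomial

variable {ι κ : Type*} [Fintype ι] [DecidableEq ι] [Fintype κ] [DecidableEq κ]

/-- The sum of the diagonal minors of order `ρ`. -/
def sumMinors (ρ : ℕ) (X : Matrix ι ι ℝ) : ℝ :=
  ∑ S ∈ Finset.powersetCard ρ (Finset.univ : Finset ι),
    (X.submatrix (Subtype.val : S → ι) (Subtype.val : S → ι)).det

theorem sumMinors_eq_coeff (ρ : ℕ) (X : Matrix ι ι ℝ) :
    sumMinors ρ X = (det (1 + (Polynomial.X : ℝ[X]) • X.map C)).coeff ρ :=
  (coeff_det_one_add_X_smul_eq_sum_minors X ρ).symm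

/-- The sum is the coefficient of `t^ρ` in `det (1 + t A B) = det (1 + t B A)`. Conjugation
invariance is the special case used for changes of frame. -/
theorem sumMinors_mul_comm (ρ : ℕ) (A : Matrix ι κ ℝ) (B : Matrix κ ι ℝ) :
    sumMinors ρ (A * B) = sumMinors ρ (B * A) := by
  rw [sumMinors_eq_coeff, sumMinors_eq_coeff, Matrix.map_mul, Matrix.map_mul, ← Matrix.smul_mul,
    det_one_add_mul_comm, Matrix.mul_smul]

theorem sumMinors_smul (ρ : ℕ) (c : ℝ) (X : Matrix ι ι ℝ) :
    sumMinors ρ (c • X) = c ^ ρ * sumMinors ρ X := by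
  simp only [sumMinors, Finset.mul_sum]
  refine Finset.sum_congr rfl fun S hS => ?_
  rw [submatrix_smul, Pi.smul_apply, Pi.smul_apply, det_smul, Fintype.card_coe,
    (Finset.mem_powersetCard.1 hS).2]

omit [DecidableEq κ] in
-- The principal minors of `B Bᵀ` are Gram determinants of rows of `B`, hence nonnegative; the one
-- attached to a maximal independent set of rows is positive.
theorem sumMinors_mul_transpose_pos (B : Matrix ι κ ℝ) : 0 < sumMinors B.rank (B * Bᵀ) := by
  have hsub : ∀ S : Finset ι, (B * Bᵀ).submatrix (Subtype.val : S → ι) (Subtype.val : S → ι) =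
      B.submatrix (Subtype.val : S → ι) id * (B.submatrix (Subtype.val : S → ι) id)ᵀ := by
    intro S; ext i j; rfl
  have hnonneg : ∀ S : Finset ι,
      0 ≤ ((B * Bᵀ).submatrix (Subtype.val : S → ι) (Subtype.val : S → ι)).det := by
    intro S
    rw [hsub]
    have := posSemidef_self_mul_conjTranspose (B.submatrix (Subtype.val : S → ι) id)
    exact this.det_nonneg
  -- A basis of the row space chosen among the rows; `S` is its set of indices.
  obtain ⟨S, hcard, hS⟩ : ∃ S : Finset ι, S.card = B.rank ∧
      LinearIndependent ℝ (fun i : S => B.row i) := by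
    obtain ⟨τ, b, hb, hspan, hli⟩ := exists_linearIndependent' ℝ B.row
    have : Fintype τ := Fintype.ofInjective b hb
    refine ⟨Finset.univ.map ⟨b, hb⟩, ?_, ?_⟩
    · rw [Finset.card_map, Finset.card_univ, rank_eq_finrank_span_row, ← hspan,
        finrank_span_eq_card hli]
    · let e : (Finset.univ.map ⟨b, hb⟩ : Finset ι) → τ := fun i =>
        (Finset.mem_map.1 i.2).choose
      have he : ∀ i, b (e i) = i := fun i => (Finset.mem_map.1 i.2).choose_spec.2
      have hinj : Function.Injective e := fun i j h => Subtype.ext (by rw [← he, ← he, h])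
      have h := hli.comp e hinj
      have h2 : (B.row ∘ b) ∘ e = fun i : (Finset.univ.map ⟨b, hb⟩ : Finset ι) => B.row i := by
        ext1 i
        simp [he]
      rwa [h2] at h
  refine Finset.sum_pos' (fun S _ => hnonneg S) ⟨S, by simp [hcard], ?_⟩
  refine lt_of_le_of_ne (hnonneg S) fun h => ?_
  rw [hsub] at h
  have h2 : IsUnit (B.submatrix (Subtype.val : S → ι) id *
      (B.submatrix (Subtype.val : S → ι) id)ᵀ) :=
    (PosDef.mul_conjTranspose_self _ (vecMul_injective_iff.2 hS)).isUnit
  exact ((isUnit_iff_isUnit_det _).1 h2).ne_zero h.symm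

open scoped MatrixOrder in
theorem PosDef.exists_transpose_mul_self {G : Matrix ι ι ℝ} (hG : G.PosDef) :
    ∃ Q : Matrix ι ι ℝ, IsUnit Q.det ∧ G = Qᵀ * Q := by
  obtain ⟨Q, hQ⟩ := CStarAlgebra.nonneg_iff_eq_star_mul_self.1 hG.posSemidef.nonneg
  refine ⟨Q, ?_, hQ⟩
  have h := hG.det_pos.ne'
  rw [hQ, det_mul] at h
  exact (right_ne_zero_of_mul h).isUnit

/-- Writing `G = Qᵀ Q` and `N = Rᵀ R` with invertible factors and moving `Qᵀ` cyclically reduces the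
matrix to `X Xᵀ` with `X = Q B Rᵀ`, which has the rank of `B`. -/
theorem sumMinors_pos {G : Matrix ι ι ℝ} (hG : G.PosDef) {N : Matrix κ κ ℝ} (hN : N.PosDef)
    (B : Matrix ι κ ℝ) : 0 < sumMinors B.rank (G * (B * N * Bᵀ)) := by
  obtain ⟨Q, hQ, rfl⟩ := PosDef.exists_transpose_mul_self hG
  obtain ⟨R, hR, rfl⟩ := PosDef.exists_transpose_mul_self hN
  have hrank : (Q * B * Rᵀ).rank = B.rank := by
    rw [rank_mul_eq_left_of_isUnit_det _ _ (by rwa [det_transpose]),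
      rank_mul_eq_right_of_isUnit_det _ _ hQ]
  have h := sumMinors_mul_transpose_pos (Q * B * Rᵀ)
  rw [hrank] at h
  refine h.trans_eq ?_
  rw [Matrix.mul_assoc Qᵀ, sumMinors_mul_comm _ Qᵀ]
  simp only [transpose_mul, transpose_transpose, Matrix.mul_assoc]

end Minors
end DeSitter

end

noncomputable section
namespace DeSitter

/-! ### The Levi-Civita connection of a spacelike map -/

section Spacelike
open Bundle Topology
variable {n r : ℕ} {M : Type*} [TopologicalSpace M] [ChartedSpace (EuclideanSpace ℝ (Fin r)) M]

/-- On the open set `W`, the smooth map `y` pulls the scalar product back to a Riemannian metric. -/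
structure IsSpacelike (r : ℕ) {M : Type*} [TopologicalSpace M]
    [ChartedSpace (EuclideanSpace ℝ (Fin r)) M] (y : M → Ambient n) (W : Set M) : Prop where
  isOpen : IsOpen W
  smooth : ContMDiffOn (𝓡 r) 𝓘(ℝ, Ambient n) ∞ y W
  pos : ∀ x ∈ W, ∀ v : TangentSpace (𝓡 r) x, v ≠ 0 →
    0 < form n (mvfderiv (𝓡 r) y x v) (mvfderiv (𝓡 r) y x v)

/-- The orthogonal projection onto the image of `dy`, followed by the inverse of `dy`. -/
def tproj (r : ℕ) {M : Type*} [TopologicalSpace M]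
    [ChartedSpace (EuclideanSpace ℝ (Fin r)) M] (y : M → Ambient n) (x : M) : Ambient n →L[ℝ] TangentSpace (𝓡 r) x :=
  pinv (E := EuclideanSpace ℝ (Fin r)) (mvfderiv (𝓡 r) y x)

/-- The derivative of a vector field `X` in the Levi-Civita connection of the metric
induced by `y`. -/
def lc (y : M → Ambient n) (X : Π x : M, TangentSpace (𝓡 r) x) (x : M) :
    TangentSpace (𝓡 r) x →L[ℝ] TangentSpace (𝓡 r) x :=
  (tproj r y x).comp (mvfderiv (𝓡 r) (fun z => mvfderiv (𝓡 r) y z (X z)) x)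

theorem lc_apply (y : M → Ambient n) (X : Π x : M, TangentSpace (𝓡 r) x) (x : M)
    (v : TangentSpace (𝓡 r) x) :
    lc y X x v = tproj r y x (mvfderiv (𝓡 r) (fun z => mvfderiv (𝓡 r) y z (X z)) x v) := rfl

namespace IsSpacelike

variable {y : M → Ambient n} {W : Set M} {x : M}

theorem contMDiffAt (h : IsSpacelike r y W) (hx : x ∈ W) :
    ContMDiffAt (𝓡 r) 𝓘(ℝ, Ambient n) ∞ y x :=
  h.smooth.contMDiffAt (h.isOpen.mem_nhds hx)

theorem form_tproj (h : IsSpacelike r y W) (hx : x ∈ W) (w : Ambient n)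
    (v : TangentSpace (𝓡 r) x) :
    form n (mvfderiv (𝓡 r) y x (tproj r y x w)) (mvfderiv (𝓡 r) y x v) =
      form n w (mvfderiv (𝓡 r) y x v) :=
  form_pinv (E := EuclideanSpace ℝ (Fin r)) (h.pos x hx) w v

theorem eq_tproj (h : IsSpacelike r y W) (hx : x ∈ W) {w : Ambient n}
    {u : TangentSpace (𝓡 r) x}
    (hu : ∀ v, form n (mvfderiv (𝓡 r) y x u) (mvfderiv (𝓡 r) y x v) =
      form n w (mvfderiv (𝓡 r) y x v)) : u = tproj r y x w :=
  eq_pinv (E := EuclideanSpace ℝ (Fin r)) (h.pos x hx) hu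

theorem tproj_mvfderiv (h : IsSpacelike r y W) (hx : x ∈ W) (v : TangentSpace (𝓡 r) x) :
    tproj r y x (mvfderiv (𝓡 r) y x v) = v :=
  (h.eq_tproj hx fun _ => rfl).symm

theorem tproj_eq_zero (h : IsSpacelike r y W) (hx : x ∈ W) {w : Ambient n}
    (hw : ∀ v, form n w (mvfderiv (𝓡 r) y x v) = 0) : tproj r y x w = 0 :=
  (h.eq_tproj hx fun v => by rw [hw, map_zero, map_zero]; rfl).symm

variable [IsManifold (𝓡 r) ∞ M]

theorem form_symmL_pos (h : IsSpacelike r y W) (hx : x ∈ W) {x₀ : M}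
    (hx₀ : x ∈ (triv r x₀).baseSet) (v : EuclideanSpace ℝ (Fin r)) (hv : v ≠ 0) :
    0 < form n ((mvfderiv (𝓡 r) y x).comp ((triv r x₀).symmL ℝ x) v)
      ((mvfderiv (𝓡 r) y x).comp ((triv r x₀).symmL ℝ x) v) := by
  refine h.pos x hx _ fun h0 => hv ?_
  have := (triv r x₀).continuousLinearMapAt_symmL (R := ℝ) hx₀ v
  rw [← this]
  exact (congrArg ((triv r x₀).continuousLinearMapAt ℝ x) h0).trans (map_zero _)

/-- In a trivialization the projection is the pseudo-inverse of the differential read there, which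
depends smoothly on the point. -/
theorem continuousLinearMapAt_tproj (h : IsSpacelike r y W) (hx : x ∈ W) {x₀ : M}
    (hx₀ : x ∈ (triv r x₀).baseSet) (w : Ambient n) :
    (triv r x₀).continuousLinearMapAt ℝ x (tproj r y x w) =
      pinv ((mvfderiv (𝓡 r) y x).comp ((triv r x₀).symmL ℝ x)) w := by
  refine eq_pinv (h.form_symmL_pos hx hx₀) fun v => ?_
  rw [ContinuousLinearMap.comp_apply, ContinuousLinearMap.comp_apply,
    (triv r x₀).symmL_continuousLinearMapAt (R := ℝ) hx₀]
  exact h.form_tproj hx w _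

theorem contMDiffAt_pinv (h : IsSpacelike r y W) {x₀ : M} (hx₀ : x₀ ∈ W) :
    ContMDiffAt (𝓡 r) 𝓘(ℝ, Ambient n →L[ℝ] EuclideanSpace ℝ (Fin r)) ∞
      (fun x => pinv ((mvfderiv (𝓡 r) y x).comp ((triv r x₀).symmL ℝ x))) x₀ :=
  ContDiffAt.comp_contMDiffAt (g := pinv)
    (f := fun x => (mvfderiv (𝓡 r) y x).comp ((triv r x₀).symmL ℝ x))
    (contDiffAt_pinv (h.form_symmL_pos hx₀ (FiberBundle.mem_baseSet_trivializationAt' x₀)))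
    (contMDiffAt_mvfderiv_comp_symmL (h.contMDiffAt hx₀) (by norm_cast))

theorem eventually_triv_tproj (h : IsSpacelike r y W) {x₀ : M} (hx₀ : x₀ ∈ W) (w : M → Ambient n) :
    (fun x => (triv r x₀ ⟨x, tproj r y x (w x)⟩).2) =ᶠ[𝓝 x₀]
      fun x => pinv ((mvfderiv (𝓡 r) y x).comp ((triv r x₀).symmL ℝ x)) (w x) := by
  filter_upwards [eventually_mem_triv (r := r) x₀, h.isOpen.mem_nhds hx₀] with x hx hxW
  rw [← h.continuousLinearMapAt_tproj hxW hx, (triv r x₀).continuousLinearMapAt_apply ℝ,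
    (triv r x₀).coe_linearMapAt_of_mem hx]

theorem contMDiffAt_tproj (h : IsSpacelike r y W) {x₀ : M} (hx₀ : x₀ ∈ W) {w : M → Ambient n}
    (hw : ContMDiffAt (𝓡 r) 𝓘(ℝ, Ambient n) ∞ w x₀) :
    ContMDiffAt (𝓡 r) (𝓡 r).tangent ∞
      (fun x => (⟨x, tproj r y x (w x)⟩ : TangentBundle (𝓡 r) M)) x₀ := by
  refine (contMDiffAt_section (IB := 𝓡 r) (F := EuclideanSpace ℝ (Fin r))
    (E := (TangentSpace (𝓡 r) : M → Type _)) x₀).2 ?_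
  exact ((h.contMDiffAt_pinv hx₀).clm_apply hw).congr_of_eventuallyEq
    (h.eventually_triv_tproj hx₀ w)

theorem contMDiffAt_lc (h : IsSpacelike r y W) {x₀ : M} (hx₀ : x₀ ∈ W)
    {X : Π x : M, TangentSpace (𝓡 r) x}
    (hX : ContMDiffAt (𝓡 r) (𝓡 r).tangent ∞
      (fun x => (⟨x, X x⟩ : TangentBundle (𝓡 r) M)) x₀) :
    ContMDiffAt (𝓡 r) ((𝓡 r).prod
        𝓘(ℝ, EuclideanSpace ℝ (Fin r) →L[ℝ] EuclideanSpace ℝ (Fin r))) ∞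
      (fun x => (⟨x, lc y X x⟩ : TotalSpace (EuclideanSpace ℝ (Fin r) →L[ℝ] EuclideanSpace ℝ (Fin r))
        fun x : M => TangentSpace (𝓡 r) x →L[ℝ] TangentSpace (𝓡 r) x)) x₀ := by
  rw [contMDiffAt_hom_bundle]
  refine ⟨contMDiffAt_id, ?_⟩
  have hz := contMDiffAt_mvfderiv_apply (h.contMDiffAt hx₀) hX
  refine ((h.contMDiffAt_pinv hx₀).clm_comp
    (contMDiffAt_mvfderiv_comp_symmL hz (by norm_cast))).congr_of_eventuallyEq ?_
  filter_upwards [eventually_mem_triv (r := r) x₀, h.isOpen.mem_nhds hx₀] with x hx hxW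
  ext1 v
  exact h.continuousLinearMapAt_tproj hxW hx _

/-- The extra term `dg · dy(X)` is tangent, and the projection sends `dy(X)` back to `X`. -/
theorem lc_smul_add (h : IsSpacelike r y W) (hx : x ∈ W) {X : Π x : M, TangentSpace (𝓡 r) x}
    (hX : MDifferentiableAt (𝓡 r) (𝓡 r).tangent
      (fun x => (⟨x, X x⟩ : TangentBundle (𝓡 r) M)) x) {g : M → ℝ}
    (hg : MDifferentiableAt (𝓡 r) 𝓘(ℝ, ℝ) g x) :
    lc y (g • X) x = g x • lc y X x + (mvfderiv (𝓡 r) g x).smulRight (X x) := by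
  have hz := mdifferentiableAt_mvfderiv_apply (h.contMDiffAt hx) hX
  have h1 : (fun p => mvfderiv (𝓡 r) y p ((g • X) p)) =
      g • fun p => mvfderiv (𝓡 r) y p (X p) := by
    ext1 p; exact (mvfderiv (𝓡 r) y p).map_smul (g p) (X p)
  ext1 v
  rw [lc_apply, h1, mvfderiv_smul hg hz]
  simp [lc_apply, h.tproj_mvfderiv hx]

theorem lc_add (h : IsSpacelike r y W) (hx : x ∈ W) {X Y : Π x : M, TangentSpace (𝓡 r) x}
    (hX : MDifferentiableAt (𝓡 r) (𝓡 r).tangent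
      (fun x => (⟨x, X x⟩ : TangentBundle (𝓡 r) M)) x)
    (hY : MDifferentiableAt (𝓡 r) (𝓡 r).tangent
      (fun x => (⟨x, Y x⟩ : TangentBundle (𝓡 r) M)) x) :
    lc y (X + Y) x = lc y X x + lc y Y x := by
  have hX' := mdifferentiableAt_mvfderiv_apply (h.contMDiffAt hx) hX
  have hY' := mdifferentiableAt_mvfderiv_apply (h.contMDiffAt hx) hY
  have h1 : (fun p => mvfderiv (𝓡 r) y p ((X + Y) p)) =
      (fun p => mvfderiv (𝓡 r) y p (X p)) + fun p => mvfderiv (𝓡 r) y p (Y p) := by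
    ext1 p; exact (mvfderiv (𝓡 r) y p).map_add (X p) (Y p)
  ext1 v
  rw [lc_apply, h1, mvfderiv_add hX' hY']
  simp [lc_apply]

/-- The difference of the two second derivatives of `y` is `dy([X, Y])`, which the projection sends
back to the bracket. -/
theorem lc_sub_lc (h : IsSpacelike r y W) (hx : x ∈ W) {X Y : Π x : M, TangentSpace (𝓡 r) x}
    (hX : MDifferentiableAt (𝓡 r) (𝓡 r).tangent
      (fun x => (⟨x, X x⟩ : TangentBundle (𝓡 r) M)) x)
    (hY : MDifferentiableAt (𝓡 r) (𝓡 r).tangent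
      (fun x => (⟨x, Y x⟩ : TangentBundle (𝓡 r) M)) x) :
    lc y Y x (X x) - lc y X x (Y x) = VectorField.mlieBracket (𝓡 r) X Y x := by
  rw [lc_apply, lc_apply, ← map_sub, ← mvfderiv_mlieBracket (h.contMDiffAt hx) hX hY,
    h.tproj_mvfderiv hx]

end IsSpacelike

end Spacelike
end DeSitter

end

noncomputable section
namespace DeSitter

/-! ### Points of tangency with the hyperquadric -/

section TangencyLift
open Bundle Topology
variable {n r : ℕ}
  {U : Type*} [TopologicalSpace U] [ChartedSpace (EuclideanSpace ℝ (Fin n)) U]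
  {M : Type*} [TopologicalSpace M] [ChartedSpace (EuclideanSpace ℝ (Fin r)) M]
  {f : U → ℙ ℝ (Ambient n)} {gen : U → M}

/-- `y` is a smooth choice over `W` of homogeneous coordinates of the points of tangency of the
tangent hyperplanes with `Q^n`. -/
structure IsTangencyLift (r : ℕ) {M : Type*} [TopologicalSpace M]
    [ChartedSpace (EuclideanSpace ℝ (Fin r)) M] (f : U → ℙ ℝ (Ambient n)) (gen : U → M)
    (W : Set M) (y : M → Ambient n) : Prop where
  isOpen : IsOpen W
  smooth : ContMDiffOn (𝓡 r) 𝓘(ℝ, Ambient n) ∞ y W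
  tangency : ∀ u, gen u ∈ W → IsTangencyPoint f u (y (gen u))

theorem mem_orthogonal_span {y v : Ambient n} :
    v ∈ (form n).orthogonal (Submodule.span ℝ {y}) ↔ form n y v = 0 := by
  rw [LinearMap.BilinForm.mem_orthogonal_iff]
  refine ⟨fun h => h y (Submodule.mem_span_singleton_self y), fun h z hz => ?_⟩
  obtain ⟨c, rfl⟩ := Submodule.mem_span_singleton.1 hz
  simp [h]

/-- A hyperplane has only one pole: two functionals, one vanishing on the kernel of the other, are
proportional, and the scalar product is nondegenerate. -/
theorem eq_smul_of_form {y y' : Ambient n} (hy : y ≠ 0)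
    (h : ∀ w, form n y w = 0 → form n y' w = 0) : ∃ c : ℝ, y' = c • y := by
  obtain ⟨w, hw⟩ : ∃ w, form n y w ≠ 0 := by
    by_contra! h0
    exact hy (eq_zero_of_form_eq_zero h0)
  refine ⟨form n y' w / form n y w, sub_eq_zero.1 (eq_zero_of_form_eq_zero fun z => ?_)⟩
  have := h (z - (form n y z / form n y w) • w) (by simp [div_mul_cancel₀ _ hw])
  simp only [map_sub, map_smul, LinearMap.sub_apply, LinearMap.smul_apply, smul_eq_mul] at this ⊢
  field_simp at this ⊢
  linarith

theorem IsTangencyPoint.eq_smul (hf : IsLightlikeHypersurface f) {u : U} {y y' : Ambient n}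
    (hy : IsTangencyPoint f u y) (hy' : IsTangencyPoint f u y') : ∃ c : ℝ, c ≠ 0 ∧ y' = c • y := by
  obtain ⟨W, x, hx, hu⟩ := hf.exists_lift u
  obtain ⟨c, hc⟩ := eq_smul_of_form hy.1 (y' := y') fun w hw => by
    rw [← mem_orthogonal_span, ← hy'.2.2 W x hx hu, hy.2.2 W x hx hu, mem_orthogonal_span]
    exact hw
  exact ⟨c, fun h => hy'.1 (by rw [hc, h, zero_smul]), hc⟩

theorem IsTangencyPoint.smul {u : U} {y : Ambient n} (hy : IsTangencyPoint f u y) {c : ℝ}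
    (hc : c ≠ 0) : IsTangencyPoint f u (c • y) := by
  refine ⟨smul_ne_zero hc hy.1, by simp [hy.2.1], fun W x hx hu => ?_⟩
  rw [hy.2.2 W x hx hu, Submodule.span_singleton_smul_eq (IsUnit.mk0 c hc)]

namespace IsTangencyLift

variable {W : Set M} {y : M → Ambient n} {x : M}

theorem contMDiffAt (h : IsTangencyLift r f gen W y) (hx : x ∈ W) :
    ContMDiffAt (𝓡 r) 𝓘(ℝ, Ambient n) ∞ y x :=
  h.smooth.contMDiffAt (h.isOpen.mem_nhds hx)

theorem mdifferentiableAt (h : IsTangencyLift r f gen W y) (hx : x ∈ W) :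
    MDifferentiableAt (𝓡 r) 𝓘(ℝ, Ambient n) y x :=
  (h.contMDiffAt hx).mdifferentiableAt (by simp)

theorem mono (h : IsTangencyLift r f gen W y) {W' : Set M} (hW' : IsOpen W') (hsub : W' ⊆ W) :
    IsTangencyLift r f gen W' y :=
  ⟨hW', h.smooth.mono hsub, fun u hu => h.tangency u (hsub hu)⟩

section

variable (hgen : IsGeneratorFibration (r := r) f gen)
include hgen

theorem ne_zero (h : IsTangencyLift r f gen W y) (hx : x ∈ W) : y x ≠ 0 := by
  obtain ⟨u, rfl⟩ := hgen.surjective x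
  exact (h.tangency u hx).1

theorem form_self (h : IsTangencyLift r f gen W y) (hx : x ∈ W) : form n (y x) (y x) = 0 := by
  obtain ⟨u, rfl⟩ := hgen.surjective x
  exact (h.tangency u hx).2.1

theorem form_mvfderiv (h : IsTangencyLift r f gen W y) (hx : x ∈ W)
    (v : TangentSpace (𝓡 r) x) : form n (y x) (mvfderiv (𝓡 r) y x v) = 0 := by
  have h1 := mvfderiv_form (h.mdifferentiableAt hx) (h.mdifferentiableAt hx) v
  have h2 : (fun p => form n (y p) (y p)) =ᶠ[𝓝 x] fun _ => 0 :=
    Filter.eventually_of_mem (h.isOpen.mem_nhds hx) fun p hp => h.form_self hgen hp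
  rw [mvfderiv_congr h2, mvfderiv_const, form_comm _ (y x)] at h1
  have h3 : (0 : ℝ) = _ := h1
  linarith

theorem mdifferentiableAt_gen (u : U) : MDifferentiableAt (𝓡 n) (𝓡 r) gen u :=
  hgen.submersion.contMDiff.contMDiffAt.mdifferentiableAt (by simp)

variable (hrank : HasRank f r)
include hrank

/-- The rank condition on `U` descends to `M`: the span of `y` and `dy` has dimension `r + 1`, so
`dy` is injective modulo `y`. -/
theorem eq_zero_of_mvfderiv_eq_smul (h : IsTangencyLift r f gen W y) (hx : x ∈ W)
    {v : TangentSpace (𝓡 r) x} {c : ℝ} (hv : mvfderiv (𝓡 r) y x v = c • y x) : v = 0 := by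
  obtain ⟨u, rfl⟩ := hgen.surjective x
  have hcont := hgen.submersion.contMDiff
  have h1 := hrank (gen ⁻¹' W) (fun u => y (gen u)) (h.isOpen.preimage hcont.continuous)
    (h.smooth.comp hcont.contMDiffOn fun _ hu => hu) (fun u hu => h.tangency u hu) u hx
  let D : EuclideanSpace ℝ (Fin r) →ₗ[ℝ] Ambient n := (mvfderiv (𝓡 r) y (gen u)).toLinearMap
  -- The source has dimension `r + 1` and the range contains a tangent span of that dimension, so
  -- `Ψ` is injective. The relation `dy(v) = c y` puts `(-c, v)` into its kernel.
  let Ψ : ℝ × EuclideanSpace ℝ (Fin r) →ₗ[ℝ] Ambient n :=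
    (LinearMap.toSpanSingleton ℝ _ (y (gen u))).coprod D
  have hΨ : ∀ t v, Ψ (t, v) = t • y (gen u) + D v := fun t v => by
    rw [LinearMap.coprod_apply, LinearMap.toSpanSingleton_apply]
  have hle : tangentSpan (fun u => y (gen u)) u ≤ LinearMap.range Ψ := by
    rw [tangentSpan, mvfderiv_comp_source (h.mdifferentiableAt hx) (mdifferentiableAt_gen hgen u)]
    refine sup_le ((Submodule.span_singleton_le_iff_mem _ _).2 ⟨(1, 0), ?_⟩) ?_
    · rw [hΨ, one_smul, map_zero, add_zero]
    · rintro _ ⟨w, rfl⟩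
      refine ⟨(0, mfderiv (𝓡 n) (𝓡 r) gen u w), ?_⟩
      refine (hΨ 0 (mfderiv (𝓡 n) (𝓡 r) gen u w)).trans ?_
      rw [zero_smul, zero_add]
      rfl
  have h2 : Module.finrank ℝ (ℝ × EuclideanSpace ℝ (Fin r)) ≤
      Module.finrank ℝ (LinearMap.range Ψ) := by
    refine le_trans ?_ (Submodule.finrank_mono hle)
    rw [h1]; simp [add_comm]
  have h3 := LinearMap.finrank_range_add_finrank_ker Ψ
  have h4 : LinearMap.ker Ψ = ⊥ := Submodule.finrank_eq_zero.1 (by omega)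
  have h5 : ((-c, v) : ℝ × EuclideanSpace ℝ (Fin r)) ∈ LinearMap.ker Ψ := by
    refine LinearMap.mem_ker.2 (((hΨ (-c) v).trans (congrArg (_ + ·) hv)).trans ?_)
    rw [neg_smul, neg_add_cancel]
  rw [h4, Submodule.mem_bot] at h5
  exact congrArg Prod.snd h5

/-- `dy` takes values in the hyperplane polar to `y`, where the form is positive except on multiples
of `y`; the rank condition excludes these. -/
theorem isSpacelike (h : IsTangencyLift r f gen W y) : IsSpacelike r y W where
  isOpen := h.isOpen
  smooth := h.smooth
  pos x hx v hv := by
    obtain ⟨h1, h2⟩ := form_pos_of_orthogonal (h.ne_zero hgen hx) (h.form_self hgen hx)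
      (h.form_mvfderiv hgen hx v)
    exact lt_of_le_of_ne h1 fun h0 =>
      hv (h.eq_zero_of_mvfderiv_eq_smul hgen hrank hx (h2 h0.symm))

end

/-- A point of the hypersurface lies in its own tangent hyperplane, which is the polar of `y`. -/
theorem form_lift (h : IsTangencyLift r f gen W y) {u : U} (hu : gen u ∈ W) {w : Ambient n}
    (hw : w ∈ (f u).submodule) (hf : IsLightlikeHypersurface f) : form n (y (gen u)) w = 0 := by
  obtain ⟨W', x, hx, hu'⟩ := hf.exists_lift u
  obtain ⟨h0, hxu⟩ := hx.lift u hu'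
  rw [← hxu, Projectivization.submodule_mk] at hw
  obtain ⟨c, rfl⟩ := Submodule.mem_span_singleton.1 hw
  have : x u ∈ tangentSpan x u :=
    Submodule.mem_sup_left (Submodule.mem_span_singleton_self _)
  rw [(h.tangency u hu).2.2 W' x hx hu', mem_orthogonal_span] at this
  rw [map_smul, this, smul_zero]

end IsTangencyLift

end TangencyLift
end DeSitter

end

noncomputable section
namespace DeSitter

/-! ### Smooth determinants and inverse matrices -/

section MatrixSmooth
variable {r : ℕ} {M : Type*} [TopologicalSpace M] [ChartedSpace (EuclideanSpace ℝ (Fin r)) M]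
  {ι : Type*} [Fintype ι] [DecidableEq ι] {G : M → Matrix ι ι ℝ} {x : M}

theorem contMDiffAt_det (h : ∀ i j, ContMDiffAt (𝓡 r) 𝓘(ℝ, ℝ) ∞ (fun y => G y i j) x) :
    ContMDiffAt (𝓡 r) 𝓘(ℝ, ℝ) ∞ (fun y => (G y).det) x := by
  simp only [Matrix.det_apply']
  exact contMDiffAt_finsetSum fun σ _ =>
    contMDiffAt_const.mul (contMDiffAt_finsetProd fun i _ => h _ _)

theorem contMDiffAt_inv (h : ∀ i j, ContMDiffAt (𝓡 r) 𝓘(ℝ, ℝ) ∞ (fun y => G y i j) x)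
    (hx : (G x).det ≠ 0) (i j : ι) :
    ContMDiffAt (𝓡 r) 𝓘(ℝ, ℝ) ∞ (fun y => (G y)⁻¹ i j) x := by
  simp only [Matrix.inv_def, Ring.inverse_eq_inv', Matrix.smul_apply, Matrix.adjugate_apply,
    smul_eq_mul]
  refine ((contMDiffAt_det h).inv₀ hx).mul (contMDiffAt_det fun a b => ?_)
  by_cases ha : a = j
  · subst ha; simpa using contMDiffAt_const
  · simpa [Matrix.updateRow_ne ha] using h a b

end MatrixSmooth

/-! ### Structure equations and smoothness in adapted frames -/

section Frames
open Bundle Topology Module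
variable {n r k : ℕ}

theorem basis_expand (b : Basis (FrameIndex r k) ℝ (Ambient n)) (v : Ambient n) :
    v = b.coord ixO v • b ixO + (∑ p, b.coord (ixP p) v • b (ixP p) +
      (∑ α, b.coord (ixA α) v • b (ixA α) + b.coord ixL v • b ixL)) := by
  conv_lhs => rw [← b.sum_repr v]
  simp only [Fintype.sum_sum_type, Finset.univ_unique, Finset.sum_singleton, Basis.coord_apply]

/-- On the hyperplane polar to `y` the form degenerates only along `y`, so it is definite on a
family independent modulo `y`. -/
theorem gram_posDef {ι : Type*} [Fintype ι] {y : Ambient n} (hy : y ≠ 0) (hyy : form n y y = 0)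
    {w : ι → Ambient n} (hw : ∀ i, form n y (w i) = 0)
    (hli : ∀ (c : ι → ℝ) (t : ℝ), ∑ i, c i • w i = t • y → c = 0) :
    (Matrix.of fun i j => form n (w i) (w j)).PosDef := by
  refine Matrix.PosDef.of_dotProduct_mulVec_pos (Matrix.IsHermitian.ext fun i j => ?_)
    fun c hc => ?_
  · simp [form_comm]
  have h1 : star c ⬝ᵥ ((Matrix.of fun i j => form n (w i) (w j)).mulVec c) =
      form n (∑ i, c i • w i) (∑ i, c i • w i) := by
    simp only [dotProduct, Matrix.mulVec, map_sum, map_smul, LinearMap.sum_apply,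
      LinearMap.smul_apply, smul_eq_mul, Matrix.of_apply, Pi.star_apply, star_trivial,
      Finset.mul_sum]
    rw [Finset.sum_comm]
    exact Finset.sum_congr rfl fun i _ => Finset.sum_congr rfl fun j _ => by ring
  have h2 : form n y (∑ i, c i • w i) = 0 := by simp [hw]
  obtain ⟨h3, h4⟩ := form_pos_of_orthogonal hy hyy h2
  rw [h1]
  exact lt_of_le_of_ne h3 fun h0 => hc (hli c _ (h4 h0.symm))

variable {U : Type*} [TopologicalSpace U] [ChartedSpace (EuclideanSpace ℝ (Fin n)) U]
  {M : Type*} [TopologicalSpace M] [ChartedSpace (EuclideanSpace ℝ (Fin r)) M]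

/-- The differential `dA_ξ` of a vertex of a frame. -/
abbrev dvert (A : FrameField n r k M) (ξ : FrameIndex r k) (x : M) :
    TangentSpace (𝓡 r) x →L[ℝ] Ambient n :=
  mvfderiv (𝓡 r) (fun y => A y ξ) x

theorem omega_apply (A : FrameField n r k M) (ξ η : FrameIndex r k) (x : M)
    (v : TangentSpace (𝓡 r) x) : omega A ξ η x v = (A x).coord η (dvert A ξ x v) := rfl

theorem dvert_eq (A : FrameField n r k M) (ξ : FrameIndex r k) (x : M)
    (v : TangentSpace (𝓡 r) x) :
    dvert A ξ x v = omega A ξ ixO x v • A x ixO + (∑ p, omega A ξ (ixP p) x v • A x (ixP p) +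
      (∑ α, omega A ξ (ixA α) x v • A x (ixA α) + omega A ξ ixL x v • A x ixL)) :=
  basis_expand (A x) _

namespace IsAdaptedFrame

variable {f : U → ℙ ℝ (Ambient n)} {gen : U → M} {W : Set M} {A : FrameField n r k M} {x : M}

theorem contMDiffAt (h : IsAdaptedFrame f gen W A) (hx : x ∈ W) (ξ : FrameIndex r k) :
    ContMDiffAt (𝓡 r) 𝓘(ℝ, Ambient n) ∞ (fun y => A y ξ) x :=
  (h.smooth ξ).contMDiffAt (h.isOpen.mem_nhds hx)

theorem mdifferentiableAt (h : IsAdaptedFrame f gen W A) (hx : x ∈ W) (ξ : FrameIndex r k) :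
    MDifferentiableAt (𝓡 r) 𝓘(ℝ, Ambient n) (fun y => A y ξ) x :=
  (h.contMDiffAt hx ξ).mdifferentiableAt (by simp)

theorem isTangencyLift (h : IsAdaptedFrame f gen W A) :
    IsTangencyLift r f gen W (fun x => A x ixO) :=
  ⟨h.isOpen, h.smooth ixO, h.tangency⟩

theorem form_dvert (h : IsAdaptedFrame f gen W A) (hx : x ∈ W) {ξ η : FrameIndex r k} {c : ℝ}
    (hc : ∀ z ∈ W, form n (A z ξ) (A z η) = c) (v : TangentSpace (𝓡 r) x) :
    form n (dvert A ξ x v) (A x η) = - form n (A x ξ) (dvert A η x v) := by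
  have h1 := mvfderiv_form (h.mdifferentiableAt hx ξ) (h.mdifferentiableAt hx η) v
  have h2 : (fun p => form n (A p ξ) (A p η)) =ᶠ[𝓝 x] fun _ => c :=
    Filter.eventually_of_mem (h.isOpen.mem_nhds hx) hc
  rw [mvfderiv_congr h2, mvfderiv_const] at h1
  have h3 : (0 : ℝ) = _ := h1
  linarith

omit [TopologicalSpace M] [ChartedSpace (EuclideanSpace ℝ (Fin r)) M] in
theorem gP_symm (A : FrameField n r k M) (x : M) (p q : Fin r) : gP A x p q = gP A x q p :=
  form_comm _ _

omit [TopologicalSpace M] [ChartedSpace (EuclideanSpace ℝ (Fin r)) M] in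
theorem gA_symm (A : FrameField n r k M) (x : M) (α β : Fin k) : gA A x α β = gA A x β α :=
  form_comm _ _

omit [TopologicalSpace M] [ChartedSpace (EuclideanSpace ℝ (Fin r)) M] in
theorem gP_transpose (A : FrameField n r k M) (x : M) : (gP A x).transpose = gP A x :=
  Matrix.ext fun p q => gP_symm A x q p

omit [TopologicalSpace M] [ChartedSpace (EuclideanSpace ℝ (Fin r)) M] in
theorem gA_transpose (A : FrameField n r k M) (x : M) : (gA A x).transpose = gA A x :=
  Matrix.ext fun p q => gA_symm A x q p

/-- The coordinates are given by the inverse of the linear map `B z` built from the vertices, and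
inversion of linear maps is smooth. -/
theorem contMDiffAt_coord (h : IsAdaptedFrame f gen W A) (hx : x ∈ W) {w : M → Ambient n}
    (hw : ContMDiffAt (𝓡 r) 𝓘(ℝ, Ambient n) ∞ w x) (η : FrameIndex r k) :
    ContMDiffAt (𝓡 r) 𝓘(ℝ, ℝ) ∞ (fun z => (A z).coord η (w z)) x := by
  let B : M → (FrameIndex r k → ℝ) →L[ℝ] Ambient n := fun z =>
    ∑ ξ, ContinuousLinearMap.smulRightL ℝ (FrameIndex r k → ℝ) (Ambient n)
      (ContinuousLinearMap.proj ξ) (A z ξ)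
  have hB : ContMDiffAt (𝓡 r) 𝓘(ℝ, (FrameIndex r k → ℝ) →L[ℝ] Ambient n) ∞ B x :=
    contMDiffAt_finsetSum fun ξ _ =>
      ((ContinuousLinearMap.contMDiff _).contMDiffAt.comp x (h.contMDiffAt hx ξ))
  have hBe : ∀ z, B z = ((A z).equivFunL.symm : (FrameIndex r k → ℝ) →L[ℝ] Ambient n) := by
    intro z
    ext1 c
    have : (A z).equivFunL.symm c = ∑ i, c i • A z i := (A z).equivFun_symm_apply c
    simp only [B, _root_.sum_apply, ContinuousLinearMap.smulRightL_apply_apply,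
      ContinuousLinearEquiv.coe_coe, this]
    rfl
  have hinv : ContDiffAt ℝ ∞ ContinuousLinearMap.inverse (B x) := by
    rw [hBe]; exact contDiffAt_map_inverse _
  have h1 := (hinv.comp_contMDiffAt hB).clm_apply hw
  have h2 := (ContinuousLinearMap.contMDiff (n := ∞)
    (ContinuousLinearMap.proj (R := ℝ) (φ := fun _ : FrameIndex r k => ℝ) η)).contMDiffAt.comp x h1
  refine h2.congr_of_eventuallyEq (Filter.Eventually.of_forall fun z => ?_)
  simp only [Function.comp_apply, hBe, ContinuousLinearMap.inverse_equiv]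
  rfl

variable (hgen : IsGeneratorFibration (r := r) f gen)
include hgen

theorem form_O_O (h : IsAdaptedFrame f gen W A) (hx : x ∈ W) :
    form n (A x ixO) (A x ixO) = 0 :=
  IsTangencyLift.form_self (y := fun z => A z ixO) hgen h.isTangencyLift hx

/-- `A_0` and `A_{n+1}` are isotropic with product `-1`, so each of them reads off the coordinate
along the other. -/
theorem form_O (h : IsAdaptedFrame f gen W A) (hx : x ∈ W) (v : Ambient n) :
    form n (A x ixO) v = - (A x).coord ixL v := by
  conv_lhs => rw [basis_expand (A x) v]
  simp [h.form_O_O hgen hx, h.form_O_P x hx, h.form_O_A x hx, h.form_O_L x hx,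
    -Basis.coord_apply]

omit hgen in
theorem form_L (h : IsAdaptedFrame f gen W A) (hx : x ∈ W) (v : Ambient n) :
    form n (A x ixL) v = - (A x).coord ixO v := by
  conv_lhs => rw [basis_expand (A x) v]
  simp [form_comm (A x ixL), h.form_P_L x hx, h.form_A_L x hx, h.form_O_L x hx, h.form_L_L x hx,
    -Basis.coord_apply]

omit hgen in
theorem form_P (h : IsAdaptedFrame f gen W A) (hx : x ∈ W) (q : Fin r) (v : Ambient n) :
    form n (A x (ixP q)) v = ∑ p, gP A x q p * (A x).coord (ixP p) v := by
  conv_lhs => rw [basis_expand (A x) v]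
  simp [form_comm (A x (ixP q)) (A x ixO), h.form_O_P x hx, h.form_P_A x hx, h.form_P_L x hx, gP,
    -Basis.coord_apply, mul_comm]

omit hgen in
theorem form_A (h : IsAdaptedFrame f gen W A) (hx : x ∈ W) (β : Fin k) (v : Ambient n) :
    form n (A x (ixA β)) v = ∑ α, gA A x β α * (A x).coord (ixA α) v := by
  conv_lhs => rw [basis_expand (A x) v]
  simp [form_comm (A x (ixA β)) (A x ixO), h.form_O_A x hx,
    form_comm (A x (ixA β)) (A x (ixP _)), h.form_P_A x hx, h.form_A_L x hx, gA,
    -Basis.coord_apply, mul_comm]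

theorem gP_posDef (h : IsAdaptedFrame f gen W A) (hx : x ∈ W) : (gP A x).PosDef := by
  refine gram_posDef (y := A x ixO) ((A x).ne_zero _) (h.form_O_O hgen hx) (h.form_O_P x hx)
    fun c t hct => ?_
  ext p
  have := congrArg ((A x).coord (ixP p)) hct
  simpa [Finsupp.single_apply] using this

theorem gA_posDef (h : IsAdaptedFrame f gen W A) (hx : x ∈ W) : (gA A x).PosDef := by
  refine gram_posDef (y := A x ixO) ((A x).ne_zero _) (h.form_O_O hgen hx) (h.form_O_A x hx)
    fun c t hct => ?_
  ext p
  have := congrArg ((A x).coord (ixA p)) hct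
  simpa [Finsupp.single_apply] using this

theorem omega_L (h : IsAdaptedFrame f gen W A) (hx : x ∈ W) (ξ : FrameIndex r k)
    (v : TangentSpace (𝓡 r) x) : omega A ξ ixL x v = - form n (A x ixO) (dvert A ξ x v) := by
  rw [h.form_O hgen hx, neg_neg, omega_apply]

/-- There is no component along `A_{n+1}` because `(A_0, dA_0) = 0`, and none along the `A_α`
because the frame is adapted. -/
theorem dvert_O (h : IsAdaptedFrame f gen W A) (hx : x ∈ W) (v : TangentSpace (𝓡 r) x) :
    dvert A ixO x v = omega A ixO ixO x v • A x ixO + ∑ p, omega A ixO (ixP p) x v • A x (ixP p) := by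
  have h1 : omega A ixO ixL x v = 0 := by
    rw [h.omega_L hgen hx, h.isTangencyLift.form_mvfderiv hgen hx, neg_zero]
  conv_lhs => rw [dvert_eq A ixO x v]
  simp [h1, h.tangent x hx]

omit hgen in
theorem form_P_dvert_O (h : IsAdaptedFrame f gen W A) (hx : x ∈ W) (p : Fin r)
    (v : TangentSpace (𝓡 r) x) :
    form n (A x (ixP p)) (dvert A ixO x v) = ∑ q, gP A x p q * omega A ixO (ixP q) x v :=
  h.form_P hx p _

/-- This is the derivative of `(A_0, A_p) = 0`; it produces the terms with `g_{pq}` in the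
curvature. -/
theorem omega_P_L (h : IsAdaptedFrame f gen W A) (hx : x ∈ W) (p : Fin r)
    (v : TangentSpace (𝓡 r) x) :
    omega A (ixP p) ixL x v = ∑ q, gP A x p q * omega A ixO (ixP q) x v := by
  rw [h.omega_L hgen hx, ← h.form_dvert hx fun z hz => h.form_O_P z hz p, form_comm,
    h.form_P_dvert_O hx]

variable (hrank : HasRank f r)
include hrank

theorem eq_zero_of_omega_eq_zero (h : IsAdaptedFrame f gen W A) (hx : x ∈ W)
    {v : TangentSpace (𝓡 r) x} (hv : ∀ p, omega A ixO (ixP p) x v = 0) : v = 0 := by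
  refine h.isTangencyLift.eq_zero_of_mvfderiv_eq_smul hgen hrank hx (c := omega A ixO ixO x v) ?_
  rw [h.dvert_O hgen hx]
  simp [hv]

/-- If all `ω_0^p` vanish on `v`, then `dA_0(v)` is a multiple of `A_0`, so `v = 0` by the rank
condition. -/
theorem isInvertible_coframe (h : IsAdaptedFrame f gen W A) (hx : x ∈ W) :
    (coframe A x).IsInvertible := by
  let G : EuclideanSpace ℝ (Fin r) →L[ℝ] (Fin r → ℝ) := coframe A x
  have hinj : Function.Injective G.toLinearMap := by
    rw [← LinearMap.ker_eq_bot, LinearMap.ker_eq_bot']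
    exact fun v hv => h.eq_zero_of_omega_eq_zero hgen hrank hx fun p => congrFun hv p
  have hdim : finrank ℝ (EuclideanSpace ℝ (Fin r)) = finrank ℝ (Fin r → ℝ) := by simp
  exact ⟨(LinearEquiv.ofInjectiveOfFinrankEq _ hinj hdim).toContinuousLinearEquiv, by ext; rfl⟩

theorem omega_dualFrame (h : IsAdaptedFrame f gen W A) (hx : x ∈ W) (p q : Fin r) :
    omega A ixO (ixP p) x (dualFrame A q x) = if p = q then 1 else 0 := by
  have := (h.isInvertible_coframe hgen hrank hx).self_apply_inverse (Pi.single q (1 : ℝ))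
  refine (congrFun this p).trans ?_
  rw [Pi.single_apply]

theorem eq_sum_dualFrame (h : IsAdaptedFrame f gen W A) (hx : x ∈ W) (v : TangentSpace (𝓡 r) x) :
    v = ∑ p, omega A ixO (ixP p) x v • dualFrame A p x := by
  refine sub_eq_zero.1 (h.eq_zero_of_omega_eq_zero hgen hrank hx fun p => ?_)
  rw [map_sub, map_sum]
  simp [h.omega_dualFrame hgen hrank hx]

theorem clm_apply_eq_sum (h : IsAdaptedFrame f gen W A) (hx : x ∈ W) {F : Type*}
    [NormedAddCommGroup F] [NormedSpace ℝ F] (φ : TangentSpace (𝓡 r) x →L[ℝ] F)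
    (v : TangentSpace (𝓡 r) x) :
    φ v = ∑ p, omega A ixO (ixP p) x v • φ (dualFrame A p x) := by
  conv_lhs => rw [h.eq_sum_dualFrame hgen hrank hx v]
  simp only [map_sum, map_smul]

theorem dvert_O_dualFrame (h : IsAdaptedFrame f gen W A) (hx : x ∈ W) (q : Fin r) :
    dvert A ixO x (dualFrame A q x) =
      omega A ixO ixO x (dualFrame A q x) • A x ixO + A x (ixP q) := by
  rw [h.dvert_O hgen hx]
  simp [h.omega_dualFrame hgen hrank hx]

/-- `dA_0(e_q)` is `A_q` up to a multiple of `A_0`, and `A_0` is orthogonal to the image of `dA_0`.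
The dual fields thereby inherit the smoothness of the projection. -/
theorem dualFrame_eq_tproj (h : IsAdaptedFrame f gen W A) (hx : x ∈ W) (q : Fin r) :
    dualFrame A q x = tproj r (fun y => A y ixO) x (A x (ixP q)) := by
  refine (h.isTangencyLift.isSpacelike hgen hrank).eq_tproj hx fun v => ?_
  have h1 := h.isTangencyLift.form_mvfderiv hgen hx v
  have h2 := h.dvert_O_dualFrame hgen hrank hx q
  rw [h2, map_add, map_smul, LinearMap.add_apply, LinearMap.smul_apply, h1, smul_zero, zero_add]

variable [IsManifold (𝓡 r) ∞ M]

theorem contMDiffAt_dualFrame (h : IsAdaptedFrame f gen W A) (hx : x ∈ W) (q : Fin r) :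
    ContMDiffAt (𝓡 r) (𝓡 r).tangent ∞
      (fun x => (⟨x, dualFrame A q x⟩ : TangentBundle (𝓡 r) M)) x := by
  refine ((h.isTangencyLift.isSpacelike hgen hrank).contMDiffAt_tproj hx
    (h.contMDiffAt hx (ixP q))).congr_of_eventuallyEq ?_
  filter_upwards [h.isOpen.mem_nhds hx] with z hz
  rw [h.dualFrame_eq_tproj hgen hrank hz]

theorem contMDiffAt_omega_dualFrame (h : IsAdaptedFrame f gen W A) (hx : x ∈ W)
    (ξ η : FrameIndex r k) (q : Fin r) :
    ContMDiffAt (𝓡 r) 𝓘(ℝ, ℝ) ∞ (fun z => omega A ξ η z (dualFrame A q z)) x :=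
  h.contMDiffAt_coord hx (contMDiffAt_mvfderiv_apply (h.contMDiffAt hx ξ)
    (h.contMDiffAt_dualFrame hgen hrank hx q)) η

omit [IsManifold (𝓡 r) ∞ M] hgen hrank in
theorem contMDiffAt_form (h : IsAdaptedFrame f gen W A) (hx : x ∈ W) (ξ η : FrameIndex r k) :
    ContMDiffAt (𝓡 r) 𝓘(ℝ, ℝ) ∞ (fun z => form n (A z ξ) (A z η)) x :=
  (((formL n).contMDiff.contMDiffAt.comp x (h.contMDiffAt hx ξ)).clm_apply
    (h.contMDiffAt hx η) :)

omit [IsManifold (𝓡 r) ∞ M] hrank in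
theorem contMDiffAt_gP_inv (h : IsAdaptedFrame f gen W A) (hx : x ∈ W) (p q : Fin r) :
    ContMDiffAt (𝓡 r) 𝓘(ℝ, ℝ) ∞ (fun z => (gP A z)⁻¹ p q) x :=
  contMDiffAt_inv (fun _ _ => h.contMDiffAt_form hx _ _) (h.gP_posDef hgen hx).det_pos.ne' p q

theorem contMDiffAt_lamMean (h : IsAdaptedFrame f gen W A) (hx : x ∈ W) (α : Fin k) :
    ContMDiffAt (𝓡 r) 𝓘(ℝ, ℝ) ∞ (fun z => lamMean A z α) x :=
  contMDiffAt_const.mul (contMDiffAt_finsetSum fun p _ => contMDiffAt_finsetSum fun q _ =>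
    (h.contMDiffAt_gP_inv hgen hx p q).mul (h.contMDiffAt_omega_dualFrame hgen hrank hx _ _ q))

theorem contMDiffAt_aTensor (h : IsAdaptedFrame f gen W A) (hx : x ∈ W) (α : Fin k)
    (p q : Fin r) : ContMDiffAt (𝓡 r) 𝓘(ℝ, ℝ) ∞ (fun z => aTensor A z α p q) x :=
  (h.contMDiffAt_omega_dualFrame hgen hrank hx _ _ q).sub
    ((h.contMDiffAt_lamMean hgen hrank hx α).mul (h.contMDiffAt_form hx _ _))

theorem contMDiffAt_aUp (h : IsAdaptedFrame f gen W A) (hx : x ∈ W) (α β : Fin k) :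
    ContMDiffAt (𝓡 r) 𝓘(ℝ, ℝ) ∞ (fun z => aUp A z α β) x :=
  contMDiffAt_finsetSum fun _ _ => contMDiffAt_finsetSum fun _ _ =>
    contMDiffAt_finsetSum fun _ _ => contMDiffAt_finsetSum fun _ _ =>
      (((h.contMDiffAt_gP_inv hgen hx _ _).mul (h.contMDiffAt_gP_inv hgen hx _ _)).mul
        (h.contMDiffAt_aTensor hgen hrank hx _ _ _)).mul
          (h.contMDiffAt_aTensor hgen hrank hx _ _ _)

theorem contMDiffAt_aMixed (h : IsAdaptedFrame f gen W A) (hx : x ∈ W) (α β : Fin k) :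
    ContMDiffAt (𝓡 r) 𝓘(ℝ, ℝ) ∞ (fun z => aMixed A z α β) x := by
  have : (fun z => aMixed A z α β) = fun z => ∑ γ, gA A z α γ * aUp A z γ β := rfl
  rw [this]
  exact contMDiffAt_finsetSum fun γ _ => (h.contMDiffAt_form hx (ixA α) (ixA γ)).mul
    (h.contMDiffAt_aUp hgen hrank hx γ β)

theorem contMDiffAt_aInvariant (h : IsAdaptedFrame f gen W A) (hx : x ∈ W) (ρ : ℕ) :
    ContMDiffAt (𝓡 r) 𝓘(ℝ, ℝ) ∞ (aInvariant A ρ) x :=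
  contMDiffAt_finsetSum fun _ _ => contMDiffAt_det fun _ _ =>
    h.contMDiffAt_aMixed hgen hrank hx _ _

end IsAdaptedFrame

end Frames
end DeSitter

end

noncomputable section
namespace DeSitter

/-! ### Trace-free parts and minors under a linear change of frame -/

section FrameChangeAlgebra
open Matrix
open scoped Kronecker
variable {r k : ℕ}

/-- The part of `B` which is trace-free with respect to `G`. -/
def tracefree (G : Matrix (Fin r) (Fin r) ℝ) :
    Matrix (Fin r) (Fin r) ℝ →ₗ[ℝ] Matrix (Fin r) (Fin r) ℝ where
  toFun B := B - ((1 / (r : ℝ)) * (G⁻¹ * Bᵀ).trace) • G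
  map_add' B C := by
    simp only [transpose_add, mul_add, trace_add, add_smul]; abel
  map_smul' c B := by
    simp only [transpose_smul, Matrix.mul_smul, trace_smul, smul_eq_mul, RingHom.id_apply, smul_sub,
      smul_smul]
    congr 2; ring

theorem tracefree_apply (G B : Matrix (Fin r) (Fin r) ℝ) :
    tracefree G B = B - ((1 / (r : ℝ)) * (G⁻¹ * Bᵀ).trace) • G := rfl

theorem tracefree_self {G : Matrix (Fin r) (Fin r) ℝ} (hG : IsUnit G.det) (hs : Gᵀ = G) :
    tracefree G G = 0 := by
  ext i j
  have hr : (r : ℝ) ≠ 0 := Nat.cast_ne_zero.2 (Fin.pos i).ne'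
  rw [tracefree_apply, hs, nonsing_inv_mul _ hG, trace_one, Fintype.card_fin, one_div,
    inv_mul_cancel₀ hr, one_smul, sub_self]

theorem tracefree_conj {G T : Matrix (Fin r) (Fin r) ℝ} (hT : IsUnit T.det)
    (B : Matrix (Fin r) (Fin r) ℝ) :
    tracefree (T * G * Tᵀ) (T * B * Tᵀ) = T * tracefree G B * Tᵀ := by
  have hT' : IsUnit (Tᵀ).det := by rwa [det_transpose]
  have h1 : ((T * G * Tᵀ)⁻¹ * (T * B * Tᵀ)ᵀ).trace = (G⁻¹ * Bᵀ).trace := by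
    rw [Matrix.mul_inv_rev, Matrix.mul_inv_rev, transpose_mul, transpose_mul, transpose_transpose, trace_mul_comm]
    simp only [Matrix.mul_assoc]
    rw [mul_nonsing_inv_cancel_left _ _ hT', trace_mul_comm]
    simp only [Matrix.mul_assoc]
    rw [nonsing_inv_mul _ hT, Matrix.mul_one, trace_mul_comm]
  rw [tracefree_apply, tracefree_apply, h1, Matrix.mul_sub, Matrix.sub_mul, Matrix.mul_smul,
    Matrix.smul_mul]

theorem mul_kronecker_transpose_apply (X : Matrix (Fin k) (Fin r × Fin r) ℝ)
    (T : Matrix (Fin r) (Fin r) ℝ) (β : Fin k) (p t : Fin r) :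
    (X * (T ⊗ₖ T)ᵀ) β (p, t) = (T * (of fun q u => X β (q, u)) * Tᵀ) p t := by
  simp only [mul_apply, transpose_apply, kroneckerMap_apply, Fintype.sum_prod_type, of_apply,
    Finset.sum_mul]
  rw [Finset.sum_comm]
  exact Finset.sum_congr rfl fun _ _ => Finset.sum_congr rfl fun _ _ => by ring

/-- The factors `T` cancel against the inverse metric, and `S` survives only as a conjugation, which
does not affect the minors. What is left is the scalar `c ^ 2`. -/
theorem sumMinors_frame_change (ρ : ℕ) {G T : Matrix (Fin r) (Fin r) ℝ}
    {H S : Matrix (Fin k) (Fin k) ℝ} {X : Matrix (Fin k) (Fin r × Fin r) ℝ}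
    (hT : IsUnit T.det) (hS : IsUnit S.det) (c : ℝ) :
    sumMinors ρ ((c • (S * X * (T ⊗ₖ T)ᵀ)) * ((T * G * Tᵀ)⁻¹ ⊗ₖ (T * G * Tᵀ)⁻¹) *
      (c • (S * X * (T ⊗ₖ T)ᵀ))ᵀ * (S * H * Sᵀ)⁻¹) =
      (c ^ 2) ^ ρ * sumMinors ρ (X * (G⁻¹ ⊗ₖ G⁻¹) * Xᵀ * H⁻¹) := by
  have hT' : IsUnit (Tᵀ).det := by rwa [det_transpose]
  have hS' : IsUnit (Sᵀ).det := by rwa [det_transpose]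
  have h1 : Tᵀ * (T * G * Tᵀ)⁻¹ * T = G⁻¹ := by
    rw [Matrix.mul_inv_rev, Matrix.mul_inv_rev]
    simp only [Matrix.mul_assoc]
    rw [mul_nonsing_inv_cancel_left _ _ hT', nonsing_inv_mul _ hT, Matrix.mul_one]
  have h2 : (T ⊗ₖ T)ᵀ * ((T * G * Tᵀ)⁻¹ ⊗ₖ (T * G * Tᵀ)⁻¹) * (T ⊗ₖ T) = G⁻¹ ⊗ₖ G⁻¹ := by
    rw [← kroneckerMap_transpose, ← mul_kronecker_mul, ← mul_kronecker_mul, h1]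
  have h3 : (c • (S * X * (T ⊗ₖ T)ᵀ)) * ((T * G * Tᵀ)⁻¹ ⊗ₖ (T * G * Tᵀ)⁻¹) *
      -- The whole product is `c ^ 2` times a conjugate by `S` of the matrix on the right of the
      -- claim.
      (c • (S * X * (T ⊗ₖ T)ᵀ))ᵀ * (S * H * Sᵀ)⁻¹ =
      c ^ 2 • (S * ((X * (G⁻¹ ⊗ₖ G⁻¹) * Xᵀ * H⁻¹) * S⁻¹)) := by
    have h4 : Sᵀ * (S * (H * Sᵀ))⁻¹ = H⁻¹ * S⁻¹ := by
      rw [Matrix.mul_inv_rev, Matrix.mul_inv_rev, Matrix.mul_assoc,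
        mul_nonsing_inv_cancel_left _ _ hS']
    rw [← h2, transpose_smul, transpose_mul, transpose_mul, transpose_transpose, pow_two, mul_smul]
    simp only [Matrix.smul_mul, Matrix.mul_smul, Matrix.mul_assoc, h4]
  rw [h3, sumMinors_smul, sumMinors_mul_comm]
  simp only [Matrix.mul_assoc]
  rw [nonsing_inv_mul _ hS, Matrix.mul_one]

end FrameChangeAlgebra

/-! ### The transformation law of the relative invariant -/

section FrameChange
open Bundle Topology Module Matrix
open scoped Kronecker
variable {n r k : ℕ}
  {U : Type*} [TopologicalSpace U] [ChartedSpace (EuclideanSpace ℝ (Fin n)) U]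
  {M : Type*} [TopologicalSpace M] [ChartedSpace (EuclideanSpace ℝ (Fin r)) M]

/-- The second fundamental forms `(A_α, dA_p(e_q))`. -/
def secondForm (A : FrameField n r k M) (x : M) (α : Fin k) : Matrix (Fin r) (Fin r) ℝ :=
  of fun p q => form n (A x (ixA α)) (dvert A (ixP p) x (dualFrame A q x))

/-- The tensor `a_{αpq}`, as a rectangular matrix. -/
def aLow (A : FrameField n r k M) (x : M) : Matrix (Fin k) (Fin r × Fin r) ℝ :=
  of fun α pq => tracefree (gP A x) (secondForm A x α) pq.1 pq.2

theorem aMixed_eq (A : FrameField n r k M) (x : M) :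
    aMixed A x = gA A x * (aMatrix A x * ((gP A x)⁻¹ ⊗ₖ (gP A x)⁻¹) * (aMatrix A x)ᵀ) := by
  ext β α
  simp only [aMixed, aUp, of_apply, mul_apply (M := gA A x)]
  refine Finset.sum_congr rfl fun γ _ => congrArg _ ?_
  simp only [mul_apply, kroneckerMap_apply, aMatrix, of_apply, transpose_apply,
    Fintype.sum_prod_type, Finset.sum_mul]
  rw [Finset.sum_comm]
  refine Finset.sum_congr rfl fun q _ => ?_
  rw [Finset.sum_congr rfl fun p _ => Finset.sum_comm, Finset.sum_comm]
  exact Finset.sum_congr rfl fun t _ => Finset.sum_congr rfl fun p _ =>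
    Finset.sum_congr rfl fun s _ => by ring

namespace IsAdaptedFrame

variable {f : U → ℙ ℝ (Ambient n)} {gen : U → M} {W W' : Set M} {A A' : FrameField n r k M} {x : M}

theorem secondForm_eq (h : IsAdaptedFrame f gen W A) (hx : x ∈ W) (α : Fin k) :
    secondForm A x α = ∑ β, gA A x α β • of (lam A x β) := by
  ext p q
  simp only [secondForm, of_apply, h.form_A hx, Matrix.sum_apply, Matrix.smul_apply, smul_eq_mul]
  rfl

omit [TopologicalSpace U] [ChartedSpace (EuclideanSpace ℝ (Fin n)) U] in
theorem aTensor_eq (A : FrameField n r k M) (x : M) (α : Fin k) (p q : Fin r) :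
    aTensor A x α p q = tracefree (gP A x) (of (lam A x α)) p q := by
  rw [tracefree_apply]
  simp only [aTensor, lamMean, trace, diag_apply, mul_apply, transpose_apply, of_apply, Matrix.sub_apply,
    Matrix.smul_apply, smul_eq_mul]

theorem gA_mul_aMatrix (h : IsAdaptedFrame f gen W A) (hx : x ∈ W) :
    gA A x * aMatrix A x = aLow A x := by
  ext α pq
  simp only [aLow, of_apply, h.secondForm_eq hx, map_sum, map_smul, mul_apply, aMatrix, aTensor_eq,
    Matrix.sum_apply, Matrix.smul_apply, smul_eq_mul]

variable (hgen : IsGeneratorFibration (r := r) f gen)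
include hgen

/-- With the index `α` lowered, the tensor comes from scalar products `(A_α, dA_p)`, which are
easier to compare between frames than coordinates. -/
theorem aMixed_eq_aLow (h : IsAdaptedFrame f gen W A) (hx : x ∈ W) :
    aMixed A x = aLow A x * ((gP A x)⁻¹ ⊗ₖ (gP A x)⁻¹) * (aLow A x)ᵀ * (gA A x)⁻¹ := by
  have hdet : IsUnit (gA A x).det := (h.gA_posDef hgen hx).det_pos.ne'.isUnit
  rw [aMixed_eq, ← h.gA_mul_aMatrix hx, transpose_mul, gA_transpose]
  simp only [Matrix.mul_assoc]
  rw [mul_nonsing_inv _ hdet, Matrix.mul_one]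

/-- `a_β^α` is the product of the positive definite `g_{βγ}` with the Gram matrix of the rows of
`(a^α_{pq})` for the positive definite inverse metric. -/
theorem aInvariant_pos (h : IsAdaptedFrame f gen W A) (hx : x ∈ W) :
    0 < aInvariant A (aMatrix A x).rank x := by
  have := sumMinors_pos (h.gA_posDef hgen hx) ((h.gP_posDef hgen hx).inv.kronecker
    (h.gP_posDef hgen hx).inv) (aMatrix A x)
  rwa [← aMixed_eq] at this

variable (hf : IsLightlikeHypersurface f) (hrank : HasRank f r)
include hf

/-- The function `σ` in `A'_0 = σ A_0`. -/
theorem exists_change_O (h : IsAdaptedFrame f gen W A) (h' : IsAdaptedFrame f gen W' A') :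
    ∃ σ : M → ℝ, ∀ z ∈ W ∩ W', σ z ≠ 0 ∧ A' z ixO = σ z • A z ixO ∧
      MDifferentiableAt (𝓡 r) 𝓘(ℝ, ℝ) σ z := by
  refine ⟨fun z => - form n (A' z ixO) (A z ixL), fun z hz => ?_⟩
  obtain ⟨u, rfl⟩ := hgen.surjective z
  obtain ⟨c, hc, hcA⟩ := (h.tangency u hz.1).eq_smul hf (h'.tangency u hz.2)
  have h1 : - form n (A' (gen u) ixO) (A (gen u) ixL) = c := by
    rw [hcA, map_smul, LinearMap.smul_apply, h.form_O_L _ hz.1]; simp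
  exact ⟨h1.trans_ne hc, hcA.trans (congrArg (· • A (gen u) ixO) h1.symm),
    (mdifferentiableAt_form (h'.mdifferentiableAt hz.2 ixO) (h.mdifferentiableAt hz.1 ixL)).neg⟩

include hrank

/-- The points `A_0`, `A_p` span the tangent subspace of `V^r`, which belongs to no particular
frame. -/
theorem exists_change_P (h : IsAdaptedFrame f gen W A) (h' : IsAdaptedFrame f gen W' A')
    (hx : x ∈ W) (hx' : x ∈ W') : ∃ (σ : ℝ) (T : Matrix (Fin r) (Fin r) ℝ) (c : Fin r → ℝ),
      σ ≠ 0 ∧ A' x ixO = σ • A x ixO ∧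
      (∀ p, A' x (ixP p) = c p • A x ixO + ∑ q, T p q • A x (ixP q)) ∧
      ∀ p q, omega A ixO (ixP q) x (dualFrame A' p x) = σ⁻¹ * T p q := by
  obtain ⟨σ, hσ⟩ := exists_change_O hgen hf h h'
  obtain ⟨h0, hO, hd⟩ := hσ x ⟨hx, hx'⟩
  have hcongr : (fun z => A' z ixO) =ᶠ[𝓝 x] fun z => σ z • A z ixO :=
    Filter.eventually_of_mem ((h.isOpen.inter h'.isOpen).mem_nhds ⟨hx, hx'⟩) fun z hz => (hσ z hz).2.1
  have hdv : ∀ v, dvert A' ixO x v = σ x • dvert A ixO x v + mvfderiv (𝓡 r) σ x v • A x ixO := by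
    intro v
    rw [dvert, mvfderiv_congr hcongr]
    have := mvfderiv_smul hd (h.mdifferentiableAt hx ixO)
    exact congrArg (fun K : EuclideanSpace ℝ (Fin r) →L[ℝ] Ambient n => K v) this
  -- The coefficients come from comparing `dA'_0(e'_p) = ω'_0^0(e'_p) A'_0 + A'_p` with `d(σ
  -- A_0)(e'_p) = σ dA_0(e'_p) + dσ(e'_p) A_0`.
  refine ⟨σ x, of fun p q => σ x * omega A ixO (ixP q) x (dualFrame A' p x), fun p =>
    σ x * omega A ixO ixO x (dualFrame A' p x) + mvfderiv (𝓡 r) σ x (dualFrame A' p x) -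
      omega A' ixO ixO x (dualFrame A' p x) * σ x, h0, hO, fun p => ?_, fun p q => ?_⟩
  · have h1 := h'.dvert_O_dualFrame hgen hrank hx' p
    rw [hdv, h.dvert_O hgen hx, hO] at h1
    rw [← sub_eq_iff_eq_add'.2 h1]
    simp only [of_apply, smul_add, Finset.smul_sum, sub_smul, add_smul, mul_smul]
    abel
  · rw [of_apply, inv_mul_cancel_left₀ h0]

theorem form_A_change_P (h : IsAdaptedFrame f gen W A) (h' : IsAdaptedFrame f gen W' A')
    (hx : x ∈ W) (hx' : x ∈ W') (α : Fin k) (p : Fin r) :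
    form n (A x (ixA α)) (A' x (ixP p)) = 0 := by
  obtain ⟨σ, T, c, -, -, h1, -⟩ := exists_change_P hgen hf hrank h h' hx hx'
  rw [h1]
  simp [form_comm (A x (ixA α)), h.form_O_A x hx, h.form_P_A x hx]

theorem form_O_change_P (h : IsAdaptedFrame f gen W A) (h' : IsAdaptedFrame f gen W' A')
    (hx : x ∈ W) (hx' : x ∈ W') (p : Fin r) :
    form n (A x ixO) (A' x (ixP p)) = 0 := by
  obtain ⟨σ, T, c, -, -, h1, -⟩ := exists_change_P hgen hf hrank h h' hx hx'
  rw [h1]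
  simp [h.form_O_O hgen hx, h.form_O_P x hx]

/-- `A'_α` is orthogonal to `A_0`, hence has no component along `A_{n+1}`, and to the `A_p`, since
these lie in the span of `A'_0` and the `A'_p`. -/
theorem change_A (h : IsAdaptedFrame f gen W A) (h' : IsAdaptedFrame f gen W' A')
    (hx : x ∈ W) (hx' : x ∈ W') (α : Fin k) :
    A' x (ixA α) = (A x).coord ixO (A' x (ixA α)) • A x ixO +
      ∑ β, (A x).coord (ixA β) (A' x (ixA α)) • A x (ixA β) := by
  obtain ⟨σ, -, -, h0, hO, -⟩ := exists_change_P hgen hf hrank h h' hx hx'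
  have hL : (A x).coord ixL (A' x (ixA α)) = 0 := by
    rw [← neg_eq_zero, ← h.form_O hgen hx]
    have := h'.form_O_A x hx' α
    rw [hO, map_smul, LinearMap.smul_apply, smul_eq_mul] at this
    exact (mul_eq_zero.1 this).resolve_left h0
  have hP : ∀ p, (A x).coord (ixP p) (A' x (ixA α)) = 0 := by
    have h1 : (gP A x).mulVec (fun p => (A x).coord (ixP p) (A' x (ixA α))) = 0 := by
      ext q
      have := form_A_change_P hgen hf hrank h' h hx' hx α q
      rw [form_comm, h.form_P hx] at this
      exact this
    exact congrFun (Matrix.eq_zero_of_mulVec_eq_zero (h.gP_posDef hgen hx).det_pos.ne' h1)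
  conv_lhs => rw [basis_expand (A x) (A' x (ixA α))]
  simp only [hL, hP, zero_smul, Finset.sum_const_zero, zero_add, add_zero]

omit [TopologicalSpace U] [ChartedSpace (EuclideanSpace ℝ (Fin n)) U] hgen hf hrank in
theorem form_dvert_of_eq_zero {w w' : M → Ambient n} {V : Set M} (hV : IsOpen V) (hx : x ∈ V)
    (hw : MDifferentiableAt (𝓡 r) 𝓘(ℝ, Ambient n) w x)
    (hw' : MDifferentiableAt (𝓡 r) 𝓘(ℝ, Ambient n) w' x)
    (h0 : ∀ z ∈ V, form n (w z) (w' z) = 0) (v : TangentSpace (𝓡 r) x) :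
    form n (w x) (mvfderiv (𝓡 r) w' x v) = - form n (mvfderiv (𝓡 r) w x v) (w' x) := by
  have h1 := mvfderiv_form hw hw' v
  have h2 : (fun p => form n (w p) (w' p)) =ᶠ[𝓝 x] fun _ => 0 :=
    Filter.eventually_of_mem (hV.mem_nhds hx) h0
  rw [mvfderiv_congr h2, mvfderiv_const] at h1
  have h3 : (0 : ℝ) = _ := h1
  linarith

/-- The second fundamental forms transform as tensors with weight `σ⁻¹`, up to a multiple of
`g_{pq}` caused by the component of `A'_α` along `A_0`. Taking trace-free parts removes this
multiple, and `a` is homogeneous of degree `2ρ` in what remains. -/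
theorem aInvariant_change (h : IsAdaptedFrame f gen W A) (h' : IsAdaptedFrame f gen W' A')
    (hx : x ∈ W) (hx' : x ∈ W') (ρ : ℕ) : ∃ σ : ℝ, σ ≠ 0 ∧ A' x ixO = σ • A x ixO ∧
      aInvariant A' ρ x = ((σ⁻¹) ^ 2) ^ ρ * aInvariant A ρ x := by
  obtain ⟨σ, T, c, h0, hO, hP, hω⟩ := exists_change_P hgen hf hrank h h' hx hx'
  refine ⟨σ, h0, hO, ?_⟩
  set S : Matrix (Fin k) (Fin k) ℝ := of fun α β => (A x).coord (ixA β) (A' x (ixA α)) with hSdef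
  set s : Fin k → ℝ := fun α => (A x).coord ixO (A' x (ixA α))
  have hA : ∀ α, A' x (ixA α) = s α • A x ixO + ∑ β, S α β • A x (ixA β) :=
    change_A hgen hf hrank h h' hx hx'
  have hgP : gP A' x = T * gP A x * Tᵀ := by
    ext p q
    simp only [gP, of_apply, hP, map_add, map_smul, LinearMap.add_apply, LinearMap.smul_apply,
      map_sum, LinearMap.sum_apply, form_comm _ (A x ixO), h.form_O_O hgen hx, h.form_O_P x hx,
      smul_eq_mul, mul_zero, Finset.sum_const_zero, zero_add, add_zero, mul_apply, transpose_apply,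
      Finset.sum_mul, Finset.mul_sum]
    exact Finset.sum_congr rfl fun _ _ => Finset.sum_congr rfl fun _ _ => by ring
  have hgA : gA A' x = S * gA A x * Sᵀ := by
    ext p q
    simp only [gA, of_apply, hA, map_add, map_smul, LinearMap.add_apply, LinearMap.smul_apply,
      map_sum, LinearMap.sum_apply, form_comm _ (A x ixO), h.form_O_O hgen hx, h.form_O_A x hx,
      smul_eq_mul, mul_zero, Finset.sum_const_zero, zero_add, add_zero, mul_apply, transpose_apply,
      Finset.sum_mul, Finset.mul_sum]
    exact Finset.sum_congr rfl fun _ _ => Finset.sum_congr rfl fun _ _ => by ring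
  have hT : IsUnit T.det := by
    have := (h'.gP_posDef hgen hx').det_pos.ne'
    rw [hgP, det_mul, det_mul] at this
    exact (left_ne_zero_of_mul (left_ne_zero_of_mul this)).isUnit
  have hS : IsUnit S.det := by
    have := (h'.gA_posDef hgen hx').det_pos.ne'
    rw [hgA, det_mul, det_mul] at this
    exact (left_ne_zero_of_mul (left_ne_zero_of_mul this)).isUnit
  have hG : IsUnit (gP A x).det := (h.gP_posDef hgen hx).det_pos.ne'.isUnit
  have hG' : IsUnit (gP A' x).det := (h'.gP_posDef hgen hx').det_pos.ne'.isUnit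
  have hV := h.isOpen.inter h'.isOpen
  -- No derivative of `T` or `S` is needed: differentiating `(A_0, A'_p) = 0` and `(A_α, A'_p) = 0`
  -- moves the derivative to the old frame.
  have hB : ∀ α, secondForm A' x α =
      σ⁻¹ • (∑ β, S α β • (T * secondForm A x β * Tᵀ)) - (σ⁻¹ * s α) • gP A' x := by
    intro α
    ext p t
    have h1 : form n (A x ixO) (dvert A' (ixP p) x (dualFrame A' t x)) = - (σ⁻¹ * gP A' x p t) := by
      rw [form_dvert_of_eq_zero hV ⟨hx, hx'⟩ (h.mdifferentiableAt hx ixO)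
        (h'.mdifferentiableAt hx' (ixP p)) fun z hz => form_O_change_P hgen hf hrank h h' hz.1 hz.2 p,
        form_comm, hP, map_add, LinearMap.add_apply, map_smul, LinearMap.smul_apply,
        h.isTangencyLift.form_mvfderiv hgen hx, smul_zero, zero_add, hgP]
      simp only [map_sum, map_smul, LinearMap.sum_apply, LinearMap.smul_apply, smul_eq_mul,
        h.form_P_dvert_O hx, hω, mul_apply, transpose_apply, Finset.sum_mul, Finset.mul_sum]
      rw [Finset.sum_comm]
      exact congrArg _ (Finset.sum_congr rfl fun _ _ => Finset.sum_congr rfl fun _ _ => by ring)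
    have h2 : ∀ β, form n (A x (ixA β)) (dvert A' (ixP p) x (dualFrame A' t x)) =
        σ⁻¹ * (T * secondForm A x β * Tᵀ) p t := by
      intro β
      have h3 : form n (dvert A (ixA β) x (dualFrame A' t x)) (A x ixO) = 0 := by
        rw [form_comm, form_dvert_of_eq_zero h.isOpen hx (h.mdifferentiableAt hx ixO)
          (h.mdifferentiableAt hx (ixA β)) fun z hz => h.form_O_A z hz β, h.dvert_O hgen hx]
        simp [h.form_O_A x hx, h.form_P_A x hx]
      have h4 : ∀ q, form n (dvert A (ixA β) x (dualFrame A' t x)) (A x (ixP q)) =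
          - ∑ u, σ⁻¹ * T t u * secondForm A x β q u := by
        intro q
        rw [h.form_dvert hx (c := 0) fun z hz => by rw [form_comm, h.form_P_A z hz],
          h.clm_apply_eq_sum hgen hrank hx (dvert A (ixP q) x) (dualFrame A' t x)]
        simp only [map_sum, map_smul, smul_eq_mul, hω]
        rfl
      rw [form_dvert_of_eq_zero hV ⟨hx, hx'⟩ (h.mdifferentiableAt hx (ixA β))
        (h'.mdifferentiableAt hx' (ixP p)) fun z hz =>
          form_A_change_P hgen hf hrank h h' hz.1 hz.2 β p, hP]
      simp only [map_add, map_smul, map_sum, h3, h4, mul_zero, zero_add, smul_eq_mul, mul_neg,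
        Finset.sum_neg_distrib, neg_neg, mul_apply, transpose_apply, Finset.sum_mul, Finset.mul_sum]
      rw [Finset.sum_comm]
      exact Finset.sum_congr rfl fun _ _ => Finset.sum_congr rfl fun _ _ => by ring
    rw [secondForm, of_apply, hA]
    simp only [map_add, map_smul, map_sum, LinearMap.add_apply, LinearMap.smul_apply,
      LinearMap.sum_apply, h1, h2, smul_eq_mul, Matrix.sub_apply, Matrix.smul_apply,
      Matrix.sum_apply, Finset.mul_sum]
    rw [add_comm, mul_neg, ← sub_eq_add_neg]
    refine congrArg₂ (· - ·) (Finset.sum_congr rfl fun _ _ => by ring) (by ring)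
  have hlow : aLow A' x = σ⁻¹ • (S * aLow A x * (T ⊗ₖ T)ᵀ) := by
    ext α ⟨p, t⟩
    have h1 : aLow A' x α (p, t) = tracefree (gP A' x) (secondForm A' x α) p t := rfl
    have h2 : ∀ β, (of fun q u => aLow A x β (q, u)) = tracefree (gP A x) (secondForm A x β) :=
      fun β => rfl
    rw [h1, hB, map_sub, map_smul, map_smul, tracefree_self hG' (gP_transpose A' x), smul_zero,
      sub_zero, map_sum, Matrix.smul_apply, Matrix.smul_apply, Matrix.mul_assoc, mul_apply,
      Matrix.sum_apply, hgP]
    refine congrArg _ (Finset.sum_congr rfl fun β _ => ?_)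
    rw [map_smul, tracefree_conj hT, mul_kronecker_transpose_apply, h2]
    rfl
  have h1 : aInvariant A' ρ x = sumMinors ρ (aMixed A' x) := rfl
  have h2 : aInvariant A ρ x = sumMinors ρ (aMixed A x) := rfl
  rw [h1, h2, h'.aMixed_eq_aLow hgen hx', h.aMixed_eq_aLow hgen hx, hlow, hgP, hgA]
  exact sumMinors_frame_change ρ hT hS σ⁻¹

end IsAdaptedFrame
end FrameChange
end DeSitter

end

noncomputable section
namespace DeSitter

/-! ### Local sections and smooth choice of the point of tangency -/

section LocalSection
open Set Topology
variable {n r : ℕ}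
  {U : Type*} [TopologicalSpace U] [ChartedSpace (EuclideanSpace ℝ (Fin n)) U]
  [IsManifold (𝓡 n) ∞ U]
  {M : Type*} [TopologicalSpace M] [ChartedSpace (EuclideanSpace ℝ (Fin r)) M]
  [IsManifold (𝓡 r) ∞ M]

omit [IsManifold (𝓡 n) ∞ U] [IsManifold (𝓡 r) ∞ M] in
/-- A submersion has smooth local sections through all points. -/
theorem exists_local_section {g : U → M} (hg : Manifold.IsSubmersion (𝓡 n) (𝓡 r) ∞ g) (u : U) :
    ∃ (V : Set M) (s : M → U), IsOpen V ∧ g u ∈ V ∧ ContMDiffOn (𝓡 r) (𝓡 n) ∞ s V ∧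
      s (g u) = u ∧ ∀ z ∈ V, g (s z) = z := by
  have h := hg.isSubmersionAt u
  set φ := h.domChart.extend (𝓡 n)
  set ψ := h.codChart.extend (𝓡 r)
  have hφu : u ∈ φ.source := by
    rw [OpenPartialHomeomorph.extend_source]; exact h.mem_domChart_source
  have hψ : ψ.source = h.codChart.source := OpenPartialHomeomorph.extend_source _
  have hw : ∀ w ∈ φ.target, ψ (g (φ.symm w)) = (h.equiv w).1 := fun w hw => h.writtenInCharts hw
  have hu1 : ψ (g u) = (h.equiv (φ u)).1 := by
    rw [← hw _ (φ.map_source hφu), φ.left_inv hφu]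
  -- In charts adapted to the submersion, which is there a projection, the section keeps the
  -- complementary coordinate equal to that of `u`.
  let E : EuclideanSpace ℝ (Fin r) → EuclideanSpace ℝ (Fin n) :=
    fun a => h.equiv.symm (a, (h.equiv (φ u)).2)
  have hE : ContDiff ℝ ∞ E :=
    h.equiv.symm.contDiff.comp (contDiff_id.prodMk contDiff_const)
  have hψs : ContMDiffOn (𝓡 r) 𝓘(ℝ, EuclideanSpace ℝ (Fin r)) ∞ ψ h.codChart.source :=
    h.codChart.contMDiffOn_extend h.codChart_mem_maximalAtlas
  have hEψ : ContMDiffOn (𝓡 r) 𝓘(ℝ, EuclideanSpace ℝ (Fin n)) ∞ (fun z => E (ψ z))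
      h.codChart.source := hE.contMDiff.comp_contMDiffOn hψs
  have hφs : ContMDiffOn 𝓘(ℝ, EuclideanSpace ℝ (Fin n)) (𝓡 n) ∞ φ.symm φ.target := by
    have := contMDiffOn_extend_symm h.domChart_mem_maximalAtlas
    rwa [← OpenPartialHomeomorph.extend_target'] at this
  have hEu : E (ψ (g u)) = φ u := by
    simp only [E, hu1, Prod.mk.eta, ContinuousLinearEquiv.symm_apply_apply]
  refine ⟨h.codChart.source ∩ (fun z => E (ψ z)) ⁻¹' φ.target, fun z => φ.symm (E (ψ z)),
    hEψ.continuousOn.isOpen_inter_preimage h.codChart.open_source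
      (OpenPartialHomeomorph.isOpen_extend_target _), ⟨h.mem_codChart_source, ?_⟩, ?_, ?_, ?_⟩
  · rw [mem_preimage, hEu]; exact φ.map_source hφu
  · exact hφs.comp (hEψ.mono inter_subset_left) inter_subset_right
  · exact (congrArg φ.symm hEu).trans (φ.left_inv hφu)
  · rintro z ⟨hz, hz'⟩
    refine ψ.injOn ?_ (hψ ▸ hz) ?_
    · rw [hψ]
      refine h.source_subset_preimage_source ?_
      have := φ.map_target hz'
      rwa [OpenPartialHomeomorph.extend_source] at this
    · rw [hw _ hz']
      simp only [E, ContinuousLinearEquiv.apply_symm_apply]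

omit [IsManifold (𝓡 n) ∞ U] [IsManifold (𝓡 r) ∞ M] in
theorem mfderiv_surjective_of_section {g : U → M} {u : U} {V : Set M} {s : M → U}
    (hg : MDifferentiableAt (𝓡 n) (𝓡 r) g u) (hV : V ∈ 𝓝 (g u))
    (hs : MDifferentiableAt (𝓡 r) (𝓡 n) s (g u)) (hsu : s (g u) = u) (hgs : ∀ z ∈ V, g (s z) = z)
    (v : TangentSpace (𝓡 r) (g u)) : ∃ w, mfderiv (𝓡 n) (𝓡 r) g u w = v := by
  have h1 : mfderiv (𝓡 r) (𝓡 r) (g ∘ s) (g u) = ContinuousLinearMap.id ℝ _ := by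
    have h2 : g ∘ s =ᶠ[𝓝 (g u)] id := Filter.eventually_of_mem hV hgs
    exact h2.mfderiv_eq.trans mfderiv_id
  have hg' : MDifferentiableAt (𝓡 n) (𝓡 r) g (s (g u)) := by rwa [hsu]
  have h3 := mfderiv_comp (g u) hg' hs
  have key : ∀ p, p = u → ∀ (L : EuclideanSpace ℝ (Fin r) →L[ℝ] EuclideanSpace ℝ (Fin n)),
      (mfderiv (𝓡 n) (𝓡 r) g p : EuclideanSpace ℝ (Fin n) →L[ℝ] EuclideanSpace ℝ (Fin r)).comp L =
        ContinuousLinearMap.id ℝ _ →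
      ∃ w, (mfderiv (𝓡 n) (𝓡 r) g u : EuclideanSpace ℝ (Fin n) →L[ℝ] EuclideanSpace ℝ (Fin r)) w
        = v := by
    rintro p rfl L hL
    exact ⟨L v, congrArg (fun K : EuclideanSpace ℝ (Fin r) →L[ℝ] EuclideanSpace ℝ (Fin r) => K v) hL⟩
  exact key _ hsu _ (h3.symm.trans h1)

theorem contMDiffAt_localFrame_apply {F : Type*} [NormedAddCommGroup F] [NormedSpace ℝ F]
    {y : M → F} {x x₀ : M} (hx : x ∈ (triv r x₀).baseSet)
    (hy : ContMDiffAt (𝓡 r) 𝓘(ℝ, F) ∞ y x) (v : EuclideanSpace ℝ (Fin r)) :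
    ContMDiffAt (𝓡 r) 𝓘(ℝ, F) ∞ (fun z => mvfderiv (𝓡 r) y z ((triv r x₀).symmL ℝ z v)) x := by
  refine contMDiffAt_mvfderiv_apply hy ?_
  refine ((triv r x₀).contMDiffAt_section_iff (IB := 𝓡 r) (F := EuclideanSpace ℝ (Fin r))
    (E := (TangentSpace (𝓡 r) : M → Type _)) hx).2 ?_
  refine contMDiffAt_const (c := v) |>.congr_of_eventuallyEq ?_
  filter_upwards [(triv r x₀).open_baseSet.mem_nhds hx] with z hz
  have := (triv r x₀).continuousLinearMapAt_symmL (R := ℝ) hz v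
  rwa [(triv r x₀).continuousLinearMapAt_apply ℝ, (triv r x₀).coe_linearMapAt_of_mem hz] at this

theorem clm_eq_sum_smulRightL {F : Type*} [NormedAddCommGroup F] [NormedSpace ℝ F]
    (L : EuclideanSpace ℝ (Fin r) →L[ℝ] F) :
    L = ∑ i, ContinuousLinearMap.smulRightL ℝ _ F (EuclideanSpace.proj i)
      (L (EuclideanSpace.single i 1)) := by
  ext v
  have hv := (EuclideanSpace.basisFun (Fin r) ℝ).sum_repr v
  conv_lhs => rw [← hv]
  simp [_root_.sum_apply]

/-- Smoothness at every point of the base set, not only at the centre of the trivialization; the map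
is recovered from its values on the standard basis. -/
theorem contMDiffAt_mvfderiv_comp_symmL_of_mem {F : Type*} [NormedAddCommGroup F]
    [NormedSpace ℝ F] {y : M → F} {x x₀ : M} (hx : x ∈ (triv r x₀).baseSet)
    (hy : ContMDiffAt (𝓡 r) 𝓘(ℝ, F) ∞ y x) :
    ContMDiffAt (𝓡 r) 𝓘(ℝ, EuclideanSpace ℝ (Fin r) →L[ℝ] F) ∞
      (fun z => (mvfderiv (𝓡 r) y z).comp ((triv r x₀).symmL ℝ z)) x := by
  let D : M → EuclideanSpace ℝ (Fin r) →L[ℝ] F := fun z =>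
    (mvfderiv (𝓡 r) y z).comp ((triv r x₀).symmL ℝ z)
  have hD : D = fun z => ∑ i, ContinuousLinearMap.smulRightL ℝ _ F (EuclideanSpace.proj i)
      (D z (EuclideanSpace.single i 1)) := funext fun z => clm_eq_sum_smulRightL (D z)
  suffices h : ContMDiffAt (𝓡 r) 𝓘(ℝ, EuclideanSpace ℝ (Fin r) →L[ℝ] F) ∞ D x from h
  rw [hD]
  refine contMDiffAt_finsetSum fun i _ => ?_
  let L : F →L[ℝ] EuclideanSpace ℝ (Fin r) →L[ℝ] F :=
    ContinuousLinearMap.smulRightL ℝ _ F (EuclideanSpace.proj i)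
  exact (L.contMDiff (n := ∞)).contMDiffAt.comp x
    (contMDiffAt_localFrame_apply hx hy (EuclideanSpace.single i 1))

theorem isInvertible_formL (n : ℕ) : (formL n).IsInvertible := by
  have hinj : Function.Injective (formL n).toLinearMap := by
    rw [← LinearMap.ker_eq_bot, LinearMap.ker_eq_bot']
    exact fun v hv => eq_zero_of_form_eq_zero fun w => congrArg (fun f : Ambient n →L[ℝ] ℝ => f w) hv
  have hdim : Module.finrank ℝ (Ambient n) = Module.finrank ℝ (Ambient n →L[ℝ] ℝ) := by
    rw [← (LinearMap.toContinuousLinearMap (𝕜 := ℝ) (E := Ambient n) (F' := ℝ)).finrank_eq]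
    exact (Subspace.dual_finrank_eq (K := ℝ) (V := Ambient n)).symm
  exact ⟨(LinearEquiv.ofInjectiveOfFinrankEq _ hinj hdim).toContinuousLinearEquiv, by ext; rfl⟩

omit [IsManifold (𝓡 r) ∞ M] in
/-- Around every generator the points of tangency have smooth homogeneous coordinates. -/
theorem exists_isTangencyLift {f : U → ℙ ℝ (Ambient n)} {gen : U → M}
    (hf : IsLightlikeHypersurface f) (hgen : IsGeneratorFibration (r := r) f gen) (x : M) :
    ∃ (W : Set M) (y : M → Ambient n), x ∈ W ∧ IsTangencyLift r f gen W y := by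
  obtain ⟨u, rfl⟩ := hgen.surjective x
  obtain ⟨V, s, hV, hxV, hs, hsu, hgs⟩ := exists_local_section hgen.submersion u
  obtain ⟨W₀, X, hX, hu⟩ := hf.exists_lift u
  let E := EuclideanSpace ℝ (Fin n)
  let N : Set U := W₀ ∩ (triv n u).baseSet
  let P : Set M := V ∩ s ⁻¹' N
  have huN : u ∈ N := ⟨hu, FiberBundle.mem_baseSet_trivializationAt' u⟩
  have hP : IsOpen P := hs.continuousOn.isOpen_inter_preimage hV
    (hX.isOpen.inter (triv n u).open_baseSet)
  have hxP : gen u ∈ P := ⟨hxV, by rw [mem_preimage, hsu]; exact huN⟩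
  -- A vector transversal to the tangent hyperplane at `u`; it stays transversal nearby and
  -- normalizes the pole by `(y, w) = 1`.
  obtain ⟨w, hw⟩ : ∃ w, w ∉ tangentSpan X u := by
    by_contra! h
    have h1 : tangentSpan X u = ⊤ := Submodule.eq_top_iff'.2 h
    have h2 := hf.immersion W₀ X hX u hu
    rw [h1, finrank_top] at h2
    simp at h2
  let φ0 : (ℝ × E) × ℝ →L[ℝ] ℝ :=
    (ContinuousLinearMap.fst ℝ ℝ E).comp (ContinuousLinearMap.fst ℝ (ℝ × E) ℝ)
  let φ1 : (ℝ × E) × ℝ →L[ℝ] E :=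
    (ContinuousLinearMap.snd ℝ ℝ E).comp (ContinuousLinearMap.fst ℝ (ℝ × E) ℝ)
  let φ2 : (ℝ × E) × ℝ →L[ℝ] ℝ := ContinuousLinearMap.snd ℝ (ℝ × E) ℝ
  let D : U → E →L[ℝ] Ambient n := fun p => (mvfderiv (𝓡 n) X p).comp ((triv n u).symmL ℝ p)
  -- `C p` parametrizes the ambient space by the tangent hyperplane and the line of `w`. It is
  -- invertible at `u` by the dimension of the tangent span, hence at nearby points.
  let C : U → (ℝ × E) × ℝ →L[ℝ] Ambient n := fun p =>
    ContinuousLinearMap.smulRightL ℝ _ _ φ0 (X p) + (D p).comp φ1 +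
      ContinuousLinearMap.smulRightL ℝ _ _ φ2 w
  have hCa : ∀ p t v τ, C p ((t, v), τ) = t • X p + D p v + τ • w := fun p t v τ => rfl
  have hCs : ∀ p ∈ N, ∀ v ∈ tangentSpan X p, ∃ c, C p (c, 0) = v := by
    intro p hp v hv
    obtain ⟨a, ha, b, hb, rfl⟩ := Submodule.mem_sup.1 hv
    obtain ⟨t, rfl⟩ := Submodule.mem_span_singleton.1 ha
    obtain ⟨z, rfl⟩ := hb
    refine ⟨(t, (triv n u).continuousLinearMapAt ℝ p z), ?_⟩
    rw [hCa, zero_smul, add_zero]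
    refine congrArg (t • X p + ·) ?_
    exact congrArg (mvfderiv (𝓡 n) X p) ((triv n u).symmL_continuousLinearMapAt (R := ℝ) hp.2 z)
  have hCu : (C u).IsInvertible := by
    have hsurj : Function.Surjective (C u).toLinearMap := by
      rw [← LinearMap.range_eq_top]
      have hle : tangentSpan X u ≤ LinearMap.range (C u).toLinearMap := fun v hv => by
        obtain ⟨c, hc⟩ := hCs u huN v hv
        exact ⟨_, hc⟩
      have hwr : w ∈ LinearMap.range (C u).toLinearMap := ⟨((0, 0), 1), by
        refine (hCa u 0 0 1).trans ?_
        rw [zero_smul, map_zero, one_smul, zero_add, zero_add]⟩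
      have hlt : tangentSpan X u < LinearMap.range (C u).toLinearMap :=
        lt_of_le_of_ne hle fun h => hw (h ▸ hwr)
      have h1 := Submodule.finrank_lt_finrank_of_lt hlt
      rw [hf.immersion W₀ X hX u hu] at h1
      refine Submodule.eq_top_of_finrank_eq (le_antisymm (Submodule.finrank_le _) ?_)
      have h2 : Module.finrank ℝ (Ambient n) = n + 2 := by simp
      rw [h2]
      exact h1
    have hdim : Module.finrank ℝ ((ℝ × E) × ℝ) = Module.finrank ℝ (Ambient n) := by
      simp [E]; ring
    have hinj := (LinearMap.injective_iff_surjective_of_finrank_eq_finrank hdim).2 hsurj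
    exact ⟨(LinearEquiv.ofInjectiveOfFinrankEq _ hinj hdim).toContinuousLinearEquiv,
      ContinuousLinearMap.ext fun v => rfl⟩
  have hCsm : ∀ z ∈ P, ContMDiffAt (𝓡 r) 𝓘(ℝ, (ℝ × E) × ℝ →L[ℝ] Ambient n) ∞
      (fun z => C (s z)) z := by
    intro z hz
    have hsz : ContMDiffAt (𝓡 r) (𝓡 n) ∞ s z := hs.contMDiffAt (hV.mem_nhds hz.1)
    have hXp : ContMDiffAt (𝓡 n) 𝓘(ℝ, Ambient n) ∞ X (s z) :=
      hX.smooth.contMDiffAt (hX.isOpen.mem_nhds hz.2.1)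
    have hDp : ContMDiffAt (𝓡 n) 𝓘(ℝ, E →L[ℝ] Ambient n) ∞ D (s z) :=
      contMDiffAt_mvfderiv_comp_symmL_of_mem hz.2.2 hXp
    have h1 : ContMDiffAt (𝓡 n) 𝓘(ℝ, (ℝ × E) × ℝ →L[ℝ] Ambient n) ∞ C (s z) :=
      (((ContinuousLinearMap.contMDiff _).contMDiffAt.comp (s z) hXp).add
        (hDp.clm_comp contMDiffAt_const)).add contMDiffAt_const
    exact h1.comp z hsz
  -- The pole of the tangent hyperplane at `s z`: its functional is the last coordinate of the
  -- inverse of `C`, which vanishes on the hyperplane and equals `1` on `w`.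
  let y : M → Ambient n := fun z =>
    (formL n).inverse (φ2.comp (C (s z)).inverse)
  have hy : ∀ z v, form n (y z) v = ((C (s z)).inverse v).2 := fun z v =>
    congrArg (fun f : Ambient n →L[ℝ] ℝ => f v) ((isInvertible_formL n).self_apply_inverse _)
  have hCinv : ∀ z, (C (s z)).IsInvertible → ∀ c, (C (s z)).inverse (C (s z) c) = c :=
    fun z hz c => hz.inverse_apply_self c
  have hopen : IsOpen {L : (ℝ × E) × ℝ →L[ℝ] Ambient n | L.IsInvertible} :=
    ContinuousLinearEquiv.isOpen
  refine ⟨P ∩ (fun z => C (s z)) ⁻¹' {L | L.IsInvertible}, y,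
    ⟨hxP, ?_⟩, ?_, ?_, ?_⟩
  · rw [mem_preimage, hsu]; exact hCu
  · exact ContinuousOn.isOpen_inter_preimage
      (fun z hz => (hCsm z hz).continuousAt.continuousWithinAt) hP hopen
  · rintro z ⟨hz, hz'⟩
    have hinv : (C (s z)).IsInvertible := hz'
    have h1 : ContMDiffAt (𝓡 r) 𝓘(ℝ, Ambient n →L[ℝ] (ℝ × E) × ℝ) ∞
        (fun z => (C (s z)).inverse) z :=
      ContDiffAt.comp_contMDiffAt (g := ContinuousLinearMap.inverse) (f := fun z => C (s z))
        hinv.contDiffAt_map_inverse (hCsm z hz)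
    have h2 : ContMDiffAt (𝓡 r) 𝓘(ℝ, Ambient n →L[ℝ] ℝ) ∞
        (fun z => φ2.comp (C (s z)).inverse) z := contMDiffAt_const.clm_comp h1
    exact ((ContinuousLinearMap.contMDiff _).contMDiffAt.comp z h2).contMDiffWithinAt
  · rintro u' ⟨hz, hz'⟩
    have hinv : (C (s (gen u'))).IsInvertible := hz'
    have hsg : gen (s (gen u')) = gen u' := hgs _ hz.1
    obtain ⟨y', hy'⟩ := hf.lightlike (s (gen u'))
    obtain ⟨c, hc⟩ := eq_smul_of_form hy'.1 (y' := y (gen u')) fun v hv => by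
      rw [← mem_orthogonal_span, ← hy'.2.2 W₀ X hX hz.2.1] at hv
      obtain ⟨c, rfl⟩ := hCs _ hz.2 v hv
      rw [hy, hCinv _ hinv]
    have hyw : form n (y (gen u')) w = 1 := by
      have h1 : C (s (gen u')) ((0, 0), 1) = w := by
        rw [hCa, zero_smul, map_zero, one_smul, zero_add, zero_add]
      rw [hy, ← h1, hCinv _ hinv]
    -- The pole was found at `s (gen u')`; constancy of the tangent hyperplane along the generator
    -- carries it to `u'`.
    refine hgen.tangent_const _ u' hsg _ ?_
    rw [hc]
    refine hy'.smul fun h0 => ?_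
    rw [hc, h0, zero_smul, map_zero] at hyw
    exact zero_ne_one hyw

end LocalSection
end DeSitter

end

noncomputable section
namespace DeSitter

/-! ### Construction of adapted frames -/

section Completion
open Set Topology Module
variable {n r k : ℕ}

/-- The scalar products of the vertices of an adapted frame. -/
structure IsAdaptedTuple (b : FrameIndex r k → Ambient n) : Prop where
  O_O : form n (b ixO) (b ixO) = 0
  O_P : ∀ p, form n (b ixO) (b (ixP p)) = 0
  O_A : ∀ α, form n (b ixO) (b (ixA α)) = 0
  O_L : form n (b ixO) (b ixL) = -1
  P_A : ∀ p α, form n (b (ixP p)) (b (ixA α)) = 0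
  P_L : ∀ p, form n (b (ixP p)) (b ixL) = 0
  A_L : ∀ α, form n (b (ixA α)) (b ixL) = 0
  L_L : form n (b ixL) (b ixL) = 0
  det_P : (Matrix.of fun p q => form n (b (ixP p)) (b (ixP q))).det ≠ 0
  det_A : (Matrix.of fun α β => form n (b (ixA α)) (b (ixA β))).det ≠ 0

namespace IsAdaptedTuple

/-- The Gram matrix is block-nondegenerate: the coordinate along `A_0` is seen by `A_{n+1}` and
conversely, and the blocks of the `A_p` and of the `A_α` see themselves. -/
theorem eq_zero_of_sum {b : FrameIndex r k → Ambient n} (h : IsAdaptedTuple b)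
    {c : FrameIndex r k → ℝ} {w : Ambient n}
    (hw : w = c ixO • b ixO + (∑ p, c (ixP p) • b (ixP p) +
      (∑ α, c (ixA α) • b (ixA α) + c ixL • b ixL))) :
    (form n (b ixO) w = 0 → c ixL = 0) ∧ (form n (b ixL) w = 0 → c ixO = 0) ∧
      ((∀ q, form n (b (ixP q)) w = 0) → ∀ p, c (ixP p) = 0) ∧
      ((∀ β, form n (b (ixA β)) w = 0) → ∀ α, c (ixA α) = 0) := by
  subst hw
  refine ⟨fun h1 => ?_, fun h1 => ?_, fun h1 p => ?_, fun h1 α => ?_⟩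
  · simpa [h.O_O, h.O_P, h.O_A, h.O_L] using h1
  · simpa [form_comm (b ixL), h.L_L, h.P_L, h.A_L, h.O_L] using h1
  · refine congrFun (Matrix.eq_zero_of_mulVec_eq_zero h.det_P (v := fun p => c (ixP p))
      (funext fun q => ?_)) p
    have := h1 q
    simpa [form_comm (b (ixP q)) (b ixO), h.O_P, h.P_A, h.P_L, Matrix.mulVec, dotProduct,
      mul_comm] using this
  · refine congrFun (Matrix.eq_zero_of_mulVec_eq_zero h.det_A (v := fun p => c (ixA p))
      (funext fun q => ?_)) α
    have := h1 q
    simpa [form_comm (b (ixA q)) (b ixO), form_comm (b (ixA q)) (b (ixP _)), h.O_A, h.P_A, h.A_L,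
      Matrix.mulVec, dotProduct, mul_comm] using this

theorem linearIndependent {b : FrameIndex r k → Ambient n} (h : IsAdaptedTuple b) :
    LinearIndependent ℝ b := by
  rw [Fintype.linearIndependent_iff]
  intro c hc
  simp only [Fintype.sum_sum_type, Finset.univ_unique, Finset.sum_singleton] at hc
  obtain ⟨hL, hO, hP, hA⟩ := h.eq_zero_of_sum hc.symm
  simp only [map_zero, forall_const] at hL hO hP hA
  rintro (_ | p | α | _)
  exacts [hO, hP p, hA α, hL]

/-- The basis of vertices. -/
def basis (hn : n = r + k) {b : FrameIndex r k → Ambient n} (h : IsAdaptedTuple b) :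
    Basis (FrameIndex r k) ℝ (Ambient n) :=
  basisOfLinearIndependentOfCardEqFinrank h.linearIndependent (by simp; omega)

theorem basis_apply (hn : n = r + k) {b : FrameIndex r k → Ambient n} (h : IsAdaptedTuple b)
    (ξ : FrameIndex r k) : h.basis hn ξ = b ξ := by
  rw [basis, coe_basisOfLinearIndependentOfCardEqFinrank]

end IsAdaptedTuple

variable
  {U : Type*} [TopologicalSpace U] [ChartedSpace (EuclideanSpace ℝ (Fin n)) U]
  {M : Type*} [TopologicalSpace M] [ChartedSpace (EuclideanSpace ℝ (Fin r)) M]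
  {f : U → ℙ ℝ (Ambient n)} {gen : U → M} {W : Set M}

/-- Frames can be prescribed as vectors with the right scalar products: these force a basis.
Orthogonality of the `A_α` to `dA_0` is the condition `ω_0^α = 0`. -/
theorem exists_adaptedFrame_of_tuples (hn : n = r + k) {a : FrameIndex r k → M → Ambient n}
    (hO : IsTangencyLift r f gen W (a ixO))
    (hs : ∀ ξ, ContMDiffOn (𝓡 r) 𝓘(ℝ, Ambient n) ∞ (a ξ) W)
    (ha : ∀ x ∈ W, IsAdaptedTuple fun ξ => a ξ x)
    (ht : ∀ x ∈ W, ∀ α v, form n (a (ixA α) x) (mvfderiv (𝓡 r) (a ixO) x v) = 0) :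
    ∃ A : FrameField n r k M, IsAdaptedFrame f gen W A ∧ ∀ x ∈ W, ∀ ξ, A x ξ = a ξ x := by
  classical
  have hcard : Fintype.card (Fin (n + 2)) = Fintype.card (FrameIndex r k) := by simp; omega
  -- A frame field is defined on all of `M`, so an arbitrary basis is used wherever the vectors are
  -- not an adapted tuple.
  let A : FrameField n r k M := fun x =>
    if h : IsAdaptedTuple (fun ξ => a ξ x) then h.basis hn
    else (Pi.basisFun ℝ (Fin (n + 2))).reindex (Fintype.equivOfCardEq hcard)
  have hA : ∀ x ∈ W, ∀ ξ, A x ξ = a ξ x := fun x hx ξ => by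
    simp only [A, dif_pos (ha x hx), IsAdaptedTuple.basis_apply]
  refine ⟨A, ⟨hO.isOpen, fun ξ => (hs ξ).congr fun x hx => hA x hx ξ, fun u hu => ?_,
    fun x hx α => ?_, ?_, ?_, ?_, ?_, ?_, ?_, ?_⟩, hA⟩
  · rw [hA _ hu]; exact hO.tangency u hu
  · have hc : (fun z => A z ixO) =ᶠ[𝓝 x] a ixO :=
      Filter.eventually_of_mem (hO.isOpen.mem_nhds hx) fun z hz => hA z hz ixO
    ext1 v
    have h1 : dvert A ixO x v = mvfderiv (𝓡 r) (a ixO) x v := by rw [dvert, mvfderiv_congr hc]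
    have h2 := basis_expand (A x) (dvert A ixO x v)
    have h3 : IsAdaptedTuple fun ξ => A x ξ := by
      simp only [hA x hx]; exact ha x hx
    refine (h3.eq_zero_of_sum (c := fun ξ => (A x).coord ξ (dvert A ixO x v)) h2).2.2.2
      (fun β => ?_) α
    rw [hA x hx, h1]
    exact ht x hx β v
  all_goals intro x hx; simp only [hA x hx]
  exacts [(ha x hx).O_P, (ha x hx).O_A, (ha x hx).O_L, (ha x hx).P_A, (ha x hx).P_L,
    (ha x hx).A_L, (ha x hx).L_L]

/-- The component of `w` orthogonal to the image of `dy`. -/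
def perp (r : ℕ) {M : Type*} [TopologicalSpace M] [ChartedSpace (EuclideanSpace ℝ (Fin r)) M]
    (y : M → Ambient n) (x : M) (w : Ambient n) : Ambient n :=
  w - mvfderiv (𝓡 r) y x (tproj r y x w)

theorem IsSpacelike.form_perp {y : M → Ambient n} {x : M} (h : IsSpacelike r y W) (hx : x ∈ W)
    (w : Ambient n) (v : TangentSpace (𝓡 r) x) :
    form n (perp r y x w) (mvfderiv (𝓡 r) y x v) = 0 := by
  rw [perp, map_sub, LinearMap.sub_apply, h.form_tproj hx, sub_self]

variable [IsManifold (𝓡 r) ∞ M]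

theorem IsSpacelike.contMDiffAt_perp {y : M → Ambient n} {x : M} (h : IsSpacelike r y W)
    (hx : x ∈ W) (w : Ambient n) :
    ContMDiffAt (𝓡 r) 𝓘(ℝ, Ambient n) ∞ (fun z => perp r y z w) x :=
  contMDiffAt_const.sub (contMDiffAt_mvfderiv_apply (h.contMDiffAt hx)
    (h.contMDiffAt_tproj hx contMDiffAt_const))

omit [IsManifold (𝓡 r) ∞ M] in
theorem contMDiffAt_form {y z : M → Ambient n} {x : M}
    (hy : ContMDiffAt (𝓡 r) 𝓘(ℝ, Ambient n) ∞ y x) (hz : ContMDiffAt (𝓡 r) 𝓘(ℝ, Ambient n) ∞ z x) :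
    ContMDiffAt (𝓡 r) 𝓘(ℝ, ℝ) ∞ (fun p => form n (y p) (z p)) x :=
  ((((formL n).contMDiff (n := ∞)).contMDiffAt.comp x hy).clm_apply hz :)

variable (hgen : IsGeneratorFibration (r := r) f gen) (hrank : HasRank f r)
include hgen hrank

/-- The `A_p` are taken in the image of `dy` itself, so for the normalized lift they will lie in the
screens. -/
theorem IsTangencyLift.exists_adaptedFrame (hn : n = r + k) {y : M → Ambient n} {x : M}
    (h : IsTangencyLift r f gen W y) (hx : x ∈ W) :
    ∃ (W' : Set M) (A : FrameField n r k M), x ∈ W' ∧ W' ⊆ W ∧ IsAdaptedFrame f gen W' A ∧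
      ∀ z ∈ W', A z ixO = y z ∧
        ∀ p, A z (ixP p) ∈ LinearMap.range (mvfderiv (𝓡 r) y z).toLinearMap := by
  have hsp := h.isSpacelike hgen hrank
  obtain ⟨l, hl⟩ : ∃ l, form n (y x) l ≠ 0 := by
    by_contra! h0
    exact h.ne_zero hgen hx (eq_zero_of_form_eq_zero h0)
  let P : Fin r → M → Ambient n := fun p z =>
    mvfderiv (𝓡 r) y z ((triv r x).symmL ℝ z (EuclideanSpace.single p 1))
  -- `L2` is orthogonal to the image of `dy` and scaled to `(y, L2) = -1`; adding half of `(L2, L2)`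
  -- times `y` then makes `L` isotropic.
  let L2 : M → Ambient n := fun z => (-(form n (y z) l)⁻¹) • perp r y z l
  let L : M → Ambient n := fun z => L2 z + ((1 / 2) * form n (L2 z) (L2 z)) • y z
  have hyl : ∀ z ∈ W, ∀ w, form n (y z) (perp r y z w) = form n (y z) w := fun z hz w => by
    rw [perp, map_sub, h.form_mvfderiv hgen hz, sub_zero]
  let V0 : Set M := (W ∩ (triv r x).baseSet) ∩ (fun z => form n (y z) l) ⁻¹' {0}ᶜ
  have hκ : ∀ z ∈ W, ContMDiffAt (𝓡 r) 𝓘(ℝ, ℝ) ∞ (fun z => form n (y z) l) z := fun z hz =>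
    contMDiffAt_form (h.contMDiffAt hz) contMDiffAt_const
  have hV0 : IsOpen V0 := ContinuousOn.isOpen_inter_preimage
    (fun z hz => (hκ z hz.1).continuousAt.continuousWithinAt)
    (h.isOpen.inter (triv r x).open_baseSet) isOpen_compl_singleton
  have hxV0 : x ∈ V0 := ⟨⟨hx, FiberBundle.mem_baseSet_trivializationAt' x⟩, hl⟩
  have hOL2 : ∀ z ∈ V0, form n (y z) (L2 z) = -1 := fun z hz => by
    have : form n (y z) l ≠ 0 := hz.2
    simp only [L2, map_smul, hyl z hz.1.1, smul_eq_mul]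
    field_simp
  have hOL : ∀ z ∈ V0, form n (y z) (L z) = -1 := fun z hz => by
    simp only [L, map_add, map_smul, hOL2 z hz, h.form_self hgen hz.1.1, smul_zero, add_zero]
  have hLL : ∀ z ∈ V0, form n (L z) (L z) = 0 := fun z hz => by
    simp only [L, map_add, map_smul, LinearMap.add_apply, LinearMap.smul_apply, hOL2 z hz,
      form_comm _ (y z), h.form_self hgen hz.1.1, smul_eq_mul]
    ring
  have hLP : ∀ z ∈ V0, ∀ v, form n (L z) (mvfderiv (𝓡 r) y z v) = 0 := fun z hz v => by
    simp only [L, L2, map_add, map_smul, LinearMap.add_apply, LinearMap.smul_apply,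
      hsp.form_perp hz.1.1, h.form_mvfderiv hgen hz.1.1, smul_zero, add_zero]
  have hLs : ∀ z ∈ V0, ContMDiffAt (𝓡 r) 𝓘(ℝ, Ambient n) ∞ L z := fun z hz => by
    have h2 : ContMDiffAt (𝓡 r) 𝓘(ℝ, Ambient n) ∞ L2 z :=
      (((hκ z hz.1.1).inv₀ hz.2).neg).smul (hsp.contMDiffAt_perp hz.1.1 l)
    exact h2.add ((contMDiffAt_const.mul (contMDiffAt_form h2 h2)).smul (h.contMDiffAt hz.1.1))
  let D : EuclideanSpace ℝ (Fin r) →ₗ[ℝ] Ambient n := (mvfderiv (𝓡 r) y x).toLinearMap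
  let Ψ : (ℝ × EuclideanSpace ℝ (Fin r)) × ℝ →ₗ[ℝ] Ambient n :=
    ((LinearMap.toSpanSingleton ℝ _ (y x)).coprod D).coprod
      (LinearMap.toSpanSingleton ℝ _ (L x))
  have hΨ : ∀ t v τ, Ψ ((t, v), τ) = t • y x + D v + τ • L x := fun _ _ _ => rfl
  -- At `x` there are `(n + 2) - (r + 2) = k` independent directions orthogonal to `y`, `dy` and
  -- `L`.
  have hfin : k ≤ finrank ℝ ((form n).orthogonal (LinearMap.range Ψ)) := by
    rw [LinearMap.BilinForm.finrank_orthogonal (form_nondegenerate n)]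
    have h1 := LinearMap.finrank_range_le Ψ
    simp only [finrank_prod, finrank_self, finrank_euclideanSpace, Fintype.card_fin] at h1
    have h2 : finrank ℝ (Ambient n) = n + 2 := by simp
    omega
  obtain ⟨w, hw⟩ := exists_linearIndependent_of_le_finrank hfin
  have hwΨ : ∀ α c, form n (Ψ c) (w α : Ambient n) = 0 := fun α c =>
    LinearMap.BilinForm.mem_orthogonal_iff.1 (w α).2 _ ⟨c, rfl⟩
  have hwy : ∀ α, form n (y x) (w α : Ambient n) = 0 := fun α => by
    have := hwΨ α ((1, 0), 0)
    rwa [hΨ, one_smul, zero_smul, map_zero, add_zero, add_zero] at this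
  have hwL : ∀ α, form n (L x) (w α : Ambient n) = 0 := fun α => by
    have := hwΨ α ((0, 0), 1)
    rwa [hΨ, one_smul, zero_smul, map_zero, add_zero, zero_add] at this
  have hwP : ∀ α v, form n (mvfderiv (𝓡 r) y x v) (w α : Ambient n) = 0 := fun α v => by
    have h1 := hwΨ α ((0, v), 0)
    have h2 := hΨ 0 v 0
    rw [zero_smul, zero_smul, add_zero, zero_add] at h2
    exact (congrArg (fun z => form n z (w α : Ambient n)) h2).symm.trans h1
  -- Projection of the fixed vectors `w α` to the orthogonal complement of `y`, `dy` and `L`; the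
  -- plus signs come from `(y, L) = -1`. At `x` it changes nothing.
  let B : Fin k → M → Ambient n := fun α z => perp r y z (w α) +
    (form n (w α) (L z) • y z + form n (w α) (y z) • L z)
  have hBO : ∀ z ∈ V0, ∀ α, form n (y z) (B α z) = 0 := fun z hz α => by
    simp only [B, map_add, map_smul, hyl z hz.1.1, h.form_self hgen hz.1.1, hOL z hz,
      form_comm _ (y z), smul_eq_mul]
    ring
  have hBL : ∀ z ∈ V0, ∀ α, form n (B α z) (L z) = 0 := fun z hz α => by
    have h1 : form n (perp r y z (w α)) (L z) = form n (w α) (L z) := by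
      rw [perp, map_sub, LinearMap.sub_apply, form_comm (mvfderiv (𝓡 r) y z _), hLP z hz, sub_zero]
    simp only [B, map_add, map_smul, LinearMap.add_apply, LinearMap.smul_apply, h1, hOL z hz,
      hLL z hz, smul_eq_mul]
    ring
  have hBP : ∀ z ∈ V0, ∀ α v, form n (B α z) (mvfderiv (𝓡 r) y z v) = 0 := fun z hz α v => by
    simp only [B, map_add, map_smul, LinearMap.add_apply, LinearMap.smul_apply,
      hsp.form_perp hz.1.1, h.form_mvfderiv hgen hz.1.1, hLP z hz, smul_zero, add_zero]
  have hBs : ∀ z ∈ V0, ∀ α, ContMDiffAt (𝓡 r) 𝓘(ℝ, Ambient n) ∞ (B α) z := fun z hz α =>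
    (hsp.contMDiffAt_perp hz.1.1 _).add
      (((contMDiffAt_form contMDiffAt_const (hLs z hz)).smul (h.contMDiffAt hz.1.1)).add
        ((contMDiffAt_form contMDiffAt_const (h.contMDiffAt hz.1.1)).smul (hLs z hz)))
  have hBx : ∀ α, B α x = w α := fun α => by
    simp only [B, perp]
    rw [hsp.tproj_eq_zero hx fun v => by rw [form_comm, hwP], form_comm _ (L x), form_comm _ (y x),
      hwL, hwy, map_zero, zero_smul, zero_smul, sub_zero, add_zero, add_zero]
  let G : M → Matrix (Fin k) (Fin k) ℝ := fun z => Matrix.of fun α β => form n (B α z) (B β z)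
  have hGx : (G x).det ≠ 0 := by
    have hpos : (G x).PosDef := gram_posDef (h.ne_zero hgen hx) (h.form_self hgen hx)
      (fun α => hBO x hxV0 α) fun c t hct => by
        simp only [hBx] at hct
        have ht : t = 0 := by
          have := congrArg (form n (L x)) hct
          simp only [map_sum, map_smul, hwL, mul_zero, Finset.sum_const_zero, form_comm _ (y x),
            hOL x hxV0, smul_eq_mul] at this
          linarith
        rw [ht, zero_smul] at hct
        have h0 : ∑ α, c α • w α = 0 := Subtype.ext (by simpa using hct)
        exact funext (Fintype.linearIndependent_iff.1 hw c h0)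
    exact hpos.det_pos.ne'
  have hGs : ∀ z ∈ V0, ContMDiffAt (𝓡 r) 𝓘(ℝ, ℝ) ∞ (fun z => (G z).det) z := fun z hz =>
    contMDiffAt_det fun α β => contMDiffAt_form (hBs z hz α) (hBs z hz β)
  let V : Set M := V0 ∩ (fun z => (G z).det) ⁻¹' {0}ᶜ
  have hV : IsOpen V := ContinuousOn.isOpen_inter_preimage
    (fun z hz => (hGs z hz).continuousAt.continuousWithinAt) hV0 isOpen_compl_singleton
  let a : FrameIndex r k → M → Ambient n :=
    Sum.elim (fun _ => y) (Sum.elim P (Sum.elim B fun _ => L))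
  have hPdet : ∀ z ∈ V0, (Matrix.of fun p q => form n (P p z) (P q z)).det ≠ 0 := fun z hz => by
    refine (gram_posDef (h.ne_zero hgen hz.1.1) (h.form_self hgen hz.1.1) (w := fun p => P p z)
      (fun p => h.form_mvfderiv hgen hz.1.1 _) fun c t hct => ?_).det_pos.ne'
    have h1 : mvfderiv (𝓡 r) y z ((triv r x).symmL ℝ z (WithLp.toLp 2 c)) = t • y z := by
      rw [← hct]
      have h2 := clm_eq_sum_smulRightL ((mvfderiv (𝓡 r) y z).comp ((triv r x).symmL ℝ z))
      have h3 := congrArg (fun K : EuclideanSpace ℝ (Fin r) →L[ℝ] Ambient n =>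
        K (WithLp.toLp 2 c)) h2
      refine h3.trans ?_
      simp only [_root_.sum_apply, ContinuousLinearMap.smulRightL_apply_apply]
      rfl
    have h2 := h.eq_zero_of_mvfderiv_eq_smul hgen hrank hz.1.1 h1
    have h3 := (triv r x).continuousLinearMapAt_symmL (R := ℝ) hz.1.2 (WithLp.toLp 2 c)
    have h4 : WithLp.toLp 2 c = (0 : EuclideanSpace ℝ (Fin r)) :=
      h3.symm.trans ((congrArg ((triv r x).continuousLinearMapAt ℝ z) h2).trans (map_zero _))
    exact congrArg (WithLp.ofLp) h4
  obtain ⟨A, hA, hAa⟩ := exists_adaptedFrame_of_tuples (f := f) (gen := gen) (W := V) hn (a := a)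
    (h.mono hV fun z hz => hz.1.1.1)
    (fun ξ z hz => by
      rcases ξ with _ | p | α | _
      · exact (h.contMDiffAt hz.1.1.1).contMDiffWithinAt
      · exact (contMDiffAt_localFrame_apply hz.1.1.2 (h.contMDiffAt hz.1.1.1) _).contMDiffWithinAt
      · exact (hBs z hz.1 α).contMDiffWithinAt
      · exact (hLs z hz.1).contMDiffWithinAt)
    (fun z hz =>
      { O_O := h.form_self hgen hz.1.1.1
        O_P := fun p => h.form_mvfderiv hgen hz.1.1.1 _
        O_A := hBO z hz.1
        O_L := hOL z hz.1
        P_A := fun p α => (form_comm _ _).trans (hBP z hz.1 α _)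
        P_L := fun p => (form_comm _ _).trans (hLP z hz.1 _)
        A_L := hBL z hz.1
        L_L := hLL z hz.1
        det_P := hPdet z hz.1
        det_A := hz.2 })
    (fun z hz α v => hBP z hz.1 α v)
  refine ⟨V, A, ⟨hxV0, hGx⟩, fun z hz => hz.1.1.1, hA, fun z hz => ⟨hAa z hz _, fun p => ?_⟩⟩
  rw [hAa z hz]
  exact ⟨_, rfl⟩

end Completion
end DeSitter

end

noncomputable section
namespace DeSitter

/-! ### The normalized lift of the points of tangency -/

section Normalization
open Set Topology Module Matrix
variable {n r k : ℕ}
  {U : Type*} [TopologicalSpace U] [ChartedSpace (EuclideanSpace ℝ (Fin n)) U]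
  {M : Type*} [TopologicalSpace M] [ChartedSpace (EuclideanSpace ℝ (Fin r)) M]
  {f : U → ℙ ℝ (Ambient n)} {gen : U → M} {W : Set M}

theorem mvfderiv_real_comp {g : ℝ → ℝ} {g' : ℝ} {a : M → ℝ} {x : M}
    (hg : HasDerivAt g g' (a x)) (ha : MDifferentiableAt (𝓡 r) 𝓘(ℝ, ℝ) a x)
    (v : TangentSpace (𝓡 r) x) :
    mvfderiv (𝓡 r) (fun z => g (a z)) x v = g' * mvfderiv (𝓡 r) a x v := by
  have h : MDifferentiableAt (𝓡 r) 𝓘(ℝ, ℝ) (fun z => g (a z)) x :=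
    hg.differentiableAt.comp_mdifferentiableAt ha
  refine (mvfderiv_eq_fderiv h v).trans ?_
  refine Eq.trans ?_ (congrArg (g' * ·) (mvfderiv_eq_fderiv ha v).symm)
  have h1 : a x = (a ∘ (extChartAt (𝓡 r) x).symm) (extChartAt (𝓡 r) x x) := by simp
  rw [h1] at hg
  have h2 := hg.comp_hasFDerivAt _ (differentiableAt_chart ha).hasFDerivAt
  exact congrArg (fun K : EuclideanSpace ℝ (Fin r) →L[ℝ] ℝ => K v) h2.fderiv

/-- The factor `c` such that `c A_0` is independent of the adapted frame. -/
def normFactor (A : FrameField n r k M) (ρ : ℕ) (x : M) : ℝ :=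
  aInvariant A ρ x ^ (1 / (2 * ρ : ℝ)) * (SignType.sign (A x ixO 0) : ℝ)

namespace IsAdaptedFrame

variable {A : FrameField n r k M} {x : M} {ρ : ℕ}
variable (hgen : IsGeneratorFibration (r := r) f gen) (hrank : HasRank f r)
include hgen

theorem aInvariant_pos_of_rank (hA : HasTensorRank (r := r) k f gen ρ)
    (h : IsAdaptedFrame f gen W A) (hx : x ∈ W) : 0 < aInvariant A ρ x := by
  rw [← hA W A h x hx]; exact h.aInvariant_pos hgen hx

theorem normFactor_ne_zero (hA : HasTensorRank (r := r) k f gen ρ)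
    (h : IsAdaptedFrame f gen W A) (hx : x ∈ W) : normFactor A ρ x ≠ 0 := by
  refine mul_ne_zero (Real.rpow_pos_of_pos (h.aInvariant_pos_of_rank hgen hA hx) _).ne' ?_
  have h0 := time_ne_zero ((A x).ne_zero ixO) (h.form_O_O hgen hx)
  rcases h0.lt_or_gt with h1 | h1
  · rw [sign_neg h1]; simp
  · rw [sign_pos h1]; simp

/-- The time coordinate of `A_0` does not vanish, so its sign is locally constant and only the power
of `a` is differentiated. -/
theorem eventually_normFactor (h : IsAdaptedFrame f gen W A) (hx : x ∈ W) :
    normFactor A ρ =ᶠ[𝓝 x] fun z =>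
      aInvariant A ρ z ^ (1 / (2 * ρ : ℝ)) * (SignType.sign (A x ixO 0) : ℝ) := by
  have h0 := time_ne_zero ((A x).ne_zero ixO) (h.form_O_O hgen hx)
  have hc : ContinuousAt (fun z => A z ixO 0) x :=
    (continuous_apply (0 : Fin (n + 2))).continuousAt.comp (h.contMDiffAt hx ixO).continuousAt
  rcases h0.lt_or_gt with h1 | h1
  · filter_upwards [hc.eventually_lt_const h1] with z hz
    rw [normFactor, sign_neg h1, sign_neg hz]
  · filter_upwards [hc.eventually_const_lt h1] with z hz
    rw [normFactor, sign_pos h1, sign_pos hz]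

include hrank
variable [IsManifold (𝓡 r) ∞ M]

theorem contMDiffAt_normFactor (hA : HasTensorRank (r := r) k f gen ρ)
    (h : IsAdaptedFrame f gen W A) (hx : x ∈ W) :
    ContMDiffAt (𝓡 r) 𝓘(ℝ, ℝ) ∞ (normFactor A ρ) x := by
  refine ContMDiffAt.congr_of_eventuallyEq ?_ (h.eventually_normFactor hgen hx)
  refine ContMDiffAt.mul ?_ contMDiffAt_const
  exact ContDiffAt.comp_contMDiffAt (g := fun t : ℝ => t ^ (1 / (2 * ρ : ℝ)))
    (Real.contDiffAt_rpow_const_of_ne (h.aInvariant_pos_of_rank hgen hA hx).ne')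
    (h.contMDiffAt_aInvariant hgen hrank hx ρ)

theorem mvfderiv_normFactor (hA : HasTensorRank (r := r) k f gen ρ)
    (h : IsAdaptedFrame f gen W A) (hx : x ∈ W) (v : TangentSpace (𝓡 r) x) :
    mvfderiv (𝓡 r) (normFactor A ρ) x v = normFactor A ρ x *
      (mvfderiv (𝓡 r) (aInvariant A ρ) x v / (2 * ρ * aInvariant A ρ x)) := by
  have hpos := h.aInvariant_pos_of_rank hgen hA hx
  rw [mvfderiv_congr (h.eventually_normFactor hgen hx)]
  have h1 := (Real.hasDerivAt_rpow_const (p := 1 / (2 * ρ : ℝ)) (Or.inl hpos.ne')).mul_const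
    (SignType.sign (A x ixO 0) : ℝ)
  refine (mvfderiv_real_comp h1
    ((h.contMDiffAt_aInvariant hgen hrank hx ρ).mdifferentiableAt (by simp)) v).trans ?_
  rw [normFactor, Real.rpow_sub_one hpos.ne']
  field_simp

omit [IsManifold (𝓡 r) ∞ M] in
-- The power `1 / (2ρ)` turns `σ^(-2ρ)` into `|σ|⁻¹`, and the sign factor supplies the missing sign
-- of `σ`.
theorem normFactor_smul_eq (hf : IsLightlikeHypersurface f) (hρ : ρ ≠ 0)
    (hA : HasTensorRank (r := r) k f gen ρ) {A' : FrameField n r k M} {W' : Set M}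
    (h : IsAdaptedFrame f gen W A) (h' : IsAdaptedFrame f gen W' A') (hx : x ∈ W) (hx' : x ∈ W') :
    normFactor A' ρ x • A' x ixO = normFactor A ρ x • A x ixO := by
  obtain ⟨σ, h0, hO, ha⟩ := aInvariant_change hgen hf hrank h h' hx hx' ρ
  have hpos := h.aInvariant_pos_of_rank hgen hA hx
  have h1 : (((σ⁻¹) ^ 2) ^ ρ) ^ (1 / (2 * ρ : ℝ)) = |σ|⁻¹ := by
    have hρ' : (ρ : ℝ) ≠ 0 := Nat.cast_ne_zero.2 hρ
    rw [← sq_abs, ← pow_mul, abs_inv, ← Real.rpow_natCast, ← Real.rpow_mul (by positivity),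
      Nat.cast_mul, Nat.cast_ofNat, mul_one_div_cancel (by positivity), Real.rpow_one]
  have h2 : (SignType.sign σ : ℝ) * σ = |σ| := sign_mul_self σ
  have h3 : |σ| ≠ 0 := abs_ne_zero.2 h0
  rw [normFactor, normFactor, ha, Real.mul_rpow (by positivity) hpos.le, h1, hO, smul_smul]
  congr 1
  rw [Pi.smul_apply, smul_eq_mul, sign_mul, SignType.coe_mul]
  calc _ = |σ|⁻¹ * ((SignType.sign σ : ℝ) * σ) * (aInvariant A ρ x ^ (1 / (2 * ρ : ℝ)) *
        (SignType.sign (A x ixO 0) : ℝ)) := by ring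
    _ = _ := by rw [h2, inv_mul_cancel₀ h3, one_mul]

end IsAdaptedFrame

/-- `Y` is the global choice of homogeneous coordinates of the points of tangency for which the
relative invariant is constant. -/
structure IsNormalizedLift (r k : ℕ) {M : Type*} [TopologicalSpace M]
    [ChartedSpace (EuclideanSpace ℝ (Fin r)) M] (f : U → ℙ ℝ (Ambient n)) (gen : U → M) (ρ : ℕ)
    (Y : M → Ambient n) : Prop where
  lift : IsTangencyLift r f gen univ Y
  eq_smul : ∀ (W : Set M) (A : FrameField n r k M), IsAdaptedFrame f gen W A → ∀ x ∈ W,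
    Y x = normFactor A ρ x • A x ixO

theorem exists_isNormalizedLift [IsManifold (𝓡 n) ∞ U] [IsManifold (𝓡 r) ∞ M] (hn : n = r + k)
    (hf : IsLightlikeHypersurface f) (hgen : IsGeneratorFibration (r := r) f gen)
    (hrank : HasRank f r) {ρ : ℕ} (hρ : ρ ≠ 0) (hA : HasTensorRank (r := r) k f gen ρ) :
    ∃ Y : M → Ambient n, IsNormalizedLift r k f gen ρ Y := by
  have hex : ∀ x : M, ∃ (W : Set M) (A : FrameField n r k M), x ∈ W ∧ IsAdaptedFrame f gen W A := by
    intro x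
    obtain ⟨W, y, hx, hy⟩ := exists_isTangencyLift hf hgen x
    obtain ⟨W', A, hx', -, hA, -⟩ := hy.exists_adaptedFrame hgen hrank hn hx
    exact ⟨W', A, hx', hA⟩
  choose W₀ A₀ hx₀ hA₀ using hex
  let Y : M → Ambient n := fun x => normFactor (A₀ x) ρ x • A₀ x x ixO
  have hY : ∀ (W : Set M) (A : FrameField n r k M), IsAdaptedFrame f gen W A → ∀ x ∈ W,
      Y x = normFactor A ρ x • A x ixO := fun W A h x hx =>
    IsAdaptedFrame.normFactor_smul_eq hgen hrank hf hρ hA h (hA₀ x) hx (hx₀ x)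
  -- The frames were chosen point by point, but near `x` the map agrees with the one computed from
  -- the single frame chosen at `x`.
  refine ⟨Y, ⟨isOpen_univ, fun x _ => ContMDiffAt.contMDiffWithinAt ?_, fun u _ => ?_⟩, hY⟩
  · refine ContMDiffAt.congr_of_eventuallyEq
      (((hA₀ x).contMDiffAt_normFactor hgen hrank hA (hx₀ x)).smul
        ((hA₀ x).contMDiffAt (hx₀ x) ixO)) ?_
    exact Filter.eventually_of_mem ((hA₀ x).isOpen.mem_nhds (hx₀ x)) fun z hz => hY _ _ (hA₀ x) z hz
  · exact ((hA₀ _).tangency u (hx₀ _)).smul ((hA₀ _).normFactor_ne_zero hgen hA (hx₀ _))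

namespace IsNormalizedLift

variable {Y : M → Ambient n} {A : FrameField n r k M} {x : M} {ρ : ℕ} [IsManifold (𝓡 r) ∞ M]
  (hgen : IsGeneratorFibration (r := r) f gen) (hrank : HasRank f r)
  (hA : HasTensorRank (r := r) k f gen ρ)
include hgen hrank hA

theorem mvfderiv_apply (hY : IsNormalizedLift r k f gen ρ Y) (h : IsAdaptedFrame f gen W A)
    (hx : x ∈ W) (v : TangentSpace (𝓡 r) x) :
    mvfderiv (𝓡 r) Y x v = mvfderiv (𝓡 r) (normFactor A ρ) x v • A x ixO +
      normFactor A ρ x • dvert A ixO x v := by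
  have h1 : Y =ᶠ[𝓝 x] fun z => normFactor A ρ z • A z ixO :=
    Filter.eventually_of_mem (h.isOpen.mem_nhds hx) fun z hz => hY.eq_smul W A h z hz
  rw [mvfderiv_congr h1]
  have := mvfderiv_smul ((h.contMDiffAt_normFactor hgen hrank hA hx).mdifferentiableAt (by simp))
    (h.mdifferentiableAt hx ixO)
  refine (congrArg (fun K : EuclideanSpace ℝ (Fin r) →L[ℝ] Ambient n => K v) this).trans ?_
  exact add_comm _ _

/-- The logarithmic derivative of the factor is `da / (2ρa)`; adding the component `ω_0^0` of `dA_0`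
gives exactly `μ_p`. -/
theorem mvfderiv_dualFrame (hY : IsNormalizedLift r k f gen ρ Y) (h : IsAdaptedFrame f gen W A)
    (hx : x ∈ W) (p : Fin r) :
    mvfderiv (𝓡 r) Y x (dualFrame A p x) = normFactor A ρ x • pointC A ρ x p := by
  rw [hY.mvfderiv_apply hgen hrank hA h hx, h.mvfderiv_normFactor hgen hrank hA hx,
    h.dvert_O_dualFrame hgen hrank hx, pointC, mu]
  module

theorem range_mvfderiv (hY : IsNormalizedLift r k f gen ρ Y) (h : IsAdaptedFrame f gen W A)
    (hx : x ∈ W) : LinearMap.range (mvfderiv (𝓡 r) Y x).toLinearMap =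
      Submodule.span ℝ (range (pointC A ρ x)) := by
  have hc := h.normFactor_ne_zero hgen hA hx
  refine le_antisymm ?_ (Submodule.span_le.2 ?_)
  · rintro _ ⟨v, rfl⟩
    have := h.clm_apply_eq_sum hgen hrank hx (mvfderiv (𝓡 r) Y x) v
    refine (congrArg (· ∈ Submodule.span ℝ (range (pointC A ρ x))) this).mpr
      (Submodule.sum_mem _ fun p _ => Submodule.smul_mem _ _ ?_)
    rw [hY.mvfderiv_dualFrame hgen hrank hA h hx]
    exact Submodule.smul_mem _ _ (Submodule.subset_span ⟨p, rfl⟩)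
  · rintro _ ⟨p, rfl⟩
    refine ⟨(normFactor A ρ x)⁻¹ • dualFrame A p x, ?_⟩
    refine ((mvfderiv (𝓡 r) Y x).map_smul _ _).trans ?_
    rw [hY.mvfderiv_dualFrame hgen hrank hA h hx, smul_smul, inv_mul_cancel₀ hc, one_smul]

end IsNormalizedLift

end Normalization
end DeSitter

end

noncomputable section
namespace DeSitter

/-! ### The invariant screen and reduced frames -/

section Screen
open Set Topology Module Matrix
variable {n r k : ℕ}
  {U : Type*} [TopologicalSpace U] [ChartedSpace (EuclideanSpace ℝ (Fin n)) U]
  {M : Type*} [TopologicalSpace M] [ChartedSpace (EuclideanSpace ℝ (Fin r)) M]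
  {f : U → ℙ ℝ (Ambient n)} {gen : U → M} {W : Set M}

/-- The point `x` of the hypersurface and `dx` are orthogonal to `y`. Differentiating `(x, y ∘ gen)
= 0` leaves `(x, dy ∘ dgen) = 0`, and `dgen` is surjective because of the local section. -/
theorem IsTangencyLift.form_fiber {y : M → Ambient n} (hf : IsLightlikeHypersurface f)
    (hgen : IsGeneratorFibration (r := r) f gen) (h : IsTangencyLift r f gen W y) {u : U}
    (hu : gen u ∈ W) {w : Ambient n} (hw : w ∈ (f u).submodule) (v : TangentSpace (𝓡 r) (gen u)) :
    form n w (mvfderiv (𝓡 r) y (gen u) v) = 0 := by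
  obtain ⟨V, s, hV, huV, hs, hsu, hgs⟩ := exists_local_section hgen.submersion u
  have hgd := mdifferentiableAt_gen hgen u
  obtain ⟨ξ, rfl⟩ := mfderiv_surjective_of_section hgd (hV.mem_nhds huV)
    ((hs.contMDiffAt (hV.mem_nhds huV)).mdifferentiableAt (by simp)) hsu hgs v
  obtain ⟨W', x, hx, hu'⟩ := hf.exists_lift u
  obtain ⟨h0, hxu⟩ := hx.lift u hu'
  rw [← hxu, Projectivization.submodule_mk] at hw
  obtain ⟨c, rfl⟩ := Submodule.mem_span_singleton.1 hw
  have hxd : MDifferentiableAt (𝓡 n) 𝓘(ℝ, Ambient n) x u :=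
    (hx.smooth.contMDiffAt (hx.isOpen.mem_nhds hu')).mdifferentiableAt (by simp)
  have hyd : MDifferentiableAt (𝓡 n) 𝓘(ℝ, Ambient n) (fun p => y (gen p)) u :=
    (h.mdifferentiableAt hu).comp u hgd
  have h1 := mvfderiv_form hxd hyd ξ
  have h2 : (fun p => form n (x p) (y (gen p))) =ᶠ[𝓝 u] fun _ => 0 := by
    filter_upwards [hx.isOpen.mem_nhds hu',
      (h.isOpen.preimage hgen.submersion.contMDiff.continuous).mem_nhds hu] with p hp hpW
    obtain ⟨hp0, hxp⟩ := hx.lift p hp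
    rw [form_comm]
    refine h.form_lift hpW ?_ hf
    rw [← hxp, Projectivization.submodule_mk]
    exact Submodule.mem_span_singleton_self _
  have h3 : form n (mvfderiv (𝓡 n) x u ξ) (y (gen u)) = 0 := by
    have : mvfderiv (𝓡 n) x u ξ ∈ tangentSpan x u := Submodule.mem_sup_right ⟨ξ, rfl⟩
    rw [(h.tangency u hu).2.2 W' x hx hu', mem_orthogonal_span] at this
    rw [form_comm, this]
  rw [mvfderiv_congr h2, mvfderiv_const, h3, zero_add,
    mvfderiv_comp_source (h.mdifferentiableAt hu) hgd] at h1
  have h4 : (0 : ℝ) = form n (x u) (mvfderiv (𝓡 r) y (gen u) (mfderiv (𝓡 n) (𝓡 r) gen u ξ)) := h1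
  rw [map_smul, LinearMap.smul_apply, ← h4, smul_zero]

/-- The planes spanned by the points of the hypersurface and the image of `dY`. -/
def screen (r : ℕ) {M : Type*} [TopologicalSpace M] [ChartedSpace (EuclideanSpace ℝ (Fin r)) M]
    (f : U → ℙ ℝ (Ambient n)) (gen : U → M) (Y : M → Ambient n) (u : U) :
    Submodule ℝ (Ambient n) :=
  (f u).submodule ⊔ LinearMap.range (mvfderiv (𝓡 r) Y (gen u)).toLinearMap

namespace IsNormalizedLift

variable {Y : M → Ambient n} {A : FrameField n r k M} {x : M} {ρ : ℕ} [IsManifold (𝓡 r) ∞ M]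
  (hgen : IsGeneratorFibration (r := r) f gen) (hrank : HasRank f r)
  (hA : HasTensorRank (r := r) k f gen ρ)
include hgen hrank hA

theorem isInvariantScreen (hY : IsNormalizedLift r k f gen ρ Y) :
    IsInvariantScreen (r := r) k f gen ρ (screen r f gen Y) := fun W A h u hu => by
  rw [screen, hY.range_mvfderiv hgen hrank hA h hu]

/-- Decompose `A_p` into a multiple `w` of the point of `U` and a vector of the image of `dY`. As
`w` is orthogonal to `A_p` and to this image, `(w, w) = 0`, and the de Sitter condition gives `w =
0`. Thus `A_p` is a combination of the `C_q`, and comparing coordinates gives `A_p = C_p`. -/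
theorem mu_eq_zero (hf : IsLightlikeHypersurface f) (hY : IsNormalizedLift r k f gen ρ Y)
    (h : IsAdaptedFrame f gen W A) (hS : IsScreenAdapted gen (screen r f gen Y) W A) (hx : x ∈ W)
    (p : Fin r) : mu A ρ x p = 0 := by
  obtain ⟨u, rfl⟩ := hgen.surjective x
  obtain ⟨w, hw, z, ⟨v, rfl⟩, hz⟩ := Submodule.mem_sup.1 (hS u hx p)
  replace hz : w + mvfderiv (𝓡 r) Y (gen u) v = A (gen u) (ixP p) := hz
  have hc := h.normFactor_ne_zero hgen hA hx
  have hwY := hY.lift.form_fiber hf hgen (mem_univ (gen u)) hw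
  have h1 : form n w (A (gen u) (ixP p)) = 0 := by
    have h2 := hwY (dualFrame A p (gen u))
    rw [hY.mvfderiv_dualFrame hgen hrank hA h hx, pointC, map_smul, map_add, map_smul,
      form_comm w (A (gen u) ixO), h.isTangencyLift.form_lift hx hw hf, smul_zero, add_zero] at h2
    exact (mul_eq_zero.1 h2).resolve_left hc
  have hw0 : w = 0 := by
    by_contra hne
    have h2 := hf.mem_deSitter u w hw hne
    rw [← hz, map_add, hwY, add_zero] at h1
    exact h2.ne' h1
  rw [hw0, zero_add, h.clm_apply_eq_sum hgen hrank hx (mvfderiv (𝓡 r) Y (gen u)) v] at hz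
  simp only [hY.mvfderiv_dualFrame hgen hrank hA h hx, pointC] at hz
  have hP : ∀ q, omega A ixO (ixP q) (gen u) v * normFactor A ρ (gen u) =
      if p = q then 1 else 0 := fun q => by
    have := congrArg ((A (gen u)).coord (ixP q)) hz
    simpa [Finsupp.single_apply] using this
  have hO := congrArg ((A (gen u)).coord ixO) hz
  simp only [map_sum, map_smul, map_add, Basis.coord_apply, Basis.repr_self, smul_eq_mul,
    Finsupp.single_apply, reduceCtorEq, if_true, if_false, zero_add, mul_one, ← mul_assoc, hP] at hO
  simpa using hO

theorem mvfderiv_dualFrame_of_screen (hf : IsLightlikeHypersurface f)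
    (hY : IsNormalizedLift r k f gen ρ Y)
    (h : IsAdaptedFrame f gen W A) (hS : IsScreenAdapted gen (screen r f gen Y) W A) (hx : x ∈ W)
    (p : Fin r) :
    mvfderiv (𝓡 r) Y x (dualFrame A p x) = normFactor A ρ x • A x (ixP p) := by
  rw [hY.mvfderiv_dualFrame hgen hrank hA h hx, pointC,
    hY.mu_eq_zero hgen hrank hA hf h hS hx, zero_smul, add_zero]

/-- This is `μ_p = 0` read as a differential equation for the factor: `dc = -c ω_0^0`. -/
theorem mvfderiv_normFactor_of_screen (hf : IsLightlikeHypersurface f)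
    (hY : IsNormalizedLift r k f gen ρ Y)
    (h : IsAdaptedFrame f gen W A) (hS : IsScreenAdapted gen (screen r f gen Y) W A) (hx : x ∈ W)
    (v : TangentSpace (𝓡 r) x) :
    mvfderiv (𝓡 r) (normFactor A ρ) x v = - (normFactor A ρ x * omega A ixO ixO x v) := by
  have h1 : ∀ p, mvfderiv (𝓡 r) (normFactor A ρ) x (dualFrame A p x) =
      - (normFactor A ρ x * omega A ixO ixO x (dualFrame A p x)) := fun p => by
    have := hY.mu_eq_zero hgen hrank hA hf h hS hx p
    rw [mu] at this
    rw [h.mvfderiv_normFactor hgen hrank hA hx, eq_neg_of_add_eq_zero_left this, mul_neg]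
  rw [h.clm_apply_eq_sum hgen hrank hx (mvfderiv (𝓡 r) (normFactor A ρ) x) v,
    h.clm_apply_eq_sum hgen hrank hx (omega A ixO ixO x) v, Finset.mul_sum,
    ← Finset.sum_neg_distrib]
  refine Finset.sum_congr rfl fun p _ => ?_
  rw [h1, smul_eq_mul, smul_eq_mul]
  ring

end IsNormalizedLift

variable (hgen : IsGeneratorFibration (r := r) f gen) (hrank : HasRank f r)
include hgen hrank

/-- The points `A_α` can be moved along the lines `A_0 A_α` to the harmonic polar of `A_0`. -/
theorem IsAdaptedFrame.exists_polar [IsManifold (𝓡 r) ∞ M] (hn : n = r + k)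
    {A : FrameField n r k M} (h : IsAdaptedFrame f gen W A) :
    ∃ A' : FrameField n r k M, IsAdaptedFrame f gen W A' ∧
      (∀ x ∈ W, A' x ixO = A x ixO ∧ ∀ p, A' x (ixP p) = A x (ixP p)) ∧
      ∀ x ∈ W, ∀ α, lamMean A' x α = 0 := by
  -- Moving `A_α` by `s_α = g_{αβ} λ^β` times `A_0` removes the trace; the changes of `A_{n+1}`
  -- below restore its products with the `A_α` and with itself.
  let s : Fin k → M → ℝ := fun α z => ∑ β, gA A z α β * lamMean A z β
  let a : FrameIndex r k → M → Ambient n :=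
    Sum.elim (fun _ z => A z ixO) (Sum.elim (fun p z => A z (ixP p))
      (Sum.elim (fun α z => A z (ixA α) + s α z • A z ixO)
        fun _ z => A z ixL + ((∑ α, lamMean A z α • A z (ixA α)) +
          (1 / 2 * ∑ α, lamMean A z α * s α z) • A z ixO)))
  have hss : ∀ z ∈ W, ∀ α, ContMDiffAt (𝓡 r) 𝓘(ℝ, ℝ) ∞ (s α) z := fun z hz α =>
    contMDiffAt_finsetSum fun β _ => (h.contMDiffAt_form hz (ixA α) (ixA β)).mul
      (h.contMDiffAt_lamMean hgen hrank hz β)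
  have hOO := fun z (hz : z ∈ W) => h.form_O_O hgen hz
  have hAA : ∀ z ∈ W, ∀ α β, form n (a (ixA α) z) (a (ixA β) z) = gA A z α β := fun z hz α β => by
    simp only [a, Sum.elim_inl, Sum.elim_inr, map_add, map_smul, LinearMap.add_apply,
      LinearMap.smul_apply, form_comm _ (A z ixO), h.form_O_A z hz, hOO z hz, smul_zero, add_zero]
    rfl
  have hgAl : ∀ z α, form n (A z (ixA α)) (∑ β, lamMean A z β • A z (ixA β)) = s α z := fun z α => by
    simp only [map_sum, map_smul, smul_eq_mul, s]
    exact Finset.sum_congr rfl fun β _ => mul_comm _ _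
  obtain ⟨A', hA', ha⟩ := exists_adaptedFrame_of_tuples (f := f) (gen := gen) (W := W) hn (a := a)
    h.isTangencyLift
    (fun ξ z hz => by
      rcases ξ with _ | p | α | _
      · exact (h.contMDiffAt hz ixO).contMDiffWithinAt
      · exact (h.contMDiffAt hz (ixP p)).contMDiffWithinAt
      · exact ((h.contMDiffAt hz (ixA α)).add
          ((hss z hz α).smul (h.contMDiffAt hz ixO))).contMDiffWithinAt
      · exact ((h.contMDiffAt hz ixL).add ((contMDiffAt_finsetSum fun α _ =>
          (h.contMDiffAt_lamMean hgen hrank hz α).smul (h.contMDiffAt hz (ixA α))).add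
            ((contMDiffAt_const.mul (contMDiffAt_finsetSum fun α _ =>
              (h.contMDiffAt_lamMean hgen hrank hz α).mul (hss z hz α))).smul
                (h.contMDiffAt hz ixO)))).contMDiffWithinAt)
    (fun z hz =>
      { O_O := hOO z hz
        O_P := h.form_O_P z hz
        O_A := fun α => by
          simp [a, h.form_O_A z hz, hOO z hz]
        O_L := by
          simp [a, h.form_O_L z hz, h.form_O_A z hz, hOO z hz]
        P_A := fun p α => by
          simp [a, h.form_P_A z hz, form_comm _ (A z ixO), h.form_O_P z hz]
        P_L := fun p => by
          simp [a, h.form_P_A z hz, form_comm _ (A z ixO), h.form_O_P z hz, h.form_P_L z hz]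
        A_L := fun α => by
          have h3 : form n (A z ixO) (∑ β, lamMean A z β • A z (ixA β)) = 0 := by
            simp [h.form_O_A z hz]
          simp only [a, Sum.elim_inl, Sum.elim_inr, map_add, map_smul, LinearMap.add_apply,
            LinearMap.smul_apply, hgAl, h3, form_comm _ (A z ixO), h.form_O_A z hz, hOO z hz,
            h.form_A_L z hz, h.form_O_L z hz, smul_eq_mul]
          ring
        L_L := by
          have h1 : form n (∑ β, lamMean A z β • A z (ixA β)) (∑ β, lamMean A z β • A z (ixA β)) =
              ∑ β, lamMean A z β * s β z := by
            rw [map_sum]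
            exact Finset.sum_congr rfl fun β _ => by
              rw [map_smul, form_comm, hgAl, smul_eq_mul]
          have h2 : form n (A z ixL) (∑ β, lamMean A z β • A z (ixA β)) = 0 := by
            simp [form_comm (A z ixL), h.form_A_L z hz]
          have h3 : form n (A z ixO) (∑ β, lamMean A z β • A z (ixA β)) = 0 := by
            simp [h.form_O_A z hz]
          have h2' := (form_comm _ _).trans h2
          have h3' := (form_comm _ _).trans h3
          have h4 := (form_comm _ _).trans (h.form_O_L z hz)
          simp only [a, Sum.elim_inr, map_add, map_smul, LinearMap.add_apply,
            LinearMap.smul_apply, h1, h2, h3, h2', h3', h4,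
            hOO z hz, h.form_O_L z hz, h.form_L_L z hz, smul_eq_mul]
          ring
        det_P := (h.gP_posDef hgen hz).det_pos.ne'
        det_A := by
          simp only [hAA z hz]
          exact (h.gA_posDef hgen hz).det_pos.ne' })
    (fun z hz α v => by
      have h1 : form n (A z (ixA α)) (dvert A ixO z v) = 0 := by
        rw [h.dvert_O hgen hz]
        simp [form_comm (A z (ixA α)), h.form_O_A z hz, h.form_P_A z hz]
      have h2 := h.isTangencyLift.form_mvfderiv hgen hz v
      simp only [a, Sum.elim_inl, Sum.elim_inr, map_add, map_smul, LinearMap.add_apply,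
        LinearMap.smul_apply]
      rw [h1, h2, smul_zero, add_zero])
  refine ⟨A', hA', fun x hx => ⟨ha x hx _, fun p => ha x hx _⟩, fun x hx => ?_⟩
  have hdv : ∀ ξ, (∀ z ∈ W, A' z ξ = A z ξ) → dvert A' ξ x = dvert A ξ x := fun ξ hξ =>
    mvfderiv_congr (Filter.eventually_of_mem (h.isOpen.mem_nhds hx) hξ)
  have hO : (fun z => A' z ixO) =ᶠ[𝓝 x] fun z => A z ixO :=
    Filter.eventually_of_mem (h.isOpen.mem_nhds hx) fun z hz => ha z hz _
  have hP : ∀ p, A' x (ixP p) = A x (ixP p) := fun p => ha x hx _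
  have he : ∀ q, dualFrame A' q x = dualFrame A q x := fun q => by
    rw [hA'.dualFrame_eq_tproj hgen hrank hx, h.dualFrame_eq_tproj hgen hrank hx, hP, tproj, tproj,
      mvfderiv_congr hO]
  have hgP : gP A' x = gP A x := by ext p q; simp only [gP, of_apply, hP]
  have hgA : gA A' x = gA A x := by
    ext p q; simp only [gA, of_apply, ha x hx]; exact hAA x hx p q
  -- The shift along `A_0` enters through `(A_0, dA_p(e_q)) = -g_{pq}`.
  have hII : ∀ α, secondForm A' x α = secondForm A x α - s α x • gP A x := fun α => by
    ext p q
    have h1 : form n (A x ixO) (dvert A (ixP p) x (dualFrame A q x)) = - gP A x p q := by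
      rw [← neg_eq_iff_eq_neg, ← h.omega_L hgen hx, h.omega_P_L hgen hx]
      simp [h.omega_dualFrame hgen hrank hx]
    have h2 : A' x (ixA α) = A x (ixA α) + s α x • A x ixO := ha x hx _
    simp only [secondForm, of_apply, he, hdv (ixP p) fun z hz => ha z hz _, h2, map_add, map_smul,
      LinearMap.add_apply, LinearMap.smul_apply, h1, Matrix.sub_apply, Matrix.smul_apply, smul_eq_mul]
    ring
  have hmean : ∀ {B : FrameField n r k M}, IsAdaptedFrame f gen W B → ∀ α,
      ∑ β, gA B x α β * lamMean B x β =
        (1 / (r : ℝ)) * ((gP B x)⁻¹ * (secondForm B x α)ᵀ).trace := fun {B} hB α => by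
    rw [hB.secondForm_eq hx, transpose_sum, Matrix.mul_sum, trace_sum, Finset.mul_sum]
    refine Finset.sum_congr rfl fun β _ => ?_
    rw [transpose_smul, Matrix.mul_smul, trace_smul, smul_eq_mul]
    simp only [lamMean, trace, diag_apply, mul_apply, transpose_apply, of_apply]
    ring
  have hdet : IsUnit (gP A x).det := (h.gP_posDef hgen hx).det_pos.ne'.isUnit
  have hzero : (gA A' x).mulVec (lamMean A' x) = 0 := by
    ext α
    have h1 : s α x = (1 / (r : ℝ)) * ((gP A x)⁻¹ * (secondForm A x α)ᵀ).trace := hmean h α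
    refine (hmean hA' α).trans ?_
    rw [hgP, hII, transpose_sub, transpose_smul, Matrix.mul_sub, Matrix.mul_smul, gP_transpose,
      nonsing_inv_mul _ hdet, trace_sub, trace_smul, trace_one, mul_sub, ← h1, Fintype.card_fin,
      smul_eq_mul, Pi.zero_apply]
    -- For `r = 0` the factor `1 / r` is `0`, so the mean vanishes anyway.
    rcases eq_or_ne r 0 with h0 | h0
    · have : (r : ℝ) = 0 := by exact_mod_cast h0
      simp [h1, this]
    · have : (r : ℝ) ≠ 0 := Nat.cast_ne_zero.2 h0
      field_simp
      ring
  exact congrFun (Matrix.eq_zero_of_mulVec_eq_zero (hA'.gA_posDef hgen hx).det_pos.ne' hzero)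

theorem IsTangencyLift.exists_reducedFrame [IsManifold (𝓡 r) ∞ M] (hn : n = r + k)
    {Y : M → Ambient n} (hY : IsTangencyLift r f gen univ Y) (x : M) :
    ∃ (W : Set M) (A : FrameField n r k M), x ∈ W ∧ IsReducedFrame f gen (screen r f gen Y) W A := by
  obtain ⟨W, A, hx, -, hA, hAP⟩ := hY.exists_adaptedFrame hgen hrank hn (mem_univ x)
  obtain ⟨A', hA', hOP, hpol⟩ := hA.exists_polar hgen hrank hn
  refine ⟨W, A', hx, hA', fun u hu p => ?_, hpol⟩
  rw [(hOP _ hu).2]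
  exact Submodule.mem_sup_right ((hAP _ hu).2 p)

end Screen
end DeSitter

end

noncomputable section
namespace DeSitter

/-! ### The induced connection as a Levi-Civita connection -/

section InducedConnection
open Set Topology Module Matrix Bundle
variable {n r k : ℕ}
  {U : Type*} [TopologicalSpace U] [ChartedSpace (EuclideanSpace ℝ (Fin n)) U]
  {M : Type*} [TopologicalSpace M] [ChartedSpace (EuclideanSpace ℝ (Fin r)) M]
  [IsManifold (𝓡 r) ∞ M]
  {f : U → ℙ ℝ (Ambient n)} {gen : U → M} {W : Set M} {Y : M → Ambient n}

omit [IsManifold (𝓡 r) ∞ M] in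
theorem theta_apply (A : FrameField n r k M) (q p : Fin r) (x : M) (v : TangentSpace (𝓡 r) x) :
    theta A q p x v = omega A (ixP q) (ixP p) x v -
      (if q = p then (1 : ℝ) else 0) * omega A ixO ixO x v := rfl

namespace IsSpacelike

/-- The Levi-Civita connection of the metric induced by a spacelike immersion. -/
def connection (h : IsSpacelike r Y univ) : AffineConnection r M where
  toFun := lc Y
  isCovariantDerivativeOnUniv :=
    { add := fun hX hX' _ => h.lc_add (mem_univ _) hX hX'
      leibniz := fun hX hg _ => h.lc_smul_add (mem_univ _) hX hg }

theorem contMDiff_connection (h : IsSpacelike r Y univ) :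
    CovariantDerivative.ContMDiffCovariantDerivative h.connection ∞ where
  contMDiff := ⟨fun {_} hX x _ =>
    (h.contMDiffAt_lc (mem_univ x) (hX.contMDiffAt Filter.univ_mem)).contMDiffWithinAt⟩

theorem torsion_connection (h : IsSpacelike r Y univ) : h.connection.torsion = 0 :=
  (CovariantDerivative.torsion_eq_zero_iff _).2 fun {_ _ x} hX hX' =>
    h.lc_sub_lc (mem_univ x) hX hX'

end IsSpacelike

namespace IsNormalizedLift

variable {A : FrameField n r k M} {x : M} {ρ : ℕ}
  (hgen : IsGeneratorFibration (r := r) f gen) (hrank : HasRank f r)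
  (hA : HasTensorRank (r := r) k f gen ρ) (hf : IsLightlikeHypersurface f)
  (hY : IsNormalizedLift r k f gen ρ Y) (h : IsAdaptedFrame f gen W A)
  (hS : IsScreenAdapted gen (screen r f gen Y) W A)

omit [IsManifold (𝓡 r) ∞ M] in
include hgen hrank hY in
theorem isSpacelike : IsSpacelike r Y univ :=
  hY.lift.isSpacelike hgen hrank

include hgen hrank hA hf hY h hS

theorem mvfderiv_eq_sum (hx : x ∈ W) (v : TangentSpace (𝓡 r) x) :
    mvfderiv (𝓡 r) Y x v =
      normFactor A ρ x • ∑ p, omega A ixO (ixP p) x v • A x (ixP p) := by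
  rw [h.clm_apply_eq_sum hgen hrank hx (mvfderiv (𝓡 r) Y x) v, Finset.smul_sum]
  refine Finset.sum_congr rfl fun p _ => ?_
  rw [hY.mvfderiv_dualFrame_of_screen hgen hrank hA hf h hS hx, smul_comm]

theorem mvfderiv_mvfderiv_dualFrame (hx : x ∈ W) (q : Fin r) (v : TangentSpace (𝓡 r) x) :
    mvfderiv (𝓡 r) (fun z => mvfderiv (𝓡 r) Y z (dualFrame A q z)) x v =
      normFactor A ρ x • (dvert A (ixP q) x v - omega A ixO ixO x v • A x (ixP q)) := by
  have h1 : (fun z => mvfderiv (𝓡 r) Y z (dualFrame A q z)) =ᶠ[𝓝 x]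
      normFactor A ρ • fun z => A z (ixP q) :=
    Filter.eventually_of_mem (h.isOpen.mem_nhds hx) fun z hz =>
      hY.mvfderiv_dualFrame_of_screen hgen hrank hA hf h hS hz q
  have h2 := mvfderiv_smul ((h.contMDiffAt_normFactor hgen hrank hA hx).mdifferentiableAt
    (by simp)) (h.mdifferentiableAt hx (ixP q))
  rw [mvfderiv_congr h1, h2]
  have h3 := hY.mvfderiv_normFactor_of_screen hgen hrank hA hf h hS hx v
  have h4 : (normFactor A ρ x • mvfderiv (𝓡 r) (fun z => A z (ixP q)) x +
      (mvfderiv (𝓡 r) (normFactor A ρ) x).smulRight (A x (ixP q))) v =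
      normFactor A ρ x • dvert A (ixP q) x v +
        mvfderiv (𝓡 r) (normFactor A ρ) x v • A x (ixP q) := rfl
  rw [h4, h3]
  module

/-- In a screen-adapted frame the image of `dY` is spanned by the `A_p`, and the other vertices are
orthogonal to it; projecting keeps only the coordinates along the `A_p`. -/
theorem tproj_eq_sum (hx : x ∈ W) (w : Ambient n) :
    tproj r Y x w =
      (normFactor A ρ x)⁻¹ • ∑ p, (A x).coord (ixP p) w • dualFrame A p x := by
  have hc := h.normFactor_ne_zero hgen hA hx
  refine (IsSpacelike.eq_tproj (hY.isSpacelike hgen hrank) (mem_univ x) fun v => ?_).symm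
  have h1 : mvfderiv (𝓡 r) Y x
      ((normFactor A ρ x)⁻¹ • ∑ p, (A x).coord (ixP p) w • dualFrame A p x) =
      ∑ p, (A x).coord (ixP p) w • A x (ixP p) := by
    rw [map_smul, map_sum, Finset.smul_sum]
    refine Finset.sum_congr rfl fun p _ => ?_
    rw [map_smul, hY.mvfderiv_dualFrame_of_screen hgen hrank hA hf h hS hx, smul_comm,
      inv_smul_smul₀ hc]
  rw [h1, hY.mvfderiv_eq_sum hgen hrank hA hf h hS hx, map_smul, map_smul,
    map_sum (form n w), map_sum (form n (∑ p, (A x).coord (ixP p) w • A x (ixP p)))]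
  congr 1
  refine Finset.sum_congr rfl fun q _ => ?_
  rw [map_smul, map_smul, form_comm w, h.form_P hx, form_comm _ (A x (ixP q)), map_sum]
  congr 1
  refine Finset.sum_congr rfl fun p _ => ?_
  rw [map_smul, smul_eq_mul, mul_comm]
  rfl

/-- The coordinates of `dA_q - ω_0^0 A_q` along the `A_p` are the forms `θ_q^p`; the factor `c` from
`dY` cancels that of the projection. -/
theorem lc_dualFrame (hx : x ∈ W) (q : Fin r) (v : TangentSpace (𝓡 r) x) :
    lc Y (dualFrame A q) x v = ∑ p, theta A q p x v • dualFrame A p x := by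
  have hc := h.normFactor_ne_zero hgen hA hx
  rw [lc_apply, hY.mvfderiv_mvfderiv_dualFrame hgen hrank hA hf h hS hx, map_smul,
    hY.tproj_eq_sum hgen hrank hA hf h hS hx, smul_inv_smul₀ hc]
  refine Finset.sum_congr rfl fun p _ => ?_
  rw [map_sub, map_smul, ← omega_apply]
  rw [theta_apply]
  simp [Finsupp.single_apply, mul_comm]

omit h hS in
theorem isInducedConnection :
    IsInducedConnection k f gen (screen r f gen Y) (hY.isSpacelike hgen hrank).connection :=
  fun _ _ h hS _ hx q v => hY.lc_dualFrame hgen hrank hA hf h hS hx q v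

end IsNormalizedLift

/-- The difference of two connections is tensorial, and it vanishes on the fields `e_q`, which span
the tangent space. -/
theorem IsInducedConnection.unique (hgen : IsGeneratorFibration (r := r) f gen)
    (hrank : HasRank f r) {Δ : U → Submodule ℝ (Ambient n)}
    {nab nab' : AffineConnection r M} (h1 : IsInducedConnection k f gen Δ nab)
    (h2 : IsInducedConnection k f gen Δ nab') {A : FrameField n r k M}
    (h : IsAdaptedFrame f gen W A) (hS : IsScreenAdapted gen Δ W A) {x : M} (hx : x ∈ W)
    {X : Π x : M, TangentSpace (𝓡 r) x} (hX : MDifferentiableAt (𝓡 r) (𝓡 r).tangent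
      (fun y => (⟨y, X y⟩ : TangentBundle (𝓡 r) M)) x) : nab' X x = nab X x := by
  have hd := fun {σ : Π x : M, TangentSpace (𝓡 r) x} (hσ : MDifferentiableAt (𝓡 r) (𝓡 r).tangent
      (fun y => (⟨y, σ y⟩ : TangentBundle (𝓡 r) M)) x) =>
    IsCovariantDerivativeOn.difference_apply nab'.isCovariantDerivativeOnUniv
      nab.isCovariantDerivativeOnUniv (mem_univ x) hσ
  have h3 : ∀ q, nab'.isCovariantDerivativeOnUniv.difference nab.isCovariantDerivativeOnUniv x
      (dualFrame A q x) = 0 := fun q => by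
    rw [hd ((h.contMDiffAt_dualFrame hgen hrank hx q).mdifferentiableAt (by simp))]
    ext1 v
    exact sub_eq_zero.2 ((h2 W A h hS x hx q v).trans (h1 W A h hS x hx q v).symm)
  refine sub_eq_zero.1 ((hd hX).symm.trans ?_)
  have h4 := congrArg (nab'.isCovariantDerivativeOnUniv.difference
    nab.isCovariantDerivativeOnUniv x) (h.eq_sum_dualFrame hgen hrank hx (X x))
  rw [h4, map_sum]
  refine Finset.sum_eq_zero fun q _ => ?_
  rw [map_smul, h3, smul_zero]

end InducedConnection
end DeSitter

end

noncomputable section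
namespace DeSitter

/-! ### The Gauss equation -/

section Gauss
open Set Topology Module Matrix Bundle VectorField
variable {n r k : ℕ}
  {U : Type*} [TopologicalSpace U] [ChartedSpace (EuclideanSpace ℝ (Fin n)) U]
  {M : Type*} [TopologicalSpace M] [ChartedSpace (EuclideanSpace ℝ (Fin r)) M]
  [IsManifold (𝓡 r) ∞ M]
  {f : U → ℙ ℝ (Ambient n)} {gen : U → M} {W : Set M} {Y : M → Ambient n} {x : M}
  {X₁ X₂ Z V : Π x : M, TangentSpace (𝓡 r) x}

namespace IsSpacelike

/-- Differentiating the orthogonality of the normal part of `d(dY(Z))(X₂)` to the image of `dY`. -/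
theorem form_lc_lc (h : IsSpacelike r Y W) (hx : x ∈ W)
    (h₁ : ContMDiffAt (𝓡 r) (𝓡 r).tangent ∞
      (fun x => (⟨x, X₁ x⟩ : TangentBundle (𝓡 r) M)) x)
    (hZ : ContMDiffAt (𝓡 r) (𝓡 r).tangent ∞
      (fun x => (⟨x, Z x⟩ : TangentBundle (𝓡 r) M)) x)
    (hV : ContMDiffAt (𝓡 r) (𝓡 r).tangent ∞
      (fun x => (⟨x, V x⟩ : TangentBundle (𝓡 r) M)) x)
    (w : TangentSpace (𝓡 r) x) :
    form n (mvfderiv (𝓡 r) Y x (lc Y (fun p => lc Y Z p (X₁ p)) x w))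
        (mvfderiv (𝓡 r) Y x (V x)) =
      form n (mvfderiv (𝓡 r) (fun p => mvfderiv (𝓡 r) (fun p => mvfderiv (𝓡 r) Y p (Z p)) p
          (X₁ p)) x w) (mvfderiv (𝓡 r) Y x (V x)) +
      form n (mvfderiv (𝓡 r) (fun p => mvfderiv (𝓡 r) Y p (Z p)) x (X₁ x) -
          mvfderiv (𝓡 r) Y x (lc Y Z x (X₁ x)))
        (mvfderiv (𝓡 r) (fun p => mvfderiv (𝓡 r) Y p (V p)) x w) := by
  have hz := contMDiffAt_mvfderiv_apply (h.contMDiffAt hx) hZ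
  have hzX := contMDiffAt_mvfderiv_apply hz h₁
  have hv := (contMDiffAt_mvfderiv_apply (h.contMDiffAt hx) hV).mdifferentiableAt (by simp)
  have hτ : MDifferentiableAt (𝓡 r) 𝓘(ℝ, Ambient n)
      (fun p => mvfderiv (𝓡 r) Y p (lc Y Z p (X₁ p))) x :=
    (contMDiffAt_mvfderiv_apply (h.contMDiffAt hx)
      (h.contMDiffAt_tproj hx hzX)).mdifferentiableAt (by simp)
  have h1 := mvfderiv_form (hzX.mdifferentiableAt (by simp)) hv w
  have h2 := mvfderiv_form hτ hv w
  -- The defining property of the projection, as an identity of functions near `x`, is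
  -- differentiated on both sides.
  have h3 := mvfderiv_congr (r := r) (Filter.eventually_of_mem (h.isOpen.mem_nhds hx) fun p hp =>
    h.form_tproj hp (mvfderiv (𝓡 r) (fun p => mvfderiv (𝓡 r) Y p (Z p)) p (X₁ p)) (V p))
  have h4 := congrArg (fun K : EuclideanSpace ℝ (Fin r) →L[ℝ] ℝ => K w) h3
  have h5 := h2.symm.trans (h4.trans h1)
  rw [lc_apply, h.form_tproj hx, map_sub, LinearMap.sub_apply]
  linear_combination h5

/-- The Gauss equation. -/
theorem form_curvature (h : IsSpacelike r Y univ)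
    (h₁ : ContMDiffAt (𝓡 r) (𝓡 r).tangent ∞
      (fun x => (⟨x, X₁ x⟩ : TangentBundle (𝓡 r) M)) x)
    (h₂ : ContMDiffAt (𝓡 r) (𝓡 r).tangent ∞
      (fun x => (⟨x, X₂ x⟩ : TangentBundle (𝓡 r) M)) x)
    (hZ : ContMDiffAt (𝓡 r) (𝓡 r).tangent ∞
      (fun x => (⟨x, Z x⟩ : TangentBundle (𝓡 r) M)) x)
    (hV : ContMDiffAt (𝓡 r) (𝓡 r).tangent ∞
      (fun x => (⟨x, V x⟩ : TangentBundle (𝓡 r) M)) x) :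
    form n (mvfderiv (𝓡 r) Y x (curvature h.connection X₁ X₂ Z x)) (mvfderiv (𝓡 r) Y x (V x)) =
      form n (mvfderiv (𝓡 r) (fun p => mvfderiv (𝓡 r) Y p (Z p)) x (X₂ x) -
          mvfderiv (𝓡 r) Y x (lc Y Z x (X₂ x)))
        (mvfderiv (𝓡 r) (fun p => mvfderiv (𝓡 r) Y p (V p)) x (X₁ x)) -
      form n (mvfderiv (𝓡 r) (fun p => mvfderiv (𝓡 r) Y p (Z p)) x (X₁ x) -
          mvfderiv (𝓡 r) Y x (lc Y Z x (X₁ x)))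
        (mvfderiv (𝓡 r) (fun p => mvfderiv (𝓡 r) Y p (V p)) x (X₂ x)) := by
  have hz := contMDiffAt_mvfderiv_apply (h.contMDiffAt (mem_univ x)) hZ
  -- The bracket formula is applied to the map `dY(Z)`, so that the twice differentiated terms
  -- cancel against the one with `[X₁, X₂]`.
  have h3 := mvfderiv_mlieBracket hz (h₁.mdifferentiableAt (by simp))
    (h₂.mdifferentiableAt (by simp))
  have h4 := h.form_tproj (mem_univ x) (mvfderiv (𝓡 r) (fun p => mvfderiv (𝓡 r) Y p (Z p)) x
    (mlieBracket (𝓡 r) X₁ X₂ x)) (V x)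
  have h8 := congrArg (fun w => form n w (mvfderiv (𝓡 r) Y x (V x))) h3
  simp only [map_sub, LinearMap.sub_apply] at h8
  have h5 := h.form_lc_lc (mem_univ x) h₂ hZ hV (X₁ x)
  have h6 := h.form_lc_lc (mem_univ x) h₁ hZ hV (X₂ x)
  have h7 : form n (mvfderiv (𝓡 r) Y x (curvature h.connection X₁ X₂ Z x))
      (mvfderiv (𝓡 r) Y x (V x)) =
      form n (mvfderiv (𝓡 r) Y x (lc Y (fun p => lc Y Z p (X₂ p)) x (X₁ x)))
          (mvfderiv (𝓡 r) Y x (V x)) -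
        form n (mvfderiv (𝓡 r) Y x (lc Y (fun p => lc Y Z p (X₁ p)) x (X₂ x)))
          (mvfderiv (𝓡 r) Y x (V x)) -
        form n (mvfderiv (𝓡 r) Y x (lc Y Z x (mlieBracket (𝓡 r) X₁ X₂ x)))
          (mvfderiv (𝓡 r) Y x (V x)) := by
    rw [← LinearMap.sub_apply, ← LinearMap.sub_apply, ← map_sub, ← map_sub, ← map_sub, ← map_sub]
    rfl
  rw [lc_apply Y Z x (mlieBracket (𝓡 r) X₁ X₂ x), h4] at h7
  linear_combination h7 + h5 - h6 - h8

end IsSpacelike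

namespace IsNormalizedLift

variable {A : FrameField n r k M} {ρ : ℕ}
  (hgen : IsGeneratorFibration (r := r) f gen) (hrank : HasRank f r)
  (hA : HasTensorRank (r := r) k f gen ρ) (hf : IsLightlikeHypersurface f)
  (hY : IsNormalizedLift r k f gen ρ Y) (h : IsAdaptedFrame f gen W A)
  (hS : IsScreenAdapted gen (screen r f gen Y) W A)
include hgen hrank hA hf hY h hS

/-- `dY([e_q, e_p])` lies in the span of the points `A_s`. So every other coordinate of the two
second derivatives of `Y` agrees; for `A_α` and `A_0` this gives the symmetry of `a^α_{pq}` and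
`c_{pq}`. -/
theorem omega_P_dualFrame_comm (hx : x ∈ W) {η : FrameIndex r k} (hη : ∀ p, ixP p ≠ η)
    (p q : Fin r) : omega A (ixP p) η x (dualFrame A q x) =
      omega A (ixP q) η x (dualFrame A p x) := by
  have hc := h.normFactor_ne_zero hgen hA hx
  have hd := fun q =>
    (h.contMDiffAt_dualFrame hgen hrank hx q).mdifferentiableAt (by simp)
  have h1 := mvfderiv_mlieBracket
    (IsSpacelike.contMDiffAt (hY.isSpacelike hgen hrank) (mem_univ x)) (hd q) (hd p)
  rw [hY.mvfderiv_mvfderiv_dualFrame hgen hrank hA hf h hS hx,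
    hY.mvfderiv_mvfderiv_dualFrame hgen hrank hA hf h hS hx,
    hY.mvfderiv_eq_sum hgen hrank hA hf h hS hx, ← smul_sub] at h1
  have h2 := congrArg ((A x).coord η) (smul_right_injective _ hc h1)
  simp only [map_sub, map_sum, map_smul, Basis.coord_apply, Basis.repr_self,
    Finsupp.single_eq_of_ne' (hη _), smul_zero, Finset.sum_const_zero, sub_zero] at h2
  exact (sub_eq_zero.1 h2.symm)

/-- Since `dY(Z)` is orthogonal to `A_η`, the derivative can be moved to `A_η`, which shows that
only the value of `Z` at `x` matters. -/
theorem form_mvfderiv_mvfderiv (hx : x ∈ W)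
    (hZ : MDifferentiableAt (𝓡 r) (𝓡 r).tangent
      (fun x => (⟨x, Z x⟩ : TangentBundle (𝓡 r) M)) x) {η : FrameIndex r k}
    (hη : ∀ z ∈ W, ∀ p, form n (A z (ixP p)) (A z η) = 0) (v : TangentSpace (𝓡 r) x) :
    form n (mvfderiv (𝓡 r) (fun p => mvfderiv (𝓡 r) Y p (Z p)) x v) (A x η) =
      normFactor A ρ x * ∑ q, omega A ixO (ixP q) x (Z x) *
        form n (dvert A (ixP q) x v) (A x η) := by
  have hz := mdifferentiableAt_mvfderiv_apply
    (IsSpacelike.contMDiffAt (hY.isSpacelike hgen hrank) (mem_univ x)) hZ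
  have h1 := mvfderiv_form hz (h.mdifferentiableAt hx η) v
  have h2 : (fun p => form n (mvfderiv (𝓡 r) Y p (Z p)) (A p η)) =ᶠ[𝓝 x] fun _ => 0 := by
    filter_upwards [h.isOpen.mem_nhds hx] with p hp
    rw [hY.mvfderiv_eq_sum hgen hrank hA hf h hS hp]
    simp [hη p hp]
  rw [mvfderiv_congr h2, mvfderiv_const] at h1
  have h3 : form n (mvfderiv (𝓡 r) (fun p => mvfderiv (𝓡 r) Y p (Z p)) x v) (A x η) =
      - form n (mvfderiv (𝓡 r) Y x (Z x)) (dvert A η x v) := eq_neg_of_add_eq_zero_left h1.symm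
  rw [h3, hY.mvfderiv_eq_sum hgen hrank hA hf h hS hx]
  simp only [map_smul, map_sum, LinearMap.smul_apply, LinearMap.coe_sum,
    Finset.sum_apply, smul_eq_mul,
    h.form_dvert hx (hη · · _), mul_neg, Finset.sum_neg_distrib]

/-- The normal part of `d(dY(Z))`. -/
theorem mvfderiv_mvfderiv_sub (hx : x ∈ W)
    (hZ : MDifferentiableAt (𝓡 r) (𝓡 r).tangent
      (fun x => (⟨x, Z x⟩ : TangentBundle (𝓡 r) M)) x) (v : TangentSpace (𝓡 r) x) :
    mvfderiv (𝓡 r) (fun p => mvfderiv (𝓡 r) Y p (Z p)) x v -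
        mvfderiv (𝓡 r) Y x (lc Y Z x v) =
      normFactor A ρ x • ∑ q, omega A ixO (ixP q) x (Z x) •
        (omega A (ixP q) ixO x v • A x ixO + (∑ α, omega A (ixP q) (ixA α) x v • A x (ixA α) +
          omega A (ixP q) ixL x v • A x ixL)) := by
  have hc := h.normFactor_ne_zero hgen hA hx
  have hP : ∀ p, form n (mvfderiv (𝓡 r) (fun p => mvfderiv (𝓡 r) Y p (Z p)) x v -
        mvfderiv (𝓡 r) Y x (lc Y Z x v)) (A x (ixP p)) = 0 := fun p => by
    have h1 := IsSpacelike.form_tproj (hY.isSpacelike hgen hrank) (mem_univ x)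
      (mvfderiv (𝓡 r) (fun p => mvfderiv (𝓡 r) Y p (Z p)) x v) (dualFrame A p x)
    rw [hY.mvfderiv_dualFrame_of_screen hgen hrank hA hf h hS hx, map_smul, map_smul] at h1
    rw [map_sub, LinearMap.sub_apply, lc_apply, smul_right_injective _ hc h1, sub_self]
  have hη : ∀ η, (∀ z ∈ W, ∀ p, form n (A z (ixP p)) (A z η) = 0) →
      form n (mvfderiv (𝓡 r) (fun p => mvfderiv (𝓡 r) Y p (Z p)) x v -
        mvfderiv (𝓡 r) Y x (lc Y Z x v)) (A x η) =
      normFactor A ρ x * ∑ q, omega A ixO (ixP q) x (Z x) *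
        form n (dvert A (ixP q) x v) (A x η) := fun η hη => by
    rw [map_sub, LinearMap.sub_apply, hY.form_mvfderiv_mvfderiv hgen hrank hA hf h hS hx hZ hη,
      hY.mvfderiv_eq_sum hgen hrank hA hf h hS hx (lc Y Z x v)]
    simp [hη x hx]
  -- By nondegeneracy it is enough to compare the products with the vertices: those with `A_p`
  -- vanish on both sides, and the others come from the orthogonality of `A_η` to the screen.
  refine sub_eq_zero.1 (eq_zero_of_form_eq_zero fun w => ?_)
  rw [map_sub, LinearMap.sub_apply, sub_eq_zero]
  refine congrArg (fun K : Ambient n →ₗ[ℝ] ℝ => K w) ((A x).ext fun η => ?_)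
  have hN : ∀ η, (∀ p, form n (A x (ixP p)) (A x η) = 0) → ∀ q,
      form n (dvert A (ixP q) x v) (A x η) = form n (omega A (ixP q) ixO x v • A x ixO +
        (∑ α, omega A (ixP q) (ixA α) x v • A x (ixA α) +
          omega A (ixP q) ixL x v • A x ixL)) (A x η) := fun η hη q => by
    rw [dvert_eq A (ixP q) x v]
    simp [hη]
  have hη' : ∀ η, (∀ z ∈ W, ∀ p, form n (A z (ixP p)) (A z η) = 0) →
      form n (mvfderiv (𝓡 r) (fun p => mvfderiv (𝓡 r) Y p (Z p)) x v -
        mvfderiv (𝓡 r) Y x (lc Y Z x v)) (A x η) =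
      form n (normFactor A ρ x • ∑ q, omega A ixO (ixP q) x (Z x) •
        (omega A (ixP q) ixO x v • A x ixO + (∑ α, omega A (ixP q) (ixA α) x v • A x (ixA α) +
          omega A (ixP q) ixL x v • A x ixL))) (A x η) := fun η h0 => by
    rw [hη η h0, map_smul, map_sum, LinearMap.smul_apply, LinearMap.sum_apply, smul_eq_mul]
    simp only [hN η (h0 x hx), map_smul, LinearMap.smul_apply, smul_eq_mul]
  rcases η with _ | p | α | _
  · exact hη' _ fun z hz p => (form_comm _ _).trans (h.form_O_P z hz p)
  · rw [hP, form_comm]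
    simp [form_comm (A x (ixP p)) (A x ixO), h.form_O_P x hx, h.form_P_A x hx, h.form_P_L x hx]
  · exact hη' _ fun z hz p => h.form_P_A z hz p α
  · exact hη' _ fun z hz p => h.form_P_L z hz p

end IsNormalizedLift
end Gauss
end DeSitter

end

noncomputable section
namespace DeSitter

/-! ### The curvature tensor and the Ricci tensor -/

section Curvature
open Set Topology Module Matrix Bundle VectorField
variable {n r k : ℕ}
  {U : Type*} [TopologicalSpace U] [ChartedSpace (EuclideanSpace ℝ (Fin n)) U]
  {M : Type*} [TopologicalSpace M] [ChartedSpace (EuclideanSpace ℝ (Fin r)) M]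
  {f : U → ℙ ℝ (Ambient n)} {gen : U → M} {W : Set M} {Y : M → Ambient n} {x : M}
  {X₁ X₂ Z V : Π x : M, TangentSpace (𝓡 r) x}

/-- Passes from the difference of two terms in the Gauss equation to coefficients alternated in `s,
t`, as in `R^p_{qst}`. -/
theorem sum_skew {ι : Type*} [Fintype ι] (e : ι → ι → ℝ) (u v : ι → ℝ) :
    ∑ s, ∑ t, (e t s - e s t) / 2 * (u s * v t - u t * v s) =
      ∑ s, ∑ t, e s t * (v s * u t) - ∑ s, ∑ t, e s t * (u s * v t) := by
  have h1 : ∑ s, ∑ t, e t s * (u s * v t) = ∑ s, ∑ t, e s t * (v s * u t) := by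
    rw [Finset.sum_comm]; simp only [mul_comm (u _)]
  have h2 : ∑ s, ∑ t, e t s * (u t * v s) = ∑ s, ∑ t, e s t * (u s * v t) := Finset.sum_comm
  calc ∑ s, ∑ t, (e t s - e s t) / 2 * (u s * v t - u t * v s)
      = ∑ s, ∑ t, (1 / 2 * (e t s * (u s * v t)) + 1 / 2 * (e s t * (v s * u t)) -
          (1 / 2 * (e t s * (u t * v s)) + 1 / 2 * (e s t * (u s * v t)))) := by
        refine Finset.sum_congr rfl fun s _ => Finset.sum_congr rfl fun t _ => ?_
        ring
    _ = _ := by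
        simp only [Finset.sum_sub_distrib, Finset.sum_add_distrib, ← Finset.mul_sum, h1, h2]
        ring

theorem sum_skew_delta {ι : Type*} [Fintype ι] [DecidableEq ι] {R : ι → ι → ℝ}
    (hR : ∀ s t, R t s = - R s t) (b : ι → ℝ) (c : ℝ) (p : ι) :
    ∑ s, ∑ t, R s t * (b s * (if t = p then 1 else 0) - b t * (if s = p then 1 else 0)) * c =
      2 * ∑ s, R s p * (c * b s) := by
  have h1 : ∀ s t, R s t * (b s * (if t = p then 1 else 0) - b t * (if s = p then 1 else 0)) * c =
      (if t = p then R s t * (c * b s) else 0) + if s = p then R t s * (c * b t) else 0 :=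
    fun s t => by
      rw [hR s t]
      split_ifs <;> ring
  have h2 : ∑ s, ∑ t, (if s = p then R t s * (c * b t) else 0) = ∑ s, R s p * (c * b s) := by
    rw [Finset.sum_comm]
    simp
  simp only [h1, Finset.sum_add_distrib, h2, Finset.sum_ite_eq', Finset.mem_univ, if_true]
  ring

/-- The tensor `R^p_{qst}` with the first index lowered. -/
theorem sum_gP_mul_curvR (A : FrameField n r k M) (hdet : IsUnit (gP A x).det)
    (p q s t : Fin r) :
    ∑ u, gP A x p u * curvR A x u q s t =
      (-(∑ α, ∑ β, gA A x α β * (aTensor A x α q s * aTensor A x β t p -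
          aTensor A x α q t * aTensor A x β s p)) +
        (cTensor A x q s * gP A x p t - cTensor A x q t * gP A x p s) +
        (gP A x q s * cTensor A x t p - gP A x q t * cTensor A x s p)) / 2 := by
  let B : Fin r → ℝ := fun u =>
    -(∑ α, ∑ β, gA A x α β * ((aTensor A x α q s * aTensor A x β t u -
          aTensor A x α q t * aTensor A x β s u) / 2)) +
      (gP A x q s * cTensor A x t u - gP A x q t * cTensor A x s u) / 2
  have h1 : ∀ u, curvR A x u q s t = ((gP A x)⁻¹ *ᵥ B) u +
      (cTensor A x q s * (if u = t then (1 : ℝ) else 0) -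
        cTensor A x q t * (if u = s then (1 : ℝ) else 0)) / 2 := fun u => by
    have h2 : ∑ α, ∑ β, ∑ v, gA A x α β * (gP A x)⁻¹ u v *
        ((aTensor A x α q s * aTensor A x β t v - aTensor A x α q t * aTensor A x β s v) / 2) =
        ∑ v, (gP A x)⁻¹ u v * ∑ α, ∑ β, gA A x α β * ((aTensor A x α q s * aTensor A x β t v -
          aTensor A x α q t * aTensor A x β s v) / 2) := by
      simp only [Finset.mul_sum]
      refine (Finset.sum_congr rfl fun _ _ => Finset.sum_comm).trans (Finset.sum_comm.trans ?_)
      exact Finset.sum_congr rfl fun _ _ => Finset.sum_congr rfl fun _ _ =>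
        Finset.sum_congr rfl fun _ _ => by ring
    rw [curvR, h2]
    simp only [mulVec, dotProduct, B, mul_add, Finset.sum_add_distrib, mul_neg,
      Finset.sum_neg_distrib]
    ring
  simp only [h1, mul_add, Finset.sum_add_distrib]
  have h3 : ∑ u, gP A x p u * ((gP A x)⁻¹ *ᵥ B) u = B p := by
    have := congrFun (mulVec_mulVec B (gP A x) (gP A x)⁻¹) p
    rwa [mul_nonsing_inv _ hdet, one_mulVec] at this
  have h4 : ∑ u, gP A x p u * ((cTensor A x q s * (if u = t then (1 : ℝ) else 0) -
      cTensor A x q t * (if u = s then (1 : ℝ) else 0)) / 2) =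
      (cTensor A x q s * gP A x p t - cTensor A x q t * gP A x p s) / 2 := by
    simp only [sub_div, mul_sub, Finset.sum_sub_distrib, mul_ite, mul_one, mul_zero, ite_div,
      zero_div, Finset.sum_ite_eq', Finset.mem_univ, if_true]
    ring
  have h5 : ∑ α, ∑ β, gA A x α β * ((aTensor A x α q s * aTensor A x β t p -
      aTensor A x α q t * aTensor A x β s p) / 2) =
      (∑ α, ∑ β, gA A x α β * (aTensor A x α q s * aTensor A x β t p -
        aTensor A x α q t * aTensor A x β s p)) / 2 := by
    simp only [Finset.sum_div, mul_div_assoc]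
  rw [h3, h4]
  simp only [B, h5]
  ring

theorem curvR_swap (A : FrameField n r k M) (p q s t : Fin r) :
    curvR A x p q t s = - curvR A x p q s t := by
  have h : ∑ α, ∑ β, ∑ u, gA A x α β * (gP A x)⁻¹ p u *
      ((aTensor A x α q t * aTensor A x β s u - aTensor A x α q s * aTensor A x β t u) / 2) =
      -∑ α, ∑ β, ∑ u, gA A x α β * (gP A x)⁻¹ p u *
      ((aTensor A x α q s * aTensor A x β t u - aTensor A x α q t * aTensor A x β s u) / 2) := by
    simp only [← Finset.sum_neg_distrib]
    refine Finset.sum_congr rfl fun _ _ => Finset.sum_congr rfl fun _ _ =>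
      Finset.sum_congr rfl fun _ _ => by ring
  have h' : ∑ u, (gP A x)⁻¹ p u *
      ((gP A x q t * cTensor A x s u - gP A x q s * cTensor A x t u) / 2) =
      -∑ u, (gP A x)⁻¹ p u *
      ((gP A x q s * cTensor A x t u - gP A x q t * cTensor A x s u) / 2) := by
    rw [← Finset.sum_neg_distrib]
    exact Finset.sum_congr rfl fun _ _ => by ring
  rw [curvR, curvR, h, h']
  ring

/-- The contraction `R^s_{pqs}` is symmetric. -/
theorem sum_curvR_comm (A : FrameField n r k M) (hdet : IsUnit (gP A x).det)
    (ha : ∀ α p q, aTensor A x α p q = aTensor A x α q p)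
    (hc : ∀ p q, cTensor A x p q = cTensor A x q p) (p q : Fin r) :
    ∑ s, curvR A x s p q s = ∑ s, curvR A x s q p s := by
  have hinv : ∀ s u, (gP A x)⁻¹ s u = (gP A x)⁻¹ u s := fun s u => by
    have := transpose_nonsing_inv (gP A x)
    rw [IsAdaptedFrame.gP_transpose] at this
    exact (congrFun (congrFun this s) u).symm
  have hid : ∀ p u, ∑ s, (gP A x)⁻¹ s u * gP A x p s = if p = u then 1 else 0 := fun p u => by
    have := congrFun (congrFun (mul_nonsing_inv _ hdet) p) u
    rw [mul_apply, one_apply] at this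
    simpa only [mul_comm] using this
  have h1 : ∀ p q, ∑ s, ∑ u, (gP A x)⁻¹ s u *
      ((gP A x p q * cTensor A x s u - gP A x p s * cTensor A x q u) / 2) =
      gP A x p q * (∑ s, ∑ u, (gP A x)⁻¹ s u * cTensor A x s u) / 2 - cTensor A x q p / 2 :=
    fun p q => by
    have h2 : ∑ s, ∑ u, (gP A x)⁻¹ s u * (gP A x p s * cTensor A x q u) = cTensor A x q p := by
      rw [Finset.sum_comm]
      simp only [← mul_assoc, ← Finset.sum_mul, hid]
      simp
    rw [← h2]
    simp only [Finset.mul_sum, Finset.sum_div, ← Finset.sum_sub_distrib]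
    exact Finset.sum_congr rfl fun s _ => Finset.sum_congr rfl fun u _ => by ring
  have h3 : ∀ p q, ∑ s, ∑ α, ∑ β, ∑ u, gA A x α β * (gP A x)⁻¹ s u *
      ((aTensor A x α p q * aTensor A x β s u - aTensor A x α p s * aTensor A x β q u) / 2) =
      ∑ s, ∑ α, ∑ β, ∑ u, gA A x α β * (gP A x)⁻¹ s u *
        (aTensor A x α p q * aTensor A x β s u / 2) -
      ∑ s, ∑ α, ∑ β, ∑ u, gA A x α β * (gP A x)⁻¹ s u *
        (aTensor A x α p s * aTensor A x β q u / 2) := fun p q => by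
    simp only [← Finset.sum_sub_distrib]
    exact Finset.sum_congr rfl fun s _ => Finset.sum_congr rfl fun u _ =>
      Finset.sum_congr rfl fun s _ => Finset.sum_congr rfl fun u _ => by ring
  have h4 : ∑ s, ∑ α, ∑ β, ∑ u, gA A x α β * (gP A x)⁻¹ s u *
        (aTensor A x α p s * aTensor A x β q u / 2) =
      ∑ s, ∑ α, ∑ β, ∑ u, gA A x α β * (gP A x)⁻¹ s u *
        (aTensor A x α q s * aTensor A x β p u / 2) := by
    -- The quadratic term in `a` is symmetric in `p, q`: renaming `(s, α) ↔ (u, β)` exchanges its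
    -- two factors, and both metrics are symmetric.
    have h5 : ∀ G : Fin r → Fin k → Fin k → Fin r → ℝ,
        ∑ s, ∑ α, ∑ β, ∑ u, G s α β u = ∑ s, ∑ α, ∑ β, ∑ u, G u β α s := fun G => by
      have h6 : Function.Involutive fun z : Fin r × Fin k × Fin k × Fin r =>
          (z.2.2.2, z.2.2.1, z.2.1, z.1) := fun _ => rfl
      have h7 := Equiv.sum_comp h6.toPerm fun z : Fin r × Fin k × Fin k × Fin r => G z.1 z.2.1 z.2.2.1 z.2.2.2
      simp only [Function.Involutive.coe_toPerm, Fintype.sum_prod_type] at h7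
      exact h7.symm
    rw [h5]
    refine Finset.sum_congr rfl fun s _ => Finset.sum_congr rfl fun α _ =>
      Finset.sum_congr rfl fun β _ => Finset.sum_congr rfl fun u _ => ?_
    rw [hinv u s, IsAdaptedFrame.gA_symm A x β α]
    ring
  simp only [curvR, Finset.sum_add_distrib, Finset.sum_neg_distrib, h1, h3, h4, if_true]
  simp only [fun α => ha α p q, IsAdaptedFrame.gP_symm A x p q, hc p q]
  rw [← Finset.sum_div, ← Finset.sum_div]
  simp [hc p q]

theorem IsReducedFrame.aTensor_eq_lam {Δ : U → Submodule ℝ (Ambient n)} {A : FrameField n r k M}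
    (h : IsReducedFrame f gen Δ W A) (hx : x ∈ W) (α : Fin k) (p q : Fin r) :
    aTensor A x α p q = lam A x α p q := by
  rw [aTensor, h.polar x hx, zero_mul, sub_zero]

theorem IsReducedFrame.omega_P_A (hgen : IsGeneratorFibration (r := r) f gen)
    (hrank : HasRank f r) {Δ : U → Submodule ℝ (Ambient n)} {A : FrameField n r k M}
    (h : IsReducedFrame f gen Δ W A) (hx : x ∈ W) (p : Fin r) (α : Fin k)
    (v : TangentSpace (𝓡 r) x) : omega A (ixP p) (ixA α) x v =
      ∑ q, aTensor A x α p q * omega A ixO (ixP q) x v := by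
  rw [h.adapted.clm_apply_eq_sum hgen hrank hx]
  refine Finset.sum_congr rfl fun q _ => ?_
  rw [h.aTensor_eq_lam hx, smul_eq_mul, mul_comm]
  rfl

theorem IsAdaptedFrame.omega_P_O (hgen : IsGeneratorFibration (r := r) f gen)
    (hrank : HasRank f r) {A : FrameField n r k M} (h : IsAdaptedFrame f gen W A) (hx : x ∈ W)
    (p : Fin r) (v : TangentSpace (𝓡 r) x) : omega A (ixP p) ixO x v =
      ∑ q, cTensor A x p q * omega A ixO (ixP q) x v := by
  rw [h.clm_apply_eq_sum hgen hrank hx]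
  refine Finset.sum_congr rfl fun q _ => ?_
  rw [smul_eq_mul, mul_comm]
  rfl

/-- The scalar product of `dA_p` with the normal part of `dA_q`. -/
theorem IsReducedFrame.form_normal (hgen : IsGeneratorFibration (r := r) f gen)
    (hrank : HasRank f r) {Δ : U → Submodule ℝ (Ambient n)} {A : FrameField n r k M}
    (h : IsReducedFrame f gen Δ W A) (hx : x ∈ W) (p q : Fin r) (v w : TangentSpace (𝓡 r) x)
    (c : ℝ) :
    form n (omega A (ixP q) ixO x v • A x ixO + (∑ α, omega A (ixP q) (ixA α) x v • A x (ixA α) +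
          omega A (ixP q) ixL x v • A x ixL)) (dvert A (ixP p) x w - c • A x (ixP p)) =
      ∑ s, ∑ t, (-(cTensor A x q s * gP A x p t) - gP A x q s * cTensor A x p t +
          ∑ α, ∑ β, gA A x α β * (aTensor A x α q s * aTensor A x β p t)) *
          (omega A ixO (ixP s) x v * omega A ixO (ixP t) x w) := by
  -- The normal part is orthogonal to `A_p`, so the multiple `c` of `A_p` does not contribute.
  have h1 : form n (omega A (ixP q) ixO x v • A x ixO +
      (∑ α, omega A (ixP q) (ixA α) x v • A x (ixA α) + omega A (ixP q) ixL x v • A x ixL))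
      (A x (ixP p)) = 0 := by
    rw [form_comm]
    simp [form_comm (A x (ixP p)) (A x ixO), h.adapted.form_O_P x hx, h.adapted.form_P_A x hx,
      h.adapted.form_P_L x hx]
  have h2 : ∑ s, ∑ t, (∑ α, ∑ β, gA A x α β * (aTensor A x α q s * aTensor A x β p t)) *
      (omega A ixO (ixP s) x v * omega A ixO (ixP t) x w) =
      ∑ α, omega A (ixP q) (ixA α) x v * ∑ β, gA A x α β * omega A (ixP p) (ixA β) x w := by
    have h3 : ∀ G : Fin r → Fin r → Fin k → Fin k → ℝ,
        ∑ s, ∑ t, ∑ α, ∑ β, G s t α β = ∑ α, ∑ β, ∑ s, ∑ t, G s t α β := fun G => by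
      have h4 := (Equiv.prodComm (Fin r × Fin r) (Fin k × Fin k)).sum_comp
        fun z => G z.2.1 z.2.2 z.1.1 z.1.2
      simp only [Fintype.sum_prod_type, Equiv.prodComm_apply, Prod.swap] at h4
      exact h4
    simp only [Finset.sum_mul, Finset.mul_sum (s := (Finset.univ : Finset (Fin k)))]
    rw [h3]
    refine Finset.sum_congr rfl fun α _ => Finset.sum_congr rfl fun β _ => ?_
    rw [h.omega_P_A hgen hrank hx, h.omega_P_A hgen hrank hx, mul_left_comm, Finset.sum_mul_sum,
      Finset.mul_sum]
    refine Finset.sum_congr rfl fun s _ => ?_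
    rw [Finset.mul_sum]
    exact Finset.sum_congr rfl fun t _ => by ring
  have h4 : ∑ s, ∑ t, cTensor A x q s * gP A x p t *
      (omega A ixO (ixP s) x v * omega A ixO (ixP t) x w) =
      omega A (ixP q) ixO x v * omega A (ixP p) ixL x w := by
    rw [h.adapted.omega_P_O hgen hrank hx, h.adapted.omega_P_L hgen hx, Finset.sum_mul_sum]
    exact Finset.sum_congr rfl fun s _ => Finset.sum_congr rfl fun t _ => by ring
  have h5 : ∑ s, ∑ t, gP A x q s * cTensor A x p t *
      (omega A ixO (ixP s) x v * omega A ixO (ixP t) x w) =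
      omega A (ixP q) ixL x v * omega A (ixP p) ixO x w := by
    rw [h.adapted.omega_P_O hgen hrank hx, h.adapted.omega_P_L hgen hx, Finset.sum_mul_sum]
    exact Finset.sum_congr rfl fun s _ => Finset.sum_congr rfl fun t _ => by ring
  simp only [add_mul, sub_mul, neg_mul, Finset.sum_add_distrib, Finset.sum_sub_distrib,
    Finset.sum_neg_distrib, h2, h4, h5]
  rw [map_sub, map_smul, h1, smul_zero, sub_zero]
  simp only [map_add, map_sum, map_smul, LinearMap.add_apply, LinearMap.sum_apply,
    LinearMap.smul_apply, h.adapted.form_O hgen hx, h.adapted.form_L hx, h.adapted.form_A hx,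
    ← omega_apply, smul_eq_mul]
  ring

theorem sum_apply_single (φ : Fin r → EuclideanSpace ℝ (Fin r) →L[ℝ] ℝ)
    (e : Fin r → EuclideanSpace ℝ (Fin r)) :
    ∑ i, (∑ p, φ p (EuclideanSpace.single i 1) • e p) i = ∑ p, φ p (e p) := by
  have h1 : ∀ p, φ p (e p) = ∑ i, φ p (EuclideanSpace.single i 1) * e p i := fun p => by
    conv_lhs => rw [← (EuclideanSpace.basisFun (Fin r) ℝ).sum_repr (e p)]
    simp [mul_comm]
  simp only [h1]
  rw [Finset.sum_comm]
  simp

/-- Makes the linearity in `v` of the curvature coefficients explicit, as is needed to take a trace.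
-/
theorem exists_clm_eq_sum {ι : Type*} [Fintype ι] (a : ι → ι → ι → ℝ) (b c : ι → ℝ)
    (η : ι → TangentSpace (𝓡 r) x →L[ℝ] ℝ) :
    ∃ φ : TangentSpace (𝓡 r) x →L[ℝ] ℝ, ∀ v, φ v =
      ∑ q, ∑ s, ∑ t, a q s t * (b s * η t v - b t * η s v) * c q := by
  refine ⟨∑ q, ∑ s, ∑ t, (a q s t * c q) • (b s • η t - b t • η s), fun v => ?_⟩
  simp only [_root_.sum_apply, _root_.smul_apply, _root_.sub_apply, smul_eq_mul]
  exact Finset.sum_congr rfl fun q _ => Finset.sum_congr rfl fun s _ =>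
    Finset.sum_congr rfl fun t _ => by ring

/-- The trace of `v ↦ ∑ φ_p(v) e_p` is `∑ φ_p(e_p)`, so the trace in the standard basis can be
evaluated on the dual frame. -/
theorem ricci_eq_sum [IsManifold (𝓡 r) ∞ M] {nab : AffineConnection r M}
    {w u : TangentSpace (𝓡 r) x} {φ : Fin r → TangentSpace (𝓡 r) x →L[ℝ] ℝ}
    {e : Fin r → TangentSpace (𝓡 r) x}
    (h : ∀ v, curvatureAt nab x u v w = ∑ p, φ p v • e p) :
    ricci nab x w u = ∑ p, φ p (e p) := by
  refine Eq.trans ?_ (sum_apply_single φ e)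
  exact Finset.sum_congr rfl fun i _ =>
    congrArg (fun z : EuclideanSpace ℝ (Fin r) => z i) (h _)

namespace IsNormalizedLift

variable [IsManifold (𝓡 r) ∞ M] {A : FrameField n r k M} {ρ : ℕ}
  (hgen : IsGeneratorFibration (r := r) f gen) (hrank : HasRank f r)
  (hA : HasTensorRank (r := r) k f gen ρ) (hf : IsLightlikeHypersurface f)
  (hY : IsNormalizedLift r k f gen ρ Y)
  (h : IsReducedFrame f gen (screen r f gen Y) W A)

include hgen hrank hA hf hY h

theorem aTensor_comm (hx : x ∈ W) (α : Fin k) (p q : Fin r) :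
    aTensor A x α p q = aTensor A x α q p := by
  rw [h.aTensor_eq_lam hx, h.aTensor_eq_lam hx]
  exact hY.omega_P_dualFrame_comm hgen hrank hA hf h.adapted h.screen hx (by simp) p q

theorem cTensor_comm (hx : x ∈ W) (p q : Fin r) : cTensor A x p q = cTensor A x q p :=
  hY.omega_P_dualFrame_comm hgen hrank hA hf h.adapted h.screen hx (by simp) p q

/-- The Gauss equation with `V = e_p`: both factors are then explicit in the frame, each carrying
one factor `c`. -/
theorem form_curvature_dualFrame (hx : x ∈ W)
    (h₁ : ContMDiffAt (𝓡 r) (𝓡 r).tangent ∞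
      (fun x => (⟨x, X₁ x⟩ : TangentBundle (𝓡 r) M)) x)
    (h₂ : ContMDiffAt (𝓡 r) (𝓡 r).tangent ∞
      (fun x => (⟨x, X₂ x⟩ : TangentBundle (𝓡 r) M)) x)
    (hZ : ContMDiffAt (𝓡 r) (𝓡 r).tangent ∞
      (fun x => (⟨x, Z x⟩ : TangentBundle (𝓡 r) M)) x) (p : Fin r) :
    form n (mvfderiv (𝓡 r) Y x
        (curvature (hY.isSpacelike hgen hrank).connection X₁ X₂ Z x))
        (mvfderiv (𝓡 r) Y x (dualFrame A p x)) =
      normFactor A ρ x ^ 2 * ∑ q, omega A ixO (ixP q) x (Z x) * ∑ s, ∑ t,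
        (∑ u, gP A x p u * curvR A x u q s t) *
          (omega A ixO (ixP s) x (X₁ x) * omega A ixO (ixP t) x (X₂ x) -
            omega A ixO (ixP t) x (X₁ x) * omega A ixO (ixP s) x (X₂ x)) := by
  have hN : ∀ v w, form n (mvfderiv (𝓡 r) (fun p => mvfderiv (𝓡 r) Y p (Z p)) x v -
          mvfderiv (𝓡 r) Y x (lc Y Z x v))
        (mvfderiv (𝓡 r) (fun z => mvfderiv (𝓡 r) Y z (dualFrame A p z)) x w) =
      normFactor A ρ x ^ 2 * ∑ q, omega A ixO (ixP q) x (Z x) * ∑ s, ∑ t,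
        (-(cTensor A x q s * gP A x p t) - gP A x q s * cTensor A x p t +
          ∑ α, ∑ β, gA A x α β * (aTensor A x α q s * aTensor A x β p t)) *
          (omega A ixO (ixP s) x v * omega A ixO (ixP t) x w) := fun v w => by
    rw [hY.mvfderiv_mvfderiv_sub hgen hrank hA hf h.adapted h.screen hx
        (hZ.mdifferentiableAt (by simp)),
      hY.mvfderiv_mvfderiv_dualFrame hgen hrank hA hf h.adapted h.screen hx, map_smul,
      map_smul (form n), LinearMap.smul_apply, map_sum, LinearMap.sum_apply, smul_eq_mul,
      smul_eq_mul, ← mul_assoc, ← pow_two]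
    congr 1
    refine Finset.sum_congr rfl fun q _ => ?_
    rw [map_smul, LinearMap.smul_apply, smul_eq_mul, h.form_normal hgen hrank hx]
  have hL := fun q => sum_skew (fun s t => -(cTensor A x q s * gP A x p t) -
    gP A x q s * cTensor A x p t +
      ∑ α, ∑ β, gA A x α β * (aTensor A x α q s * aTensor A x β p t))
    (fun s => omega A ixO (ixP s) x (X₁ x)) fun s => omega A ixO (ixP s) x (X₂ x)
  -- The symmetry of `a` and `c_{pq}` brings the lowered tensor to the index order of the Gauss
  -- equation.
  have hR : ∀ q s t, ∑ u, gP A x p u * curvR A x u q s t =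
      ((-(cTensor A x q t * gP A x p s) - gP A x q t * cTensor A x p s +
        ∑ α, ∑ β, gA A x α β * (aTensor A x α q t * aTensor A x β p s)) -
       (-(cTensor A x q s * gP A x p t) - gP A x q s * cTensor A x p t +
        ∑ α, ∑ β, gA A x α β * (aTensor A x α q s * aTensor A x β p t))) / 2 := fun q s t => by
    rw [sum_gP_mul_curvR A (h.adapted.gP_posDef hgen hx).det_pos.ne'.isUnit]
    simp only [hY.aTensor_comm hgen hrank hA hf h hx _ _ p,
      hY.cTensor_comm hgen hrank hA hf h hx _ p, mul_sub, Finset.sum_sub_distrib]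
    ring
  rw [IsSpacelike.form_curvature (hY.isSpacelike hgen hrank) h₁ h₂ hZ
    (h.adapted.contMDiffAt_dualFrame hgen hrank hx p), hN, hN, ← mul_sub,
    ← Finset.sum_sub_distrib]
  congr 1
  refine Finset.sum_congr rfl fun q _ => ?_
  rw [← mul_sub, ← hL]
  simp only [hR]

/-- The curvature of the induced connection in a reduced frame. -/
theorem curvature_eq (hx : x ∈ W)
    (h₁ : ContMDiffAt (𝓡 r) (𝓡 r).tangent ∞
      (fun x => (⟨x, X₁ x⟩ : TangentBundle (𝓡 r) M)) x)
    (h₂ : ContMDiffAt (𝓡 r) (𝓡 r).tangent ∞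
      (fun x => (⟨x, X₂ x⟩ : TangentBundle (𝓡 r) M)) x)
    (hZ : ContMDiffAt (𝓡 r) (𝓡 r).tangent ∞
      (fun x => (⟨x, Z x⟩ : TangentBundle (𝓡 r) M)) x) :
    curvature (hY.isSpacelike hgen hrank).connection X₁ X₂ Z x =
      ∑ p, (∑ q, ∑ s, ∑ t, curvR A x p q s t *
        (omega A ixO (ixP s) x (X₁ x) * omega A ixO (ixP t) x (X₂ x) -
          omega A ixO (ixP t) x (X₁ x) * omega A ixO (ixP s) x (X₂ x)) *
        omega A ixO (ixP q) x (Z x)) • dualFrame A p x := by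
  have hsp := hY.isSpacelike hgen hrank
  set K : Fin r → ℝ := fun p => ∑ q, ∑ s, ∑ t, curvR A x p q s t *
        (omega A ixO (ixP s) x (X₁ x) * omega A ixO (ixP t) x (X₂ x) -
          omega A ixO (ixP t) x (X₁ x) * omega A ixO (ixP s) x (X₂ x)) *
        omega A ixO (ixP q) x (Z x) with hK
  have h1 : mvfderiv (𝓡 r) Y x (∑ p, K p • dualFrame A p x) =
      normFactor A ρ x • ∑ p, K p • A x (ixP p) := by
    rw [map_sum, Finset.smul_sum]
    refine Finset.sum_congr rfl fun p _ => ?_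
    rw [map_smul, hY.mvfderiv_dualFrame_of_screen hgen hrank hA hf h.adapted h.screen hx,
      smul_comm]
  have h2 : ∀ p, form n (mvfderiv (𝓡 r) Y x (∑ p, K p • dualFrame A p x))
      (mvfderiv (𝓡 r) Y x (dualFrame A p x)) =
      form n (mvfderiv (𝓡 r) Y x
        (curvature (hY.isSpacelike hgen hrank).connection X₁ X₂ Z x))
        (mvfderiv (𝓡 r) Y x (dualFrame A p x)) := fun p => by
    rw [hY.form_curvature_dualFrame hgen hrank hA hf h hx h₁ h₂ hZ, h1,
      hY.mvfderiv_dualFrame_of_screen hgen hrank hA hf h.adapted h.screen hx, form_comm,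
      map_smul (form n), LinearMap.smul_apply, map_smul, map_sum, smul_eq_mul, smul_eq_mul,
      ← mul_assoc, ← pow_two]
    congr 1
    have h3 : ∀ u, form n (A x (ixP p)) (K u • A x (ixP u)) = gP A x p u * K u := fun u => by
      rw [map_smul, smul_eq_mul, mul_comm]; rfl
    simp only [h3]
    simp only [hK, Finset.mul_sum, Finset.sum_mul]
    rw [Finset.sum_comm]
    refine Finset.sum_congr rfl fun q _ => ?_
    rw [Finset.sum_comm]
    refine Finset.sum_congr rfl fun s _ => ?_
    rw [Finset.sum_comm]
    refine Finset.sum_congr rfl fun t _ => Finset.sum_congr rfl fun u _ => ?_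
    ring
  have h4 : ∀ v, form n (mvfderiv (𝓡 r) Y x (∑ p, K p • dualFrame A p x))
      (mvfderiv (𝓡 r) Y x v) =
      form n (mvfderiv (𝓡 r) Y x
        (curvature (hY.isSpacelike hgen hrank).connection X₁ X₂ Z x))
        (mvfderiv (𝓡 r) Y x v) := fun v => by
    have h3 : ∀ a : Ambient n, form n a (mvfderiv (𝓡 r) Y x v) = ∑ p, omega A ixO (ixP p) x v *
        form n a (mvfderiv (𝓡 r) Y x (dualFrame A p x)) := fun a => by
      rw [h.adapted.clm_apply_eq_sum hgen hrank hx (mvfderiv (𝓡 r) Y x) v, map_sum]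
      exact Finset.sum_congr rfl fun p _ => by rw [map_smul, smul_eq_mul]
    rw [h3, h3]
    exact Finset.sum_congr rfl fun p _ => by rw [h2]
  -- The metric is positive definite, so a tangent vector is determined by its products with all
  -- `dY(v)`.
  have h5 := IsSpacelike.eq_tproj hsp (mem_univ x) h4
  rw [IsSpacelike.tproj_mvfderiv hsp (mem_univ x)] at h5
  exact h5.symm

/-- The chosen extensions are smooth at `x`, and the curvature formula asks for no more than that.
-/
theorem curvatureAt_eq (hx : x ∈ W) (u v w : TangentSpace (𝓡 r) x) :
    curvatureAt (hY.isSpacelike hgen hrank).connection x u v w =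
      ∑ p, (∑ q, ∑ s, ∑ t, curvR A x p q s t *
        (omega A ixO (ixP s) x u * omega A ixO (ixP t) x v -
          omega A ixO (ixP t) x u * omega A ixO (ixP s) x v) *
        omega A ixO (ixP q) x w) • dualFrame A p x := by
  have h2 := fun z : TangentSpace (𝓡 r) x => FiberBundle.contMDiffAt_extend (𝓡 r) (k := ∞)
    (EuclideanSpace ℝ (Fin r)) z
  rw [curvatureAt, hY.curvature_eq hgen hrank hA hf h hx (h2 u) (h2 v) (h2 w)]
  simp only [FiberBundle.extend_apply_self]

/-- The factor `2` appears because `R^p_{qst}` is summed over all ordered pairs `s, t` and both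
terms of the wedge product contribute equally. -/
theorem ricci_eq (hx : x ∈ W) (w u : TangentSpace (𝓡 r) x) :
    ricci (hY.isSpacelike hgen hrank).connection x w u =
      2 * ∑ q, ∑ s, (∑ p, curvR A x p q s p) *
        (omega A ixO (ixP q) x w * omega A ixO (ixP s) x u) := by
  have h1 := fun v => hY.curvatureAt_eq hgen hrank hA hf h hx u v w
  obtain ⟨φ, hφ⟩ : ∃ φ : Fin r → TangentSpace (𝓡 r) x →L[ℝ] ℝ, ∀ p v,
      φ p v = ∑ q, ∑ s, ∑ t, curvR A x p q s t *
        (omega A ixO (ixP s) x u * omega A ixO (ixP t) x v -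
          omega A ixO (ixP t) x u * omega A ixO (ixP s) x v) *
        omega A ixO (ixP q) x w := by
    choose φ hφ using fun p => exists_clm_eq_sum (x := x)
      (curvR A x p) (fun s => omega A ixO (ixP s) x u) (fun q => omega A ixO (ixP q) x w)
      fun s => omega A ixO (ixP s) x
    exact ⟨φ, hφ⟩
  have h2 : ricci (hY.isSpacelike hgen hrank).connection x w u = ∑ p, φ p (dualFrame A p x) :=
    ricci_eq_sum fun v => by rw [h1 v]; simp only [hφ]
  have h3 : ∀ p, φ p (dualFrame A p x) = 2 * ∑ q, ∑ s, curvR A x p q s p *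
      (omega A ixO (ixP q) x w * omega A ixO (ixP s) x u) := fun p => by
    rw [hφ p, Finset.mul_sum]
    refine Finset.sum_congr rfl fun q _ => ?_
    simp only [h.adapted.omega_dualFrame hgen hrank hx]
    exact sum_skew_delta (fun s t => curvR_swap A p q s t) _ _ p
  rw [h2, Finset.sum_congr rfl fun p _ => h3 p, ← Finset.mul_sum]
  refine congrArg (2 * ·) (Finset.sum_comm.trans (Finset.sum_congr rfl fun q _ => ?_))
  refine Finset.sum_comm.trans (Finset.sum_congr rfl fun s _ => ?_)
  rw [Finset.sum_mul]

theorem ricci_comm (hx : x ∈ W) (w u : TangentSpace (𝓡 r) x) :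
    ricci (hY.isSpacelike hgen hrank).connection x w u =
      ricci (hY.isSpacelike hgen hrank).connection x u w := by
  have h1 := sum_curvR_comm A (h.adapted.gP_posDef hgen hx).det_pos.ne'.isUnit
    (hY.aTensor_comm hgen hrank hA hf h hx) (hY.cTensor_comm hgen hrank hA hf h hx)
  rw [hY.ricci_eq hgen hrank hA hf h hx, hY.ricci_eq hgen hrank hA hf h hx]
  refine congrArg (2 * ·) (Finset.sum_comm.trans ?_)
  refine Finset.sum_congr rfl fun s _ => Finset.sum_congr rfl fun q _ => ?_
  rw [h1 q s, mul_comm (omega A ixO (ixP q) x w)]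

end IsNormalizedLift

end Curvature
end DeSitter

end

/-! ### The theorem -/

theorem theorem11 {n r m ρ : ℕ} (hn : n = r + m + 1) (hm : 1 ≤ m) (hρ : 1 ≤ ρ)
    {U : Type*} [TopologicalSpace U] [ChartedSpace (EuclideanSpace ℝ (Fin n)) U]
    [IsManifold (𝓡 n) ∞ U]
    {M : Type*} [TopologicalSpace M] [ChartedSpace (EuclideanSpace ℝ (Fin r)) M]
    [IsManifold (𝓡 r) ∞ M]
    (f : U → ℙ ℝ (DeSitter.Ambient n)) (gen : U → M)
    (hf : DeSitter.IsLightlikeHypersurface f)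
    (hrank : DeSitter.HasRank f r)
    (hgen : DeSitter.IsGeneratorFibration (r := r) f gen)
    (hA : DeSitter.HasTensorRank (r := r) (m + 1) f gen ρ) :
    ∃ Δ : U → Submodule ℝ (DeSitter.Ambient n),
      DeSitter.IsInvariantScreen (r := r) (m + 1) f gen ρ Δ ∧
      -- reduced frames exist around every generator
      (∀ x : M, ∃ (W : Set M) (A : DeSitter.FrameField n r (m + 1) M),
        x ∈ W ∧ DeSitter.IsReducedFrame f gen Δ W A) ∧
      -- the screen distribution induces one and only one affine connection, which is smooth
      ∃ nab : DeSitter.AffineConnection r M,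
        CovariantDerivative.ContMDiffCovariantDerivative nab ∞ ∧
        DeSitter.IsInducedConnection (m + 1) f gen Δ nab ∧
        (∀ nab' : DeSitter.AffineConnection r M,
          DeSitter.IsInducedConnection (m + 1) f gen Δ nab' →
          ∀ (X : Π x : M, TangentSpace (𝓡 r) x) (x : M),
            MDifferentiableAt (𝓡 r) (𝓡 r).tangent
              (fun y => (⟨y, X y⟩ : TangentBundle (𝓡 r) M)) x →
            nab' X x = nab X x) ∧
        -- it is torsion-free
        nab.torsion = 0 ∧
        (∀ (W : Set M) (A : DeSitter.FrameField n r (m + 1) M),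
          DeSitter.IsReducedFrame f gen Δ W A → ∀ x ∈ W,
            -- the forms `ω_0^p` are basis forms, with dual frame `e_q`
            (∀ p q, DeSitter.omega A DeSitter.ixO (DeSitter.ixP p) x (DeSitter.dualFrame A q x) =
              if p = q then 1 else 0) ∧
            -- `ω_p^α = a^α_{pq} ω_0^q`, `a^α_{pq} = a^α_{qp}`
            (∀ p α, DeSitter.omega A (DeSitter.ixP p) (DeSitter.ixA α) x =
              ∑ q, DeSitter.aTensor A x α p q •
                DeSitter.omega A DeSitter.ixO (DeSitter.ixP q) x) ∧
            (∀ α p q, DeSitter.aTensor A x α p q = DeSitter.aTensor A x α q p) ∧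
            -- `ω_p^0 = c_{pq} ω_0^q`, `c_{pq} = c_{qp}`
            (∀ p, DeSitter.omega A (DeSitter.ixP p) DeSitter.ixO x =
              ∑ q, DeSitter.cTensor A x p q •
                DeSitter.omega A DeSitter.ixO (DeSitter.ixP q) x) ∧
            (∀ p q, DeSitter.cTensor A x p q = DeSitter.cTensor A x q p) ∧
            -- the curvature forms are `R^p_{qst} ω_0^s ∧ ω_0^t`
            (∀ X Y Z : Π y : M, TangentSpace (𝓡 r) y,
              DeSitter.IsSmoothFieldOn W X → DeSitter.IsSmoothFieldOn W Y → DeSitter.IsSmoothFieldOn W Z →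
              DeSitter.curvature nab X Y Z x =
                ∑ p, (∑ q, ∑ s, ∑ t, DeSitter.curvR A x p q s t *
                  (DeSitter.omega A DeSitter.ixO (DeSitter.ixP s) x (X x) *
                      DeSitter.omega A DeSitter.ixO (DeSitter.ixP t) x (Y x) -
                    DeSitter.omega A DeSitter.ixO (DeSitter.ixP t) x (X x) *
                      DeSitter.omega A DeSitter.ixO (DeSitter.ixP s) x (Y x)) *
                  DeSitter.omega A DeSitter.ixO (DeSitter.ixP q) x (Z x)) •
                DeSitter.dualFrame A p x) ∧
            -- the contraction `R_{pq} = R^s_{pqs}` is symmetric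
            (∀ p q, ∑ s, DeSitter.curvR A x s p q s = ∑ s, DeSitter.curvR A x s q p s)) ∧
        -- the Ricci tensor is symmetric
        (∀ (x : M) (v w : TangentSpace (𝓡 r) x),
          DeSitter.ricci nab x v w = DeSitter.ricci nab x w v) := by
  have hn' : n = r + (m + 1) := hn
  have hρ' : ρ ≠ 0 := by omega
  obtain ⟨Y, hY⟩ := DeSitter.exists_isNormalizedLift hn' hf hgen hrank hρ' hA
  have hsp := hY.isSpacelike hgen hrank
  have hred := fun x => hY.lift.exists_reducedFrame hgen hrank hn' x
  have hind := hY.isInducedConnection hgen hrank hA hf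
  refine ⟨DeSitter.screen r f gen Y, hY.isInvariantScreen hgen hrank hA, hred,
    hsp.connection, hsp.contMDiff_connection, hind, ?_, hsp.torsion_connection, ?_, ?_⟩
  · intro nab' h' X x hX
    obtain ⟨W, A, hx, h⟩ := hred x
    exact hind.unique hgen hrank h' h.adapted h.screen hx hX
  · intro W A h x hx
    have hW := h.adapted.isOpen.mem_nhds hx
    refine ⟨h.adapted.omega_dualFrame hgen hrank hx, fun p α => ?_,
      hY.aTensor_comm hgen hrank hA hf h hx, fun p => ?_,
      hY.cTensor_comm hgen hrank hA hf h hx, fun X X' Z hX hX' hZ => ?_, ?_⟩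
    · ext1 v
      rw [h.omega_P_A hgen hrank hx]
      simp
    · ext1 v
      rw [h.adapted.omega_P_O hgen hrank hx]
      simp
    · exact hY.curvature_eq hgen hrank hA hf h hx (hX.contMDiffAt hW) (hX'.contMDiffAt hW)
        (hZ.contMDiffAt hW)
    · exact DeSitter.sum_curvR_comm A (h.adapted.gP_posDef hgen hx).det_pos.ne'.isUnit
        (hY.aTensor_comm hgen hrank hA hf h hx) (hY.cTensor_comm hgen hrank hA hf h hx)
  · intro x v w
    obtain ⟨W, A, hx, h⟩ := hred x
    exact hY.ricci_comm hgen hrank hA hf h hx v w
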